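/- **Setting.** Let $\Omega\subset\mathbb R^2$ be a bounded domain and $\Gamma\subset\Omega$ a simple closed smooth regular curve that cuts $\Omega$ into two subdomains, $\Omega\setminus\Gamma=\Omega^-\cup\Omega^+$ (disjoint, open, connected). Let $\alpha=\alpha^\pm>0$ and $\beta=\beta^\pm>0$ be constant on $\Omega^\pm$. Write $\operatorname{curl}v=\partial_1v_2-\partial_2v_1$ (weak derivatives). $H(\operatorname{curl};\omega)$ is the space of $v\in L^2(\omega)^2$ with $\operatorname{curl}v\in L^2(\omega)$, $H^1(\operatorname{curl};\omega)$ the space of $v\in H^1(\omega)^2$ with $\operatorname{curl}v\in H^1(\omega)$, and $H_0(\operatorname{curl};\Omega)$ the closure of $C_c^\infty(\Omega)^2$ in $H(\operatorname{curl};\Omega)$ (zero tangential trace). *Mesh.* Let $\mathcal T_h^B$ be a finite conforming mesh of $\Omega$ by nondegenerate closed triangles with all angles at least $\theta>0$. A triangle $K$ is an interface element, $K\in\mathcal T_h^{Bi}$, if its interior meets $\Gamma$; $h_K$ is the diameter of $K$. Assume that no interface element meets $\partial\Omega$ and that for each interface element $K$ with suitably named vertices $A_1,A_2,A_3$ one has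 $\partial K\cap\Gamma=\{D,E\}$ with $D$ in the open edge $A_1A_3$ and $E$ in the open edge $A_2A_3$. The segment $DE$ cuts $K$ into the triangle $K^t=DEA_3$ and the quadrilateral $K^q=A_1A_2ED$; $\mathcal T_h^q$ is the set of all these quadrilaterals. The names are chosen such that the diagonal $A_2D$ is Delaunay, i.e. $\angle A_2A_1D+\angle DEA_2\le\pi$; it splits $K^q$ into $K^q_1=A_1A_2D$ and $K^q_2=DA_2E$. For $\kappa\in\{\alpha,\beta\}$ let $\kappa_h=\kappa$ on non-interface elements, and on $K^q$ (resp. $K^t$) let $\kappa_h$ be the constant value of $\kappa$ at $A_1$ (equivalently at $A_2$) (resp. at $A_3$). *Discrete space and scheme.* Let $V_h$ be the set of $v\in H_0(\operatorname{curl};\Omega)$ that are of the form $a+b\,(x_2,-x_1)^{\mathsf T}$, $a\in\mathbb R^2$, $b\in\mathbb R$, on each non-interface element and on each of the triangles $K^t,K^q_1,K^q_2$, and for which $\operatorname{curl}v$ is constant on each $K^q$. Let $\Pi_{K^q}$ be the $L^2(K^q)$-projection onto constant vector fields, and let $\Pi_h$ be $\Pi_{K^q}$ on each $K^q\in\mathcal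 T_h^q$ and the identity elsewhere. Let $t$ be a unit tangent of $\partial K^q$; traces on $\partial K^q$ are taken from inside $K^q$. For parameters $\gamma_K\in[\gamma_0,\gamma_1]$, $\gamma_0>0$, put $$a_h(v,w)=(\alpha_h\operatorname{curl}v,\operatorname{curl}w)_\Omega+(\beta_h\Pi_hv,\Pi_hw)_\Omega+\sum_{K\in\mathcal T_h^{Bi}}\gamma_Kh_K\big(\beta_h(v-\Pi_{K^q}v)\cdot t,(w-\Pi_{K^q}w)\cdot t\big)_{\partial K^q},$$ $$|||v|||_h^2=\|\alpha_h^{1/2}\operatorname{curl}v\|_{L^2(\Omega)}^2+\|\beta_h^{1/2}\Pi_hv\|_{L^2(\Omega)}^2+\sum_{K\in\mathcal T_h^{Bi}}h_K\|(v-\Pi_{K^q}v)\cdot t\|_{L^2(\partial K^q)}^2 .$$ **Theorem.** There is a constant $C>0$ that depends only on $\Omega$, $\alpha^\pm$, $\beta^\pm$, $\theta$, $\gamma_0$, $\gamma_1$ (in particular not on the mesh size, on the position of the interface relative to the mesh, or on the anisotropy of the subelements) such that the following holds for all $\Gamma$, $\mathcal T_h^B$ and $\gamma_K$ as above. Let $f\in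 L^2(\Omega)^2$ with $f\in H^1(K^q)^2$ for every $K^q\in\mathcal T_h^q$. Let $u\in H_0(\operatorname{curl};\Omega)$, with restrictions to $\Omega^\pm$ in $H^1(\operatorname{curl};\Omega^\pm)$, solve $$(\alpha\operatorname{curl}u,\operatorname{curl}v)_\Omega+(\beta u,v)_\Omega=(f,v)_\Omega\qquad\forall v\in H_0(\operatorname{curl};\Omega),$$ and let $u_h\in V_h$ solve $a_h(u_h,w_h)=(f,\Pi_hw_h)_\Omega$ for all $w_h\in V_h$. Then for every $v_h\in V_h$ the function $\eta_h=u_h-v_h$ belongs to $V_h$ and $$|||\eta_h|||_h\le C\Big[\Big(\sum_{K^q\in\mathcal T_h^q}h_K^2|f|_{H^1(K^q)}^2+\sum_{K^q\in\mathcal T_h^q}h_K\|(v_h-\Pi_hv_h)\cdot t\|_{L^2(\partial K^q)}^2\Big)^{1/2}+\|\alpha\operatorname{curl}u-\alpha_h\operatorname{curl}v_h\|_{L^2(\Omega^-\cup\Omega^+)}+\|\beta u-\beta_h\Pi_hv_h\|_{L^2(\Omega)}\Big].$$ -/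

import Mathlib

open MeasureTheory Set Filter Topology
open scoped ContDiff

noncomputable section

namespace MaxwellVEM

/-- The Euclidean plane. -/
abbrev Plane : Type := EuclideanSpace ℝ (Fin 2)

/-! ### Sobolev spaces through weak derivatives -/

/-- The `L²` norm on `U`. -/
def l2Norm {F : Type*} [NormedAddCommGroup F] (U : Set Plane) (g : Plane → F) : ℝ :=
  √(∫ x in U, ‖g x‖ ^ 2)

/-- The classical partial derivative in the `k`-th coordinate direction. -/
def partialDeriv (k : Fin 2) (φ : Plane → ℝ) (x : Plane) : ℝ :=
  fderiv ℝ φ x (EuclideanSpace.single k 1)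

/-- Compactly supported smooth functions on `U`. -/
def IsTestFunction {F : Type*} [NormedAddCommGroup F] [NormedSpace ℝ F]
    (U : Set Plane) (φ : Plane → F) : Prop :=
  ContDiff ℝ ∞ φ ∧ HasCompactSupport φ ∧ tsupport φ ⊆ U

/-- `d` is the weak `k`-th partial derivative of `g` in the open set `U`. -/
def IsWeakPartial (U : Set Plane) (k : Fin 2) (g d : Plane → ℝ) : Prop :=
  ∀ φ : Plane → ℝ, IsTestFunction U φ →
    ∫ x in U, d x * φ x = - ∫ x in U, g x * partialDeriv k φ x

/-- `c` is the weak scalar curl `∂₁ u₂ - ∂₂ u₁` of `u` in the open set `U`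
(coordinates are numbered `0, 1` in the code): `∫ c φ = ∫ u ⬝ (∂₂ φ, - ∂₁ φ)`. -/
def IsWeakCurl (U : Set Plane) (u : Plane → Plane) (c : Plane → ℝ) : Prop :=
  ∀ φ : Plane → ℝ, IsTestFunction U φ →
    ∫ x in U, c x * φ x = ∫ x in U, (u x 0 * partialDeriv 1 φ x - u x 1 * partialDeriv 0 φ x)

/-- `g` has a square integrable weak `k`-th partial derivative in `U`. -/
def HasL2WeakPartial (U : Set Plane) (k : Fin 2) (g : Plane → ℝ) : Prop :=
  ∃ d : Plane → ℝ, MemLp d 2 (volume.restrict U) ∧ IsWeakPartial U k g d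

/-- `u` has a square integrable weak curl in `U`. -/
def HasL2WeakCurl (U : Set Plane) (u : Plane → Plane) : Prop :=
  ∃ c : Plane → ℝ, MemLp c 2 (volume.restrict U) ∧ IsWeakCurl U u c

open Classical in
/-- The weak partial derivative (unique up to null sets when it exists). -/
def weakPartial (U : Set Plane) (k : Fin 2) (g : Plane → ℝ) : Plane → ℝ :=
  if h : HasL2WeakPartial U k g then h.choose else 0

open Classical in
/-- The weak curl (unique up to null sets when it exists). -/
def weakCurl (U : Set Plane) (u : Plane → Plane) : Plane → ℝ :=
  if h : HasL2WeakCurl U u then h.choose else 0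

/-- The scalar Sobolev space `H¹(U)`. -/
def MemH1 (U : Set Plane) (g : Plane → ℝ) : Prop :=
  MemLp g 2 (volume.restrict U) ∧ ∀ k, HasL2WeakPartial U k g

/-- The vector Sobolev space `H¹(U)²`. -/
def MemH1Vec (U : Set Plane) (u : Plane → Plane) : Prop :=
  ∀ m, MemH1 U (fun x => u x m)

/-- The square of the seminorm `|u|_{H¹(U)}` of a vector field. -/
def h1SeminormSq (U : Set Plane) (u : Plane → Plane) : ℝ :=
  ∑ m, ∑ k, ∫ x in U, (weakPartial U k (fun y => u y m) x) ^ 2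

/-- The space `H(curl; U)`. -/
def MemHCurl (U : Set Plane) (u : Plane → Plane) : Prop :=
  MemLp u 2 (volume.restrict U) ∧ HasL2WeakCurl U u

/-- The space `H¹(curl; U)`. -/
def MemH1Curl (U : Set Plane) (u : Plane → Plane) : Prop :=
  MemH1Vec U u ∧ MemHCurl U u ∧ MemH1 U (weakCurl U u)

/-- The classical curl of a differentiable vector field. -/
def classicalCurl (ψ : Plane → Plane) (x : Plane) : ℝ :=
  partialDeriv 0 (fun y => ψ y 1) x - partialDeriv 1 (fun y => ψ y 0) x

/-- The space `H₀(curl; U)` of fields with zero tangential trace: the closure of the compactly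
supported smooth vector fields in the norm of `H(curl; U)`. -/
def MemH0Curl (U : Set Plane) (u : Plane → Plane) : Prop :=
  MemHCurl U u ∧ ∀ ε : ℝ, 0 < ε → ∃ ψ : Plane → Plane, IsTestFunction U ψ ∧
    l2Norm U (fun x => u x - ψ x) < ε ∧
    l2Norm U (fun x => weakCurl U u x - classicalCurl ψ x) < ε

/-! ### The interface problem -/

/-- A simple closed regular smooth curve. -/
def IsSmoothClosedCurve (Γ : Set Plane) : Prop :=
  ∃ g : ℝ → Plane, ContDiff ℝ ∞ g ∧ Function.Periodic g 1 ∧ InjOn g (Ico 0 1) ∧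
    (∀ t, deriv g t ≠ 0) ∧ range g = Γ

/-- The closed smooth curve `Γ ⊆ Ω` cuts `Ω` into the subdomains `Ωm` and `Ωp`. -/
structure IsInterface (Ω Γ Ωm Ωp : Set Plane) : Prop where
  curve : IsSmoothClosedCurve Γ
  subset : Γ ⊆ Ω
  open_m : IsOpen Ωm
  open_p : IsOpen Ωp
  connected_m : IsConnected Ωm
  connected_p : IsConnected Ωp
  disj : Disjoint Ωm Ωp
  union_eq : Ωm ∪ Ωp = Ω \ Γ

open Classical in
/-- The piecewise constant coefficient with value `cp` in `Ωp` and `cm` in `Ωm`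
(its value on the null set `Γ` is immaterial). -/
def coeff (Ωp : Set Plane) (cm cp : ℝ) (x : Plane) : ℝ := if x ∈ Ωp then cp else cm

/-- `u` solves the weak problem: `u ∈ H₀(curl; Ω)` and
`(α curl u, curl v) + (β u, v) = (f, v)` for all `v ∈ H₀(curl; Ω)`. -/
def IsWeakSolution (Ω : Set Plane) (α β : Plane → ℝ) (f u : Plane → Plane) : Prop :=
  MemH0Curl Ω u ∧ ∀ v, MemH0Curl Ω v →
    (∫ x in Ω, α x * weakCurl Ω u x * weakCurl Ω v x) + (∫ x in Ω, β x * inner ℝ (u x) (v x))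
      = ∫ x in Ω, inner ℝ (f x) (v x)

/-! ### Meshes -/

/-- A conforming triangulation of `Ω` with finitely many closed triangles. -/
structure BackgroundMesh (Ω : Set Plane) where
  n : ℕ
  vert : Fin n → Fin 3 → Plane
  nondegenerate : ∀ i, AffineIndependent ℝ (vert i)
  distinct : Function.Injective fun i => range (vert i)
  cover : (⋃ i, convexHull ℝ (range (vert i))) = closure Ω
  interior_subset : ∀ i, interior (convexHull ℝ (range (vert i))) ⊆ Ω
  conforming : ∀ i j, i ≠ j → convexHull ℝ (range (vert i)) ∩ convexHull ℝ (range (vert j))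
    = convexHull ℝ (range (vert i) ∩ range (vert j))

namespace BackgroundMesh

variable {Ω : Set Plane} (M : BackgroundMesh Ω)

/-- The `i`-th closed triangle of the mesh. -/
def elem (i : Fin M.n) : Set Plane := convexHull ℝ (range (M.vert i))

/-- Shape regularity: all angles of all triangles are at least `θ`. -/
def ShapeRegular (θ : ℝ) : Prop :=
  ∀ i, ∀ a b c : Fin 3, a ≠ b → b ≠ c → a ≠ c →
    θ ≤ EuclideanGeometry.angle (M.vert i a) (M.vert i b) (M.vert i c)

/-- Interface elements: those whose (open) triangle meets the interface. -/
def IsCut (Γ : Set Plane) (i : Fin M.n) : Prop := (interior (M.elem i) ∩ Γ).Nonempty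

open Classical in
/-- The finite set of interface elements. -/
def cutElems (Γ : Set Plane) : Finset (Fin M.n) := Finset.univ.filter fun i => M.IsCut Γ i

end BackgroundMesh

/-- The cutting of the interface elements. On an interface element, the vertices are enumerated
as `A₁, A₂, A₃` (code: `0, 1, 2`) so that the boundary of the element meets `Γ` exactly in a point
`D` of the open edge `A₁A₃` and a point `E` of the open edge `A₂A₃`, and so that `A₂D` is a
Delaunay diagonal of the quadrilateral `A₁A₂ED`: the two angles opposite to it add up to at
most `π`. Interface elements do not meet the boundary of `Ω`. The values of `D` and `E` on other
elements are never used. -/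
structure Cutting {Ω : Set Plane} (M : BackgroundMesh Ω) (Γ : Set Plane) where
  D : Fin M.n → Plane
  E : Fin M.n → Plane
  D_mem : ∀ i, M.IsCut Γ i → D i ∈ openSegment ℝ (M.vert i 0) (M.vert i 2)
  E_mem : ∀ i, M.IsCut Γ i → E i ∈ openSegment ℝ (M.vert i 1) (M.vert i 2)
  boundary_inter : ∀ i, M.IsCut Γ i → frontier (M.elem i) ∩ Γ = {D i, E i}
  interior_elem : ∀ i, M.IsCut Γ i → Disjoint (M.elem i) (frontier Ω)
  delaunay : ∀ i, M.IsCut Γ i →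
    EuclideanGeometry.angle (M.vert i 1) (M.vert i 0) (D i)
      + EuclideanGeometry.angle (D i) (E i) (M.vert i 1) ≤ Real.pi

/-- A field agrees in the interior of the triangle `T` with a member `a + b (x₂, -x₁)` of the
lowest order Nédélec space. -/
def IsND (T : Set Plane) (v : Plane → Plane) : Prop :=
  ∃ (a : Plane) (b : ℝ), ∀ x ∈ interior T, v x = a + b • !₂[x 1, - x 0]

/-- The `L²` projection onto constant fields on `U`, that is, the average over `U`. -/
def proj (U : Set Plane) (v : Plane → Plane) : Plane := ⨍ x in U, v x

/-- The value at a boundary point `x` of the trace of `v` taken from inside `T`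
(for Nédélec fields, the continuous extension to `T`). -/
def innerTrace (T : Set Plane) (v : Plane → Plane) (x : Plane) : Plane :=
  limUnder (𝓝[interior T] x) v

/-- The tangential component `(v - c) ⬝ t` on the edge from `p` to `q`, at the point
`p + s (q - p)`, of the trace from inside `T`. -/
def tangential (T : Set Plane) (p q : Plane) (v : Plane → Plane) (c : Plane) (s : ℝ) : ℝ :=
  inner ℝ (innerTrace T v (AffineMap.lineMap p q s) - c) ((dist p q)⁻¹ • (q - p))

/-- The `L²` inner product on the edge from `p` to `q` of `(v - c) ⬝ t` and `(w - d) ⬝ t`. -/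
def edgeForm (T : Set Plane) (p q : Plane) (v : Plane → Plane) (c : Plane)
    (w : Plane → Plane) (d : Plane) : ℝ :=
  dist p q * ∫ s in (0 : ℝ)..1, tangential T p q v c s * tangential T p q w d s

namespace Cutting

variable {Ω Γ : Set Plane} {M : BackgroundMesh Ω} (P : Cutting M Γ)

/-- The triangular subelement `D E A₃` of an interface element. -/
def triPart (i : Fin M.n) : Set Plane := convexHull ℝ {P.D i, P.E i, M.vert i 2}

/-- The quadrilateral subelement `A₁ A₂ E D` of an interface element. -/
def quad (i : Fin M.n) : Set Plane :=
  convexHull ℝ {M.vert i 0, M.vert i 1, P.E i, P.D i}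

/-- The first triangle `A₁ A₂ D` of the quadrilateral. -/
def quad1 (i : Fin M.n) : Set Plane := convexHull ℝ {M.vert i 0, M.vert i 1, P.D i}

/-- The second triangle `D A₂ E` of the quadrilateral. -/
def quad2 (i : Fin M.n) : Set Plane := convexHull ℝ {P.D i, M.vert i 1, P.E i}

/-- The discrete space `V_h`: fields in `H₀(curl; Ω)` that are lowest order Nédélec fields on
every triangle, with a curl that is constant on each quadrilateral. -/
def Vh : Set (Plane → Plane) :=
  {v | MemH0Curl Ω v ∧
    (∀ i, ¬ M.IsCut Γ i → IsND (M.elem i) v) ∧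
    (∀ i, M.IsCut Γ i → IsND (P.triPart i) v ∧ IsND (P.quad1 i) v ∧ IsND (P.quad2 i) v ∧
      ∃ c : ℝ, ∀ᵐ x ∂(volume.restrict (P.quad i)), weakCurl Ω v x = c)}

open Classical in
/-- The modification of a piecewise constant coefficient `κ` according to the polygonal interface:
on either part of an interface element it takes the value of `κ` at those vertices of the element
that belong to the part; elsewhere it is `κ`. -/
def modified (κ : Plane → ℝ) (x : Plane) : ℝ :=
  if h : ∃ i, M.IsCut Γ i ∧ x ∈ interior (P.quad i) then κ (M.vert h.choose 0)
  else if h : ∃ i, M.IsCut Γ i ∧ x ∈ interior (P.triPart i) then κ (M.vert h.choose 2)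
  else κ x

open Classical in
/-- The operator `Π_h`: the `L²` projection onto constants on each quadrilateral subelement, and
the identity elsewhere. -/
def projH (v : Plane → Plane) (x : Plane) : Plane :=
  if h : ∃ i, M.IsCut Γ i ∧ x ∈ interior (P.quad i) then proj (P.quad h.choose) v else v x

/-- The `L²` inner product of `(v - Π v) ⬝ t` and `(w - Π w) ⬝ t` on the boundary of the
quadrilateral `A₁ A₂ E D`, traces being taken from inside. -/
def bdryForm (i : Fin M.n) (v w : Plane → Plane) : ℝ :=
  let c := proj (P.quad i) v
  let d := proj (P.quad i) w
  edgeForm (P.quad1 i) (M.vert i 0) (M.vert i 1) v c w d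
    + edgeForm (P.quad2 i) (M.vert i 1) (P.E i) v c w d
    + edgeForm (P.quad2 i) (P.E i) (P.D i) v c w d
    + edgeForm (P.quad1 i) (P.D i) (M.vert i 0) v c w d

/-- The bilinear form `a_h` of the virtual element scheme, with stabilization parameters `γ`.
The coefficient `β_h` equals `β (A₁)` on the quadrilateral. -/
def aForm (α β : Plane → ℝ) (γ : Fin M.n → ℝ) (v w : Plane → Plane) : ℝ :=
  (∫ x in Ω, P.modified α x * weakCurl Ω v x * weakCurl Ω w x)
    + (∫ x in Ω, P.modified β x * inner ℝ (P.projH v x) (P.projH w x))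
    + ∑ i ∈ M.cutElems Γ,
        γ i * Metric.diam (M.elem i) * (β (M.vert i 0) * P.bdryForm i v w)

/-- `uh` is a solution of the virtual element scheme. -/
def IsVEMSolution (α β : Plane → ℝ) (γ : Fin M.n → ℝ) (f uh : Plane → Plane) : Prop :=
  uh ∈ P.Vh ∧ ∀ w ∈ P.Vh, P.aForm α β γ uh w = ∫ x in Ω, inner ℝ (f x) (P.projH w x)

/-- The discrete energy norm. -/
def energyNorm (α β : Plane → ℝ) (v : Plane → Plane) : ℝ :=
  √((∫ x in Ω, P.modified α x * weakCurl Ω v x ^ 2)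
    + (∫ x in Ω, P.modified β x * ‖P.projH v x‖ ^ 2)
    + ∑ i ∈ M.cutElems Γ, Metric.diam (M.elem i) * P.bdryForm i v v)

end Cutting

/-- The average is the `L²` projection onto the constants. -/
theorem proj_spec (U : Set Plane) (hU : volume U ≠ ⊤) (v : Plane → Plane)
    (hv : IntegrableOn v U) (p : Plane) :
    ∫ _ in U, inner ℝ (proj U v) p = ∫ x in U, inner ℝ (v x) p := by
  have : IsFiniteMeasure (volume.restrict U) := ⟨by simpa using lt_top_iff_ne_top.2 hU⟩
  have h1 : ∫ _ in U, proj U v = ∫ x in U, v x := by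
    have := integral_average (volume.restrict U) v
    simpa [proj] using this
  have hr : ∫ x in U, inner ℝ (v x) p = inner ℝ (∫ x in U, v x) p := by
    simpa [real_inner_comm] using integral_inner (𝕜 := ℝ) hv p
  have hl : ∫ _ in U, inner ℝ (proj U v) p = inner ℝ (∫ _ in U, proj U v) p := by
    simpa [real_inner_comm] using
      integral_inner (𝕜 := ℝ) (integrable_const (μ := volume.restrict U) (proj U v)) p
  rw [hl, hr, h1]

end MaxwellVEM

end

/-! Put `η = u_h - v_h`. Since `V_h` is a subspace of `H₀(curl; Ω)`, `η` may be tested in both the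
scheme and the continuous problem. Subtracting the two expresses `a_h(η, η)` as the sum of the
consistency terms `(α curl u - α_h curl v_h, curl η)` and `(β u - β_h Π v_h, η)`, the load term `-(f
- Π f, η - Π η)`, and minus the stabilization paired with `v_h`. This is `aForm_error_eq`. It rests
on the orthogonality of `η - Π η` to fields constant on each quadrilateral: `β_h Π v_h` and `Π f`
are such fields there, and off the quadrilaterals `Π_h` is the identity. The form is coercive for
the energy norm (`energyNorm_spec`), so Cauchy–Schwarz finishes the proof once two estimates are
available whose constants do not see the shape of the cut.

The first is a Poincaré inequality for `f` on a quadrilateral that may be arbitrarily thin. For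
convex sets the constant can be taken as a multiple of the diameter (`integral_sub_average_sq_le`):
bound the double integral of `|g x - g y|²` by integrating the gradient along chords.

The second bounds `‖η - Π η‖` by the energy norm (`integral_quad_sub_proj_le`). On each triangle of
the quadrilateral there is a vertex at which two boundary edges of the quadrilateral meet at an
angle between `θ` and `π - θ`: `A₁` in `A₁A₂D`, and `E` in `DA₂E`. The Delaunay condition supplies
the upper bound at `E`. The two tangential components control the vector `η - Π η` at that vertex.
Away from the vertex a Nédélec field changes only by its rotational part, which is its curl times a
length at most `h_K`. Since the area of the triangle is at most the product of the two edge lengths,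
the edge integrals times `h_K` suffice, however short the edges are. -/

noncomputable section

namespace MaxwellVEM

open scoped ENNReal Convolution Pointwise

/-! ### The Poincaré inequality on convex sets, with a constant independent of the shape -/

/-- Jensen's inequality for the square. -/
theorem enorm_integral_sq_le {X : Type*} [MeasurableSpace X] (μ : Measure X)
    [IsProbabilityMeasure μ] (f : X → ℝ) :
    ‖∫ x, f x ∂μ‖ₑ ^ 2 ≤ ∫⁻ x, ‖f x‖ₑ ^ 2 ∂μ := by
  by_cases hf : AEStronglyMeasurable f μ
  · have h1 : ‖∫ x, f x ∂μ‖ₑ ≤ ∫⁻ x, ‖f x‖ₑ ∂μ := enorm_integral_le_lintegral_enorm f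
    have h2 := eLpNorm_le_eLpNorm_of_exponent_le (p := 1) (q := 2) (μ := μ) (by norm_num) hf
    rw [eLpNorm_one_eq_lintegral_enorm] at h2
    have h3 : eLpNorm f 2 μ ^ 2 = ∫⁻ x, ‖f x‖ₑ ^ 2 ∂μ := by
      rw [eLpNorm_eq_lintegral_rpow_enorm_toReal (by norm_num) (by norm_num)]
      rw [← ENNReal.rpow_natCast, ← ENNReal.rpow_mul]
      simp
    rw [← h3]
    gcongr
    exact h1.trans h2
  · rw [integral_non_aestronglyMeasurable hf]
    simp

theorem lintegral_comp_add_smul (c : Plane) {s : ℝ} (hs : 0 < s) {h : Plane → ℝ≥0∞}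
    (hh : Measurable h) :
    ∫⁻ y, h (c + s • y) = ENNReal.ofReal ((s ^ 2)⁻¹) * ∫⁻ y, h y := by
  have h1 := Measure.map_addHaar_smul (volume : Measure Plane) hs.ne'
  have h2 : ∫⁻ y, h (c + s • y) = ∫⁻ z, h (c + z) ∂(Measure.map (s • ·) volume) := by
    rw [lintegral_map (by fun_prop) (by fun_prop)]
  rw [h2, h1, lintegral_smul_measure, lintegral_add_left_eq_self]
  simp [abs_of_pos hs]

/-- The map `y ↦ (1 - s) x + s y` sends `U` into itself by convexity and has Jacobian `s² ≥ 1/4`;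
this is the origin of the factor 4. -/
theorem lintegral_convex_comb_le {U : Set Plane} (hU : MeasurableSet U) (hUc : Convex ℝ U)
    {h : Plane → ℝ≥0∞} (hh : Measurable h) {x : Plane} (hx : x ∈ U) {s : ℝ} (hs : 1 / 2 ≤ s)
    (hs1 : s ≤ 1) :
    ∫⁻ y in U, h ((1 - s) • x + s • y) ≤ 4 * ∫⁻ y in U, h y := by
  have h1 : ∫⁻ y in U, h ((1 - s) • x + s • y)
      ≤ ∫⁻ y, U.indicator h ((1 - s) • x + s • y) := by
    rw [← lintegral_indicator hU]
    refine lintegral_mono fun y => ?_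
    by_cases hy : y ∈ U
    · rw [indicator_of_mem hy, indicator_of_mem]
      exact hUc hx hy (by linarith) (by linarith) (by ring)
    · rw [indicator_of_notMem hy]; exact zero_le
  rw [lintegral_comp_add_smul _ (by linarith) (hh.indicator hU), lintegral_indicator hU] at h1
  refine h1.trans ?_
  gcongr
  rw [ENNReal.ofReal_le_iff_le_toReal (by norm_num)]
  have : (1 : ℝ) / 4 ≤ s ^ 2 := by nlinarith
  calc (s ^ 2)⁻¹ ≤ ((1 : ℝ) / 4)⁻¹ := by gcongr
    _ = _ := by norm_num

/-- The Jacobian in `y` degenerates as `s → 0`, but the double integral is symmetric under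
exchanging `x, y` and `s, 1 - s`, so one of the two variables always has weight at least `1/2`. -/
theorem double_lintegral_convex_comb_le {U : Set Plane} (hU : MeasurableSet U)
    (hUc : Convex ℝ U) {h : Plane → ℝ≥0∞} (hh : Measurable h) {s : ℝ} (hs0 : 0 ≤ s)
    (hs1 : s ≤ 1) :
    ∫⁻ x in U, ∫⁻ y in U, h ((1 - s) • x + s • y) ≤ 4 * volume U * ∫⁻ y in U, h y := by
  have key : ∀ s : ℝ, 1 / 2 ≤ s → s ≤ 1 →
      ∫⁻ x in U, ∫⁻ y in U, h ((1 - s) • x + s • y) ≤ 4 * volume U * ∫⁻ y in U, h y := by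
    intro s hs hs1
    calc ∫⁻ x in U, ∫⁻ y in U, h ((1 - s) • x + s • y)
        ≤ ∫⁻ x in U, 4 * ∫⁻ y in U, h y :=
          setLIntegral_mono' hU fun x hx => lintegral_convex_comb_le hU hUc hh hx hs hs1
      _ = _ := by simp [mul_assoc, mul_comm, mul_left_comm]
  rcases le_total (1 / 2) s with hs | hs
  · exact key s hs hs1
  · rw [lintegral_lintegral_swap (by fun_prop)]
    have := key (1 - s) (by linarith) (by linarith)
    simpa [add_comm] using this

/-- The square of the length of the gradient with components `d 0`, `d 1`. -/
def gradSq (d : Fin 2 → Plane → ℝ) (z : Plane) : ℝ≥0∞ := ∑ k, ‖d k z‖ₑ ^ 2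

theorem fderiv_apply_eq (G : Plane → ℝ) (z v : Plane) :
    fderiv ℝ G z v = v 0 * partialDeriv 0 G z + v 1 * partialDeriv 1 G z := by
  have hv : v = v 0 • EuclideanSpace.single 0 1 + v 1 • EuclideanSpace.single 1 1 := by
    ext i; fin_cases i <;> simp
  conv_lhs => rw [hv]
  simp [partialDeriv]

theorem enorm_sq_eq_ofReal (a : ℝ) : ‖a‖ₑ ^ 2 = ENNReal.ofReal (a ^ 2) := by
  rw [← ofReal_norm, ← ENNReal.ofReal_pow (norm_nonneg _)]; simp

theorem gradSq_eq_ofReal (d : Fin 2 → Plane → ℝ) (z : Plane) :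
    gradSq d z = ENNReal.ofReal (d 0 z ^ 2 + d 1 z ^ 2) := by
  rw [gradSq, Fin.sum_univ_two, enorm_sq_eq_ofReal, enorm_sq_eq_ofReal,
    ENNReal.ofReal_add (sq_nonneg _) (sq_nonneg _)]

theorem enorm_fderiv_apply_sq_le (G : Plane → ℝ) (z v : Plane) {D : ℝ} (hv : ‖v‖ ≤ D) :
    ‖fderiv ℝ G z v‖ₑ ^ 2 ≤ ENNReal.ofReal (D ^ 2) * gradSq (fun k => partialDeriv k G) z := by
  rw [enorm_sq_eq_ofReal, gradSq_eq_ofReal, ← ENNReal.ofReal_mul (sq_nonneg _)]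
  apply ENNReal.ofReal_le_ofReal
  rw [fderiv_apply_eq]
  have h1 : v 0 ^ 2 + v 1 ^ 2 = ‖v‖ ^ 2 := by
    rw [EuclideanSpace.norm_sq_eq, Fin.sum_univ_two]; simp
  have h2 : ‖v‖ ^ 2 ≤ D ^ 2 := by gcongr
  set a := partialDeriv 0 G z
  set b := partialDeriv 1 G z
  nlinarith [sq_nonneg (v 0 * b - v 1 * a), mul_le_mul_of_nonneg_right h2
    (by positivity : 0 ≤ a ^ 2 + b ^ 2)]

theorem continuous_partialDeriv {G : Plane → ℝ} (hG : ContDiff ℝ 1 G) (k : Fin 2) :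
    Continuous (partialDeriv k G) :=
  (hG.continuous_fderiv (by norm_num)).clm_apply continuous_const

theorem measurable_gradSq {d : Fin 2 → Plane → ℝ} (hd : ∀ k, Measurable (d k)) :
    Measurable (gradSq d) := by
  unfold gradSq
  exact Finset.measurable_sum _ fun k _ => (hd k).enorm.pow_const 2

/-- Write `G x - G y` as the integral of the derivative along the chord, apply Jensen in the chord
parameter, and exchange integrals so that, for each fixed parameter, the double integral over convex
combinations is the one already bounded. -/
theorem double_lintegral_le_of_contDiff {U : Set Plane} (hU : MeasurableSet U)
    (hUc : Convex ℝ U) {D : ℝ} (hD : ∀ x ∈ U, ∀ y ∈ U, dist x y ≤ D) {G : Plane → ℝ}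
    (hG : ContDiff ℝ 1 G) :
    ∫⁻ x in U, ∫⁻ y in U, ‖G x - G y‖ₑ ^ 2
      ≤ 4 * ENNReal.ofReal (D ^ 2) * volume U *
        ∫⁻ z in U, gradSq (fun k => partialDeriv k G) z := by
  set H := gradSq (fun k => partialDeriv k G) with hH
  have hHm : Measurable H := measurable_gradSq fun k => (continuous_partialDeriv hG k).measurable
  have hp : ∀ x ∈ U, ∀ y ∈ U, ‖G x - G y‖ₑ ^ 2
      ≤ ∫⁻ s in Ioc (0 : ℝ) 1, ENNReal.ofReal (D ^ 2) * H ((1 - s) • x + s • y) := by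
    intro x hx y hy
    have hder : ∀ s : ℝ, HasDerivAt (fun s : ℝ => G ((1 - s) • x + s • y))
        (fderiv ℝ G ((1 - s) • x + s • y) (y - x)) s := by
      intro s
      have h1 : HasDerivAt (fun s : ℝ => (1 - s) • x + s • y) (y - x) s := by
        have h := (((hasDerivAt_id s).const_sub 1).smul_const x).add
          ((hasDerivAt_id s).smul_const y)
        have e : (-1 : ℝ) • x + (1 : ℝ) • y = y - x := by
          rw [neg_one_smul, one_smul, neg_add_eq_sub]
        rw [e] at h
        exact h
      exact ((hG.differentiable (by norm_num)) _).hasFDerivAt.comp_hasDerivAt s h1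
    have hcont : Continuous fun s : ℝ => fderiv ℝ G ((1 - s) • x + s • y) (y - x) :=
      ((hG.continuous_fderiv (by norm_num)).comp (by fun_prop)).clm_apply continuous_const
    have hint := intervalIntegral.integral_eq_sub_of_hasDerivAt (a := 0) (b := 1)
      (fun s _ => hder s) (hcont.intervalIntegrable _ _)
    simp only [sub_self, zero_smul, one_smul, zero_add, sub_zero, add_zero] at hint
    rw [intervalIntegral.integral_of_le zero_le_one] at hint
    have hprob : IsProbabilityMeasure (volume.restrict (Ioc (0 : ℝ) 1)) := ⟨by simp⟩
    rw [← enorm_neg, neg_sub, ← hint]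
    refine (enorm_integral_sq_le _ _).trans (lintegral_mono fun s => ?_)
    refine enorm_fderiv_apply_sq_le _ _ _ ?_
    rw [← dist_eq_norm]
    exact hD y hy x hx
  calc ∫⁻ x in U, ∫⁻ y in U, ‖G x - G y‖ₑ ^ 2
      ≤ ∫⁻ x in U, ∫⁻ y in U, ∫⁻ s in Ioc (0 : ℝ) 1,
          ENNReal.ofReal (D ^ 2) * H ((1 - s) • x + s • y) :=
        setLIntegral_mono' hU fun x hx => setLIntegral_mono' hU fun y hy => hp x hx y hy
    _ = ∫⁻ x in U, ∫⁻ s in Ioc (0 : ℝ) 1, ∫⁻ y in U,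
          ENNReal.ofReal (D ^ 2) * H ((1 - s) • x + s • y) := by
        refine lintegral_congr fun x => ?_
        rw [lintegral_lintegral_swap (by fun_prop)]
    _ = ∫⁻ s in Ioc (0 : ℝ) 1, ∫⁻ x in U, ∫⁻ y in U,
          ENNReal.ofReal (D ^ 2) * H ((1 - s) • x + s • y) := by
        rw [lintegral_lintegral_swap]
        refine Measurable.aemeasurable ?_
        have : Measurable (fun q : (Plane × ℝ) × Plane =>
            ENNReal.ofReal (D ^ 2) * H ((1 - q.1.2) • q.1.1 + q.1.2 • q.2)) := by fun_prop
        exact this.lintegral_prod_right'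
    _ ≤ ∫⁻ s in Ioc (0 : ℝ) 1, ENNReal.ofReal (D ^ 2) * (4 * volume U * ∫⁻ y in U, H y) := by
        refine setLIntegral_mono' measurableSet_Ioc fun s hs => ?_
        have : ∀ x, ∫⁻ y in U, ENNReal.ofReal (D ^ 2) * H ((1 - s) • x + s • y)
            = ENNReal.ofReal (D ^ 2) * ∫⁻ y in U, H ((1 - s) • x + s • y) := fun x =>
          lintegral_const_mul _ (by fun_prop)
        simp_rw [this]
        rw [lintegral_const_mul' _ _ (by simp)]
        gcongr
        exact double_lintegral_convex_comb_le hU hUc hHm hs.1.le hs.2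
    _ = _ := by
        simp
        ring

/-! ### Mollification: from smooth to weakly differentiable functions -/

/-- Mollification by a normed bump function. -/
def mollify (φ : ContDiffBump (0 : Plane)) (g : Plane → ℝ) (x : Plane) : ℝ :=
  ∫ t, φ.normed volume (x - t) * g t

theorem mollify_eq_convolution (φ : ContDiffBump (0 : Plane)) (g : Plane → ℝ) :
    mollify φ g = (φ.normed volume ⋆[ContinuousLinearMap.lsmul ℝ ℝ, volume] g) := by
  ext x
  rw [convolution_lsmul_swap]
  rfl

theorem contDiff_mollify (φ : ContDiffBump (0 : Plane)) {g : Plane → ℝ}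
    (hg : LocallyIntegrable g) : ContDiff ℝ 1 (mollify φ g) := by
  rw [mollify_eq_convolution]
  exact HasCompactSupport.contDiff_convolution_left _ φ.hasCompactSupport_normed
    (φ.contDiff_normed (n := 1)) hg

theorem partialDeriv_mollify (φ : ContDiffBump (0 : Plane)) {g : Plane → ℝ}
    (hg : LocallyIntegrable g) (k : Fin 2) (x : Plane) :
    partialDeriv k (mollify φ g) x
      = ∫ t, partialDeriv k (φ.normed volume) (x - t) * g t := by
  have h := HasCompactSupport.hasFDerivAt_convolution_left (μ := (volume : Measure Plane))
    (ContinuousLinearMap.lsmul ℝ ℝ) (φ.hasCompactSupport_normed (μ := volume))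
    (φ.contDiff_normed (n := 1)) hg x
  rw [partialDeriv, mollify_eq_convolution, h.fderiv, convolution_eq_swap]
  have hcs : HasCompactSupport (fderiv ℝ (φ.normed (volume : Measure Plane))) :=
    φ.hasCompactSupport_normed.fderiv ℝ
  have hc : Continuous (fderiv ℝ (φ.normed (volume : Measure Plane))) :=
    (φ.contDiff_normed (n := 1)).continuous_fderiv (by norm_num)
  have hi := (hcs.convolutionExists_left (ContinuousLinearMap.precompL Plane
    (ContinuousLinearMap.lsmul ℝ ℝ : ℝ →L[ℝ] ℝ →L[ℝ] ℝ)) hc hg x)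
  have hi' := hi.integrable_swap
  rw [ContinuousLinearMap.integral_apply hi']
  refine integral_congr_ae (Eventually.of_forall fun t => ?_)
  simp [partialDeriv, ContinuousLinearMap.precompL_apply]

theorem partialDeriv_comp_sub {ψ : Plane → ℝ} (hψ : Differentiable ℝ ψ) (k : Fin 2) (x t : Plane) :
    partialDeriv k (fun y => ψ (x - y)) t = - partialDeriv k ψ (x - t) := by
  have h := (hψ (x - t)).hasFDerivAt.comp t ((hasFDerivAt_id t).const_sub x)
  have e : fderiv ℝ (fun y => ψ (x - y)) t = _ := h.fderiv
  rw [partialDeriv, e]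
  simp [partialDeriv]

/-- Mollification commutes with weak derivatives away from the boundary. -/
theorem partialDeriv_mollify_eq_mollify {U : Set Plane} (hU : MeasurableSet U)
    (φ : ContDiffBump (0 : Plane)) {g d : Plane → ℝ} (hg : LocallyIntegrable (U.indicator g))
    {k : Fin 2} (hd : IsWeakPartial U k g d) {x : Plane}
    (hx : Metric.closedBall x φ.rOut ⊆ U) :
    partialDeriv k (mollify φ (U.indicator g)) x = mollify φ (U.indicator d) x := by
  rw [partialDeriv_mollify φ hg]
  -- The reflected, translated bump is supported in the closed ball about `x`, which lies in `U`, so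
  -- it is admissible in the definition of the weak derivative. The reflection produces the sign
  -- that cancels the one from integration by parts.
  have htest : IsTestFunction U (fun y => φ.normed volume (x - y)) := by
    have hs : tsupport (fun y => φ.normed (volume : Measure Plane) (x - y))
        = Metric.closedBall x φ.rOut := by
      have : (fun y => φ.normed (volume : Measure Plane) (x - y))
          = φ.normed volume ∘ (Homeomorph.subLeft x) := rfl
      rw [this, tsupport_comp_eq_preimage, φ.tsupport_normed_eq]
      ext y
      simp [dist_eq_norm, norm_sub_rev]
    refine ⟨?_, ?_, ?_⟩
    · exact (φ.contDiff_normed (n := ⊤)).comp (contDiff_const.sub contDiff_id)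
    · rw [HasCompactSupport, hs]
      exact isCompact_closedBall _ _
    · rw [hs]; exact hx
  have h := hd _ htest
  have e1 : ∀ F : Plane → ℝ, ∀ w : Plane → ℝ,
      ∫ t, F t * U.indicator w t = ∫ t in U, F t * w t := by
    intro F w
    rw [← integral_indicator hU]
    congr 1
    ext t
    by_cases ht : t ∈ U <;> simp [ht]
  rw [mollify, e1, e1]
  have h2 : ∫ t in U, φ.normed volume (x - t) * d t
      = ∫ t in U, d t * φ.normed volume (x - t) := by simp_rw [mul_comm]
  rw [h2, h, ← integral_neg]
  congr 1
  ext t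
  rw [partialDeriv_comp_sub ((φ.contDiff_normed (n := 1)).differentiable (by norm_num))]
  ring

/-- Mollification does not increase the `L²` norm. -/
theorem lintegral_mollify_sq_le (φ : ContDiffBump (0 : Plane)) {d : Plane → ℝ}
    (hd : Measurable d) :
    ∫⁻ x, ‖mollify φ d x‖ₑ ^ 2 ≤ ∫⁻ x, ‖d x‖ₑ ^ 2 := by
  -- Mollification is the mean of `d (x - t)` under the probability measure `ν`; Jensen and
  -- translation invariance then give the bound.
  set ν : Measure Plane := volume.withDensity fun t => ENNReal.ofReal (φ.normed volume t) with hν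
  have hφm : Measurable (φ.normed (volume : Measure Plane)) := φ.continuous_normed.measurable
  have hprob : IsProbabilityMeasure ν := by
    refine ⟨?_⟩
    rw [hν, withDensity_apply _ MeasurableSet.univ, Measure.restrict_univ,
      ← ofReal_integral_eq_lintegral_ofReal φ.integrable_normed
        (Eventually.of_forall fun t => φ.nonneg_normed t), φ.integral_normed]
    simp
  have h1 : ∀ x, mollify φ d x = ∫ t, d (x - t) ∂ν := by
    intro x
    rw [hν, integral_withDensity_eq_integral_toReal_smul (by fun_prop) (by simp),
      mollify_eq_convolution, convolution_lsmul]
    congr 1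
    ext t
    rw [ENNReal.toReal_ofReal (φ.nonneg_normed t)]
  calc ∫⁻ x, ‖mollify φ d x‖ₑ ^ 2 ≤ ∫⁻ x, ∫⁻ t, ‖d (x - t)‖ₑ ^ 2 ∂ν := by
        refine lintegral_mono fun x => ?_
        simp only [h1]
        exact enorm_integral_sq_le _ _
    _ = ∫⁻ t, (∫⁻ x, ‖d (x - t)‖ₑ ^ 2) ∂ν := lintegral_lintegral_swap (by fun_prop)
    _ = ∫⁻ t, (∫⁻ x, ‖d x‖ₑ ^ 2) ∂ν := by
        congr 1
        ext t
        exact lintegral_sub_right_eq_self (fun x => ‖d x‖ₑ ^ 2) t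
    _ = _ := by simp

/-- The points of `U` at distance greater than `δ` from the complement. -/
def erosion (U : Set Plane) (δ : ℝ) : Set Plane := (Uᶜ + Metric.closedBall (0 : Plane) δ)ᶜ

theorem mem_erosion {U : Set Plane} {δ : ℝ} {x : Plane} :
    x ∈ erosion U δ ↔ Metric.closedBall x δ ⊆ U := by
  rw [erosion, mem_compl_iff, Set.mem_add]
  constructor
  · intro h z hz
    by_contra hzU
    refine h ⟨z, hzU, x - z, ?_, by abel⟩
    rw [mem_closedBall_zero_iff, ← dist_eq_norm, dist_comm]
    exact hz
  · rintro h ⟨z, hz, w, hw, rfl⟩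
    refine hz (h ?_)
    rw [mem_closedBall_zero_iff] at hw
    simpa [dist_eq_norm] using hw

theorem isOpen_erosion {U : Set Plane} (hU : IsOpen U) (δ : ℝ) : IsOpen (erosion U δ) :=
  (hU.isClosed_compl.add_right_of_isCompact (isCompact_closedBall _ _)).isOpen_compl

/-- A displacement `w` of the convex combination is realized by displacing both end points by the
same `w`. Convexity is needed because the smooth estimate is applied on the eroded set. -/
theorem convex_erosion {U : Set Plane} (hU : Convex ℝ U) (δ : ℝ) : Convex ℝ (erosion U δ) := by
  intro x hx y hy a b ha hb hab
  rw [mem_erosion] at *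
  intro z hz
  have hw : ‖z - (a • x + b • y)‖ ≤ δ := by rwa [← dist_eq_norm]
  set w := z - (a • x + b • y) with hwdef
  have h1 : x + w ∈ U := hx (by simpa [dist_eq_norm] using hw)
  have h2 : y + w ∈ U := hy (by simpa [dist_eq_norm] using hw)
  have h3 := hU h1 h2 ha hb hab
  have : z = a • (x + w) + b • (y + w) := by
    have : w = a • w + b • w := by rw [← add_smul, hab, one_smul]
    rw [smul_add, smul_add, add_add_add_comm, ← this, hwdef]; abel
  rwa [this]

theorem gradSq_congr {d e : Fin 2 → Plane → ℝ} {z : Plane} (h : ∀ k, d k z = e k z) :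
    gradSq d z = gradSq e z := by
  simp [gradSq, h]

/-- Mollify at scale `δ n` and use the smooth estimate on the erosion, where the gradient of the
mollified function is the mollified weak gradient. The bound is uniform in `n`, and the erosions
exhaust `U`, so Fatou's lemma concludes. -/
theorem double_lintegral_le_of_isWeakPartial {U : Set Plane} (hU : IsOpen U)
    (hUc : Convex ℝ U) {D : ℝ} (hD : ∀ x ∈ U, ∀ y ∈ U, dist x y ≤ D) {g : Plane → ℝ}
    (hg : IntegrableOn g U) (hgm : Measurable (U.indicator g)) {d : Fin 2 → Plane → ℝ}
    (hd : ∀ k, Measurable (U.indicator (d k)))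
    (hgd : ∀ k, IsWeakPartial U k g (d k)) :
    ∫⁻ x in U, ∫⁻ y in U, ‖g x - g y‖ₑ ^ 2
      ≤ 4 * ENNReal.ofReal (D ^ 2) * volume U * ∫⁻ z in U, gradSq d z := by
  set δ : ℕ → ℝ := fun n => 1 / ((n : ℝ) + 1) with hδ
  have hδ0 : ∀ n, 0 < δ n := fun n => by positivity
  have hδt : Tendsto δ atTop (𝓝 0) := tendsto_one_div_add_atTop_nhds_zero_nat
  -- The ratio of outer to inner radius stays equal to 2, as required for almost everywhere
  -- convergence of the mollifications.
  set φ : ℕ → ContDiffBump (0 : Plane) := fun n =>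
    ⟨δ n / 2, δ n, by have := hδ0 n; linarith, by have := hδ0 n; linarith⟩ with hφ
  set V : ℕ → Set Plane := fun n => erosion U (δ n) with hV
  have hVm : ∀ n, MeasurableSet (V n) := fun n => (isOpen_erosion hU _).measurableSet
  have hVU : ∀ n, V n ⊆ U := fun n x hx =>
    mem_erosion.1 hx (Metric.mem_closedBall_self (hδ0 n).le)
  set G : ℕ → Plane → ℝ := fun n => mollify (φ n) (U.indicator g) with hG
  have hgi : LocallyIntegrable (U.indicator g) :=
    ((integrable_indicator_iff hU.measurableSet).2 hg).locallyIntegrable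
  have hGc : ∀ n, ContDiff ℝ 1 (G n) := fun n => contDiff_mollify _ hgi
  have hbound : ∀ n, ∫⁻ x in V n, ∫⁻ y in V n, ‖G n x - G n y‖ₑ ^ 2
      ≤ 4 * ENNReal.ofReal (D ^ 2) * volume U * ∫⁻ z in U, gradSq d z := by
    intro n
    refine (double_lintegral_le_of_contDiff (hVm n) (convex_erosion hUc _)
      (fun x hx y hy => hD x (hVU n hx) y (hVU n hy)) (hGc n)).trans ?_
    have h1 : ∫⁻ z in V n, gradSq (fun k => partialDeriv k (G n)) z
        ≤ ∫⁻ z, gradSq (fun k => mollify (φ n) (U.indicator (d k))) z := by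
      refine le_trans (le_of_eq ?_) (setLIntegral_le_lintegral (V n) _)
      refine setLIntegral_congr_fun (hVm n) fun z hz => ?_
      exact gradSq_congr fun k => partialDeriv_mollify_eq_mollify hU.measurableSet (φ n) hgi
        (hgd k) (mem_erosion.1 hz)
    have hmm : ∀ k, Measurable fun x => ‖mollify (φ n) (U.indicator (d k)) x‖ₑ ^ 2 := by
      intro k
      have hm : StronglyMeasurable (mollify (φ n) (U.indicator (d k))) := by
        unfold mollify
        have : Measurable fun q : Plane × Plane =>
            (φ n).normed volume (q.1 - q.2) * U.indicator (d k) q.2 := by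
          have := (φ n).continuous_normed (μ := volume).measurable
          have := hd k
          fun_prop
        exact this.stronglyMeasurable.integral_prod_right
      exact hm.measurable.enorm.pow_const 2
    have h2 : ∫⁻ z, gradSq (fun k => mollify (φ n) (U.indicator (d k))) z
        ≤ ∫⁻ z in U, gradSq d z := by
      have : ∫⁻ z in U, gradSq d z = ∫⁻ z, gradSq (fun k => U.indicator (d k)) z := by
        rw [← lintegral_indicator hU.measurableSet]
        congr 1
        ext z
        by_cases hz : z ∈ U <;> simp [hz, gradSq]
      rw [this]
      unfold gradSq
      rw [lintegral_finsetSum _ fun k _ => hmm k,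
        lintegral_finsetSum _ fun k _ => (hd k).enorm.pow_const 2]
      exact Finset.sum_le_sum fun k _ => lintegral_mollify_sq_le _ (hd k)
    exact mul_le_mul' (by gcongr; exact hVU n) (h1.trans h2)
  have hmem : ∀ x ∈ U, ∀ᶠ n in atTop, x ∈ V n := by
    intro x hx
    obtain ⟨ε, hε, hεU⟩ := Metric.isOpen_iff.1 hU x hx
    filter_upwards [hδt.eventually (gt_mem_nhds hε)] with n hn
    exact mem_erosion.2 ((Metric.closedBall_subset_ball hn).trans hεU)
  have hconv : ∀ᵐ x, x ∈ U → Tendsto (fun n => G n x) atTop (𝓝 (g x)) := by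
    have h1 := ContDiffBump.ae_convolution_tendsto_right_of_locallyIntegrable (μ := volume)
      (φ := φ) (l := atTop) (K := 2) hδt
      (Eventually.of_forall fun n => by simp only [hφ]; linarith) hgi
    filter_upwards [h1] with x hx hxU
    simp only [← mollify_eq_convolution, indicator_of_mem hxU] at hx
    exact hx
  -- Extending the integrands by zero puts the integrals over the varying sets `V n` on one fixed
  -- product measure, where Fatou applies.
  set F : ℕ → Plane × Plane → ℝ≥0∞ := fun n =>
    (V n ×ˢ V n).indicator fun q => ‖G n q.1 - G n q.2‖ₑ ^ 2 with hF
  have hFm : ∀ n, Measurable (F n) := by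
    intro n
    refine Measurable.indicator ?_ ((hVm n).prod (hVm n))
    have := (hGc n).continuous.measurable
    fun_prop
  set μ := (volume : Measure Plane).restrict U with hμ
  have hFint : ∀ n, ∫⁻ q, F n q ∂(μ.prod μ)
      ≤ 4 * ENNReal.ofReal (D ^ 2) * volume U * ∫⁻ z in U, gradSq d z := by
    intro n
    refine le_trans (le_of_eq ?_) (hbound n)
    rw [lintegral_prod _ (hFm n).aemeasurable, ← lintegral_indicator (hVm n),
      hμ, ← lintegral_indicator hU.measurableSet]
    congr 1
    ext x
    by_cases hx : x ∈ V n
    · rw [indicator_of_mem hx, indicator_of_mem (hVU n hx), ← lintegral_indicator (hVm n),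
        ← lintegral_indicator hU.measurableSet]
      congr 1
      ext y
      by_cases hy : y ∈ V n
      · simp [hF, hx, hy, hVU n hy]
      · simp [hF, hx, hy]
    · rw [indicator_of_notMem hx]
      by_cases hxU : x ∈ U
      · simp [hxU, hF, hx]
      · simp [hxU]
  have hae : ∀ᵐ q ∂(μ.prod μ), ‖U.indicator g q.1 - U.indicator g q.2‖ₑ ^ 2
      ≤ liminf (fun n => F n q) atTop := by
    have hc : ∀ᵐ x ∂μ, x ∈ U ∧ Tendsto (fun n => G n x) atTop (𝓝 (g x)) := by
      rw [hμ, ae_restrict_iff' hU.measurableSet]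
      filter_upwards [hconv] with x hx hxU using ⟨hxU, hx hxU⟩
    have h1 : ∀ᵐ q ∂(μ.prod μ), q.1 ∈ U ∧ Tendsto (fun n => G n q.1) atTop (𝓝 (g q.1)) :=
      Measure.quasiMeasurePreserving_fst.ae hc
    have h2 : ∀ᵐ q ∂(μ.prod μ), q.2 ∈ U ∧ Tendsto (fun n => G n q.2) atTop (𝓝 (g q.2)) :=
      Measure.quasiMeasurePreserving_snd.ae hc
    filter_upwards [h1, h2] with q hq1 hq2
    rw [indicator_of_mem hq1.1, indicator_of_mem hq2.1]
    refine le_of_eq (Eq.symm (Tendsto.liminf_eq ?_))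
    have ht : Tendsto (fun n => ‖G n q.1 - G n q.2‖ₑ ^ 2) atTop
        (𝓝 (‖g q.1 - g q.2‖ₑ ^ 2)) :=
      ((ENNReal.continuous_pow 2).tendsto _).comp ((hq1.2.sub hq2.2).enorm)
    refine ht.congr' ?_
    filter_upwards [hmem _ hq1.1, hmem _ hq2.1] with n hn1 hn2
    rw [hF]
    simp only
    rw [indicator_of_mem (Set.mk_mem_prod hn1 hn2)]
  have hlhs : ∫⁻ x in U, ∫⁻ y in U, ‖g x - g y‖ₑ ^ 2
      = ∫⁻ q, ‖U.indicator g q.1 - U.indicator g q.2‖ₑ ^ 2 ∂(μ.prod μ) := by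
    rw [lintegral_prod _ (by fun_prop)]
    refine setLIntegral_congr_fun hU.measurableSet fun x hx => ?_
    refine setLIntegral_congr_fun hU.measurableSet fun y hy => ?_
    simp [hx, hy]
  rw [hlhs]
  refine (lintegral_mono_ae hae).trans ((lintegral_liminf_le hFm).trans ?_)
  refine (liminf_le_liminf (v := fun _ => 4 * ENNReal.ofReal (D ^ 2) * volume U
    * ∫⁻ z in U, gradSq d z) (Eventually.of_forall hFint)).trans ?_
  simp [hμ]

theorem IsWeakPartial.congr {U : Set Plane} {k : Fin 2} {g d g' d' : Plane → ℝ}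
    (h : IsWeakPartial U k g d) (hg : g =ᵐ[volume.restrict U] g')
    (hd : d =ᵐ[volume.restrict U] d') : IsWeakPartial U k g' d' := by
  intro φ hφ
  have h1 := h φ hφ
  rw [integral_congr_ae (g := fun x => d' x * φ x)
    (by filter_upwards [hd] with x hx; rw [hx]),
    integral_congr_ae (f := fun x => g x * _) (g := fun x => g' x * partialDeriv k φ x)
    (by filter_upwards [hg] with x hx; rw [hx])] at h1
  exact h1

/-- By Jensen, the squared deviation from the mean is at most the mean of `|g x - g y|²` over `y`.
The factor `(volume U)⁻¹` cancels the area in the double integral estimate, so only the diameter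
remains. -/
theorem lintegral_sub_average_sq_le {U : Set Plane} (hU : IsOpen U)
    (hUc : Convex ℝ U) (hne : U.Nonempty) {D : ℝ} (hD : ∀ x ∈ U, ∀ y ∈ U, dist x y ≤ D)
    (hfin : volume U ≠ ⊤) {g : Plane → ℝ}
    (hg : IntegrableOn g U) (hgm : Measurable (U.indicator g)) {d : Fin 2 → Plane → ℝ}
    (hd : ∀ k, Measurable (U.indicator (d k)))
    (hgd : ∀ k, IsWeakPartial U k g (d k)) :
    ∫⁻ x in U, ‖g x - ⨍ y in U, g y‖ₑ ^ 2
      ≤ 4 * ENNReal.ofReal (D ^ 2) * ∫⁻ z in U, gradSq d z := by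
  have hpos : volume U ≠ 0 := (hU.measure_pos _ hne).ne'
  have h0 := double_lintegral_le_of_isWeakPartial hU hUc hD hg hgm hd hgd
  set P : Measure Plane := (volume U)⁻¹ • volume.restrict U with hP
  have hprob : IsProbabilityMeasure P := by
    refine ⟨?_⟩
    rw [hP, Measure.smul_apply, Measure.restrict_apply_univ, smul_eq_mul,
      ENNReal.inv_mul_cancel hpos hfin]
  have hgP : Integrable g P := Integrable.smul_measure hg (ENNReal.inv_ne_top.2 hpos)
  have h1 : ∀ x, ‖g x - ⨍ y in U, g y‖ₑ ^ 2
      ≤ (volume U)⁻¹ * ∫⁻ y in U, ‖g x - g y‖ₑ ^ 2 := by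
    intro x
    have e : g x - ⨍ y in U, g y = ∫ y, (g x - g y) ∂P := by
      rw [integral_sub (integrable_const _) hgP, integral_const, average_eq', hP]
      simp only [Measure.restrict_apply_univ]
      rw [← hP]
      simp
    rw [e]
    refine (enorm_integral_sq_le P _).trans ?_
    rw [hP, lintegral_smul_measure, smul_eq_mul]
  calc ∫⁻ x in U, ‖g x - ⨍ y in U, g y‖ₑ ^ 2
      ≤ ∫⁻ x in U, (volume U)⁻¹ * ∫⁻ y in U, ‖g x - g y‖ₑ ^ 2 := lintegral_mono h1
    _ = (volume U)⁻¹ * ∫⁻ x in U, ∫⁻ y in U, ‖g x - g y‖ₑ ^ 2 :=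
        lintegral_const_mul' _ _ (ENNReal.inv_ne_top.2 hpos)
    _ ≤ (volume U)⁻¹ * (4 * ENNReal.ofReal (D ^ 2) * volume U * ∫⁻ z in U, gradSq d z) := by
        gcongr
    _ = ((volume U)⁻¹ * volume U) * (4 * ENNReal.ofReal (D ^ 2) * ∫⁻ z in U, gradSq d z) := by
        ring
    _ = _ := by rw [ENNReal.inv_mul_cancel hpos hfin, one_mul]

theorem integral_sq_eq_toReal {X : Type*} [MeasurableSpace X] {μ : Measure X} {f : X → ℝ}
    (hf : AEStronglyMeasurable f μ) : ∫ x, f x ^ 2 ∂μ = (∫⁻ x, ‖f x‖ₑ ^ 2 ∂μ).toReal := by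
  rw [integral_eq_lintegral_of_nonneg_ae (Eventually.of_forall fun x => sq_nonneg _)
    (hf.pow 2)]
  simp_rw [enorm_sq_eq_ofReal]

/-- **Poincaré–Wirtinger inequality** on a convex set, with a constant that depends only on the
diameter. -/
theorem integral_sub_average_sq_le {U : Set Plane} (hU : IsOpen U)
    (hUc : Convex ℝ U) (hne : U.Nonempty) {D : ℝ} (hD : ∀ x ∈ U, ∀ y ∈ U, dist x y ≤ D)
    (hfin : volume U ≠ ⊤) {g : Plane → ℝ} (hg : MemLp g 2 (volume.restrict U))
    {d : Fin 2 → Plane → ℝ} (hd : ∀ k, MemLp (d k) 2 (volume.restrict U))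
    (hgd : ∀ k, IsWeakPartial U k g (d k)) :
    ∫ x in U, (g x - ⨍ y in U, g y) ^ 2 ≤ 4 * D ^ 2 * ∑ k, ∫ x in U, d k x ^ 2 := by
  have hf : IsFiniteMeasure (volume.restrict U) := ⟨by simpa using lt_top_iff_ne_top.2 hfin⟩
  have hgi : IntegrableOn g U := hg.integrable (by norm_num)
  -- Fatou and Fubini were used for measurable functions; weak derivatives and averages do not
  -- notice the change of representatives.
  set g' := hg.1.mk g
  have hgg : g =ᵐ[volume.restrict U] g' := hg.1.ae_eq_mk
  set d' : Fin 2 → Plane → ℝ := fun k => (hd k).1.mk (d k)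
  have hdd : ∀ k, d k =ᵐ[volume.restrict U] d' k := fun k => (hd k).1.ae_eq_mk
  have h := lintegral_sub_average_sq_le hU hUc hne hD hfin (g := g') (d := d')
    (hgi.congr hgg) (hg.1.stronglyMeasurable_mk.measurable.indicator hU.measurableSet)
    (fun k => (hd k).1.stronglyMeasurable_mk.measurable.indicator hU.measurableSet)
    (fun k => (hgd k).congr hgg (hdd k))
  have hav : ⨍ y in U, g' y = ⨍ y in U, g y := average_congr hgg.symm
  rw [hav] at h
  have h1 : ∫⁻ x in U, ‖g' x - ⨍ y in U, g y‖ₑ ^ 2 = ∫⁻ x in U, ‖g x - ⨍ y in U, g y‖ₑ ^ 2 :=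
    lintegral_congr_ae (by filter_upwards [hgg] with x hx; rw [hx])
  have h2 : ∫⁻ z in U, gradSq d' z = ∑ k, ∫⁻ z in U, ‖d k z‖ₑ ^ 2 := by
    unfold gradSq
    rw [lintegral_finsetSum _ fun k _ =>
      (hd k).1.stronglyMeasurable_mk.measurable.enorm.pow_const 2]
    refine Finset.sum_congr rfl fun k _ =>
      lintegral_congr_ae (by filter_upwards [hdd k] with x hx; rw [hx])
  have hfink : ∀ k, ∫⁻ z in U, ‖d k z‖ₑ ^ 2 ≠ ⊤ := by
    intro k
    have := (hd k).integrable_sq.2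
    rw [hasFiniteIntegral_iff_enorm] at this
    simpa [enorm_pow] using this.ne
  rw [h1, h2] at h
  rw [integral_sq_eq_toReal (f := fun x => g x - ⨍ y in U, g y)
    (hg.1.sub aestronglyMeasurable_const)]
  have h3 : ∀ k, ∫ x in U, d k x ^ 2 = (∫⁻ z in U, ‖d k z‖ₑ ^ 2).toReal := fun k =>
    integral_sq_eq_toReal (hd k).1
  simp_rw [h3]
  rw [← ENNReal.toReal_sum fun k _ => hfink k]
  have h4 := ENNReal.toReal_mono (ENNReal.mul_ne_top (by finiteness)
    (ENNReal.sum_ne_top.2 fun k _ => hfink k)) h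
  simpa [ENNReal.toReal_mul, ENNReal.toReal_ofReal (sq_nonneg D)] using h4

end MaxwellVEM

namespace MaxwellVEM

/-! ### The `L²` norm -/

theorem l2Norm_nonneg {F : Type*} [NormedAddCommGroup F] (U : Set Plane) (f : Plane → F) :
    0 ≤ l2Norm U f := Real.sqrt_nonneg _

theorem l2Norm_sq {F : Type*} [NormedAddCommGroup F] (U : Set Plane) (f : Plane → F) :
    l2Norm U f ^ 2 = ∫ x in U, ‖f x‖ ^ 2 :=
  Real.sq_sqrt (integral_nonneg fun _ => sq_nonneg _)

theorem l2Norm_eq_toReal {F : Type*} [NormedAddCommGroup F] {U : Set Plane} {f : Plane → F}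
    (hf : MemLp f 2 (volume.restrict U)) :
    l2Norm U f = (eLpNorm f 2 (volume.restrict U)).toReal := by
  rw [hf.eLpNorm_eq_integral_rpow_norm (by norm_num) (by norm_num), ENNReal.toReal_ofReal
    (by positivity), l2Norm, Real.sqrt_eq_rpow]
  norm_num

theorem l2Norm_add_le {F : Type*} [NormedAddCommGroup F] {U : Set Plane} {f g : Plane → F}
    (hf : MemLp f 2 (volume.restrict U)) (hg : MemLp g 2 (volume.restrict U)) :
    l2Norm U (fun x => f x + g x) ≤ l2Norm U f + l2Norm U g := by
  have h := eLpNorm_add_le hf.1 hg.1 (p := 2) (by norm_num)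
  have e : l2Norm U (fun x => f x + g x) = _ := l2Norm_eq_toReal (hf.add hg)
  rw [e, l2Norm_eq_toReal hf, l2Norm_eq_toReal hg, ← ENNReal.toReal_add hf.2.ne hg.2.ne]
  exact ENNReal.toReal_mono (ENNReal.add_ne_top.2 ⟨hf.2.ne, hg.2.ne⟩) h

theorem l2Norm_neg {F : Type*} [NormedAddCommGroup F] (U : Set Plane) (f : Plane → F) :
    l2Norm U (fun x => - f x) = l2Norm U f := by
  simp [l2Norm]

theorem l2Norm_sub_le {F : Type*} [NormedAddCommGroup F] {U : Set Plane} {f g : Plane → F}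
    (hf : MemLp f 2 (volume.restrict U)) (hg : MemLp g 2 (volume.restrict U)) :
    l2Norm U (fun x => f x - g x) ≤ l2Norm U f + l2Norm U g := by
  have h := l2Norm_add_le hf hg.neg
  rw [show l2Norm U (-g) = l2Norm U g from l2Norm_neg U g] at h
  simpa [sub_eq_add_neg] using h

theorem l2Norm_congr {F : Type*} [NormedAddCommGroup F] {U : Set Plane} {f g : Plane → F}
    (h : f =ᵐ[volume.restrict U] g) : l2Norm U f = l2Norm U g := by
  unfold l2Norm
  congr 1
  exact integral_congr_ae (by filter_upwards [h] with x hx; rw [hx])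

theorem abs_integral_inner_le {F : Type*} [NormedAddCommGroup F] [InnerProductSpace ℝ F]
    {U : Set Plane} {f g : Plane → F} (hf : MemLp f 2 (volume.restrict U))
    (hg : MemLp g 2 (volume.restrict U)) :
    |∫ x in U, inner ℝ (f x) (g x)| ≤ l2Norm U f * l2Norm U g := by
  have h1 : |∫ x in U, inner ℝ (f x) (g x)| ≤ ∫ x in U, ‖f x‖ * ‖g x‖ := by
    refine (abs_integral_le_integral_abs).trans (integral_mono_of_nonneg
      (Eventually.of_forall fun x => abs_nonneg _) (hf.norm.integrable_mul hg.norm)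
      (Eventually.of_forall fun x => abs_real_inner_le_norm _ _))
  refine h1.trans ?_
  have h2 := integral_mul_le_Lp_mul_Lq_of_nonneg (μ := volume.restrict U) (f := fun x => ‖f x‖)
    (g := fun x => ‖g x‖) (p := 2) (q := 2) (by constructor <;> norm_num)
    (Eventually.of_forall fun x => norm_nonneg _) (Eventually.of_forall fun x => norm_nonneg _)
    (by simpa using hf.norm) (by simpa using hg.norm)
  simpa [l2Norm, Real.sqrt_eq_rpow] using h2

/-! ### Weak curls -/

theorem MemHCurl.memLp_weakCurl {U : Set Plane} {u : Plane → Plane} (h : MemHCurl U u) :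
    MemLp (weakCurl U u) 2 (volume.restrict U) := by
  rw [weakCurl, dif_pos h.2]
  exact h.2.choose_spec.1

theorem MemHCurl.isWeakCurl {U : Set Plane} {u : Plane → Plane} (h : MemHCurl U u) :
    IsWeakCurl U u (weakCurl U u) := by
  rw [weakCurl, dif_pos h.2]
  exact h.2.choose_spec.2

theorem memLp_coord {μ : Measure Plane} {u : Plane → Plane} (hu : MemLp u 2 μ) (k : Fin 2) :
    MemLp (fun x => u x k) 2 μ :=
  (EuclideanSpace.proj k : Plane →L[ℝ] ℝ).comp_memLp' hu

theorem IsTestFunction.mono {F : Type*} [NormedAddCommGroup F] [NormedSpace ℝ F]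
    {U V : Set Plane} {φ : Plane → F} (h : IsTestFunction U φ) (hUV : U ⊆ V) :
    IsTestFunction V φ := ⟨h.1, h.2.1, h.2.2.trans hUV⟩

theorem IsTestFunction.memLp {F : Type*} [NormedAddCommGroup F] [NormedSpace ℝ F]
    {U : Set Plane} {φ : Plane → F} (h : IsTestFunction U φ) (μ : Measure Plane)
    [IsFiniteMeasureOnCompacts μ] : MemLp φ 2 μ :=
  h.1.continuous.memLp_of_hasCompactSupport h.2.1

theorem IsTestFunction.continuous_partialDeriv {U : Set Plane} {φ : Plane → ℝ}
    (h : IsTestFunction U φ) (k : Fin 2) : Continuous (partialDeriv k φ) :=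
  MaxwellVEM.continuous_partialDeriv (h.1.of_le (by exact_mod_cast le_top)) k

theorem IsTestFunction.hasCompactSupport_partialDeriv {U : Set Plane} {φ : Plane → ℝ}
    (h : IsTestFunction U φ) (k : Fin 2) : HasCompactSupport (partialDeriv k φ) :=
  h.2.1.fderiv_apply ℝ _

theorem IsTestFunction.memLp_partialDeriv {U : Set Plane} {φ : Plane → ℝ}
    (h : IsTestFunction U φ) (k : Fin 2) (μ : Measure Plane)
    [IsFiniteMeasureOnCompacts μ] : MemLp (partialDeriv k φ) 2 μ :=
  (h.continuous_partialDeriv k).memLp_of_hasCompactSupport (h.hasCompactSupport_partialDeriv k)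

theorem IsTestFunction.eq_zero {F : Type*} [NormedAddCommGroup F] [NormedSpace ℝ F]
    {U : Set Plane} {φ : Plane → F} (h : IsTestFunction U φ) {x : Plane} (hx : x ∉ U) :
    φ x = 0 := image_eq_zero_of_notMem_tsupport fun h' => hx (h.2.2 h')

theorem IsTestFunction.partialDeriv_eq_zero {U : Set Plane} {φ : Plane → ℝ}
    (h : IsTestFunction U φ) (k : Fin 2) {x : Plane} (hx : x ∉ U) :
    partialDeriv k φ x = 0 := by
  have : x ∉ tsupport φ := fun h' => hx (h.2.2 h')
  have h1 : x ∉ Function.support (fderiv ℝ φ) := fun h' => this (support_fderiv_subset ℝ h')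
  rw [Function.notMem_support] at h1
  simp [partialDeriv, h1]

theorem IsWeakCurl.integral_eq {U : Set Plane} {u : Plane → Plane} {c : Plane → ℝ}
    (h : IsWeakCurl U u c) {φ : Plane → ℝ} (hφ : IsTestFunction U φ) :
    ∫ x, c x * φ x = ∫ x, (u x 0 * partialDeriv 1 φ x - u x 1 * partialDeriv 0 φ x) := by
  have := h φ hφ
  rwa [setIntegral_eq_integral_of_forall_compl_eq_zero fun x hx => by simp [hφ.eq_zero hx],
    setIntegral_eq_integral_of_forall_compl_eq_zero fun x hx => by
      simp [hφ.partialDeriv_eq_zero _ hx]] at this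

/-- Test functions on `T` are test functions on `U`, so both curls have the same integral against
each of them, and the fundamental lemma of the calculus of variations applies. Allowing `T ⊆ U`
makes a global curl computable locally. -/
theorem IsWeakCurl.ae_eq {U T : Set Plane} (hT : IsOpen T) (hTU : T ⊆ U) {u : Plane → Plane}
    {c c' : Plane → ℝ} (hc : IntegrableOn c T) (hc' : IntegrableOn c' T)
    (h : IsWeakCurl U u c) (h' : IsWeakCurl T u c') :
    ∀ᵐ x ∂(volume.restrict T), c x = c' x := by
  rw [ae_restrict_iff' hT.measurableSet]
  have := IsOpen.ae_eq_zero_of_integral_contDiff_smul_eq_zero (μ := volume) hT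
    (f := fun x => c x - c' x) (hc.sub hc').locallyIntegrableOn ?_
  · filter_upwards [this] with x hx hxT
    exact sub_eq_zero.1 (hx hxT)
  · intro φ h1 h2 h3
    have hφ : IsTestFunction T φ := ⟨h1, h2, h3⟩
    have e1 := h.integral_eq (hφ.mono hTU)
    have e2 := h'.integral_eq hφ
    have hint : ∀ c : Plane → ℝ, IntegrableOn c T → Integrable fun x => c x * φ x := by
      intro c hc
      have : Integrable (fun x => φ x * c x) (volume.restrict T) := by
        obtain ⟨B, hB⟩ := h1.continuous.bounded_above_of_compact_support h2
        exact hc.bdd_mul (c := B) h1.continuous.aestronglyMeasurable (Eventually.of_forall hB)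
      rw [← IntegrableOn, integrableOn_iff_integrable_of_support_subset] at this
      · simpa [mul_comm] using this
      · intro x hx
        by_contra hxT
        exact hx (by simp [hφ.eq_zero hxT])
    calc ∫ x, φ x • (c x - c' x) = ∫ x, (c x * φ x - c' x * φ x) := by
          congr 1; ext x; simp; ring
      _ = 0 := by rw [integral_sub (hint c hc) (hint c' hc'), e1, e2, sub_self]

theorem IsWeakCurl.congr {U : Set Plane} (hU : MeasurableSet U) {u v : Plane → Plane}
    {c : Plane → ℝ} (h : IsWeakCurl U u c) (huv : ∀ x ∈ U, u x = v x) : IsWeakCurl U v c := by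
  intro φ hφ
  rw [h φ hφ]
  exact setIntegral_congr_fun hU fun x hx => by simp only [huv x hx]

theorem IsWeakCurl.sub {U : Set Plane} {u v : Plane → Plane} {c d : Plane → ℝ}
    (hu : MemLp u 2 (volume.restrict U)) (hv : MemLp v 2 (volume.restrict U))
    (hc : MemLp c 2 (volume.restrict U)) (hd : MemLp d 2 (volume.restrict U))
    (h : IsWeakCurl U u c) (h' : IsWeakCurl U v d) :
    IsWeakCurl U (u - v) (fun x => c x - d x) := by
  intro φ hφ
  have hφ2 := hφ.memLp (volume.restrict U)
  have hp := fun k => hφ.memLp_partialDeriv k (volume.restrict U)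
  have i1 : ∀ w : Plane → Plane, MemLp w 2 (volume.restrict U) → Integrable
      (fun x => w x 0 * partialDeriv 1 φ x - w x 1 * partialDeriv 0 φ x) (volume.restrict U) :=
    fun w hw => ((memLp_coord hw 0).integrable_mul (hp 1)).sub
      ((memLp_coord hw 1).integrable_mul (hp 0))
  calc ∫ x in U, (c x - d x) * φ x = ∫ x in U, (c x * φ x - d x * φ x) := by
        congr 1; ext x; ring
    _ = (∫ x in U, c x * φ x) - ∫ x in U, d x * φ x :=
        integral_sub (hc.integrable_mul hφ2) (hd.integrable_mul hφ2)
    _ = _ := by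
        rw [h φ hφ, h' φ hφ, ← integral_sub (i1 u hu) (i1 v hv)]
        congr 1; ext x; simp; ring

theorem MemHCurl.sub {U : Set Plane} {u v : Plane → Plane} (hu : MemHCurl U u)
    (hv : MemHCurl U v) : MemHCurl U (u - v) :=
  ⟨hu.1.sub hv.1, _, hu.memLp_weakCurl.sub hv.memLp_weakCurl,
    IsWeakCurl.sub hu.1 hv.1 hu.memLp_weakCurl hv.memLp_weakCurl hu.isWeakCurl hv.isWeakCurl⟩

theorem weakCurl_sub {U : Set Plane} (hU : IsOpen U) (hfin : volume U ≠ ⊤)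
    {u v : Plane → Plane} (hu : MemHCurl U u) (hv : MemHCurl U v) :
    ∀ᵐ x ∂(volume.restrict U), weakCurl U (u - v) x = weakCurl U u x - weakCurl U v x := by
  have : IsFiniteMeasure (volume.restrict U) := ⟨by simpa using lt_top_iff_ne_top.2 hfin⟩
  exact IsWeakCurl.ae_eq hU Subset.rfl ((hu.sub hv).memLp_weakCurl.integrable (by norm_num))
    ((hu.memLp_weakCurl.sub hv.memLp_weakCurl).integrable (by norm_num)) (hu.sub hv).isWeakCurl
    (IsWeakCurl.sub hu.1 hv.1 hu.memLp_weakCurl hv.memLp_weakCurl hu.isWeakCurl hv.isWeakCurl)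

theorem contDiff_coord {ψ : Plane → Plane} (h : ContDiff ℝ ∞ ψ) (k : Fin 2) :
    ContDiff ℝ ∞ fun x => ψ x k :=
  (EuclideanSpace.proj k : Plane →L[ℝ] ℝ).contDiff.comp h

theorem IsTestFunction.coord {U : Set Plane} {ψ : Plane → Plane} (h : IsTestFunction U ψ)
    (k : Fin 2) : IsTestFunction U fun x => ψ x k := by
  refine ⟨contDiff_coord h.1 k, h.2.1.comp_left (g := fun y : Plane => y k) (by simp), ?_⟩
  exact (tsupport_comp_subset (g := fun y : Plane => y k) (by simp) ψ).trans h.2.2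

theorem IsTestFunction.sub {F : Type*} [NormedAddCommGroup F] [NormedSpace ℝ F]
    {U : Set Plane} {φ ψ : Plane → F} (h : IsTestFunction U φ) (h' : IsTestFunction U ψ) :
    IsTestFunction U (φ - ψ) := by
  refine ⟨h.1.sub h'.1, h.2.1.sub h'.2.1, ?_⟩
  exact (tsupport_sub φ ψ).trans (union_subset h.2.2 h'.2.2)

theorem IsTestFunction.differentiable {F : Type*} [NormedAddCommGroup F] [NormedSpace ℝ F]
    {U : Set Plane} {φ : Plane → F} (h : IsTestFunction U φ) : Differentiable ℝ φ :=
  h.1.differentiable (by norm_num)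

theorem partialDeriv_sub {φ ψ : Plane → ℝ} (hφ : Differentiable ℝ φ) (hψ : Differentiable ℝ ψ)
    (k : Fin 2) (x : Plane) :
    partialDeriv k (fun y => φ y - ψ y) x = partialDeriv k φ x - partialDeriv k ψ x := by
  rw [partialDeriv, fderiv_fun_sub (hφ x) (hψ x)]
  simp [partialDeriv]

theorem classicalCurl_sub {U : Set Plane} {φ ψ : Plane → Plane} (h : IsTestFunction U φ)
    (h' : IsTestFunction U ψ) (x : Plane) :
    classicalCurl (φ - ψ) x = classicalCurl φ x - classicalCurl ψ x := by
  have e : ∀ k j, partialDeriv k (fun y => (φ - ψ) y j) x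
      = partialDeriv k (fun y => φ y j) x - partialDeriv k (fun y => ψ y j) x := fun k j =>
    partialDeriv_sub (h.coord j).differentiable (h'.coord j).differentiable k x
  rw [classicalCurl, e, e, classicalCurl, classicalCurl]
  ring

theorem IsTestFunction.memLp_classicalCurl {U : Set Plane} {φ : Plane → Plane}
    (h : IsTestFunction U φ) (μ : Measure Plane) [IsFiniteMeasureOnCompacts μ] :
    MemLp (classicalCurl φ) 2 μ :=
  ((h.coord 1).memLp_partialDeriv 0 μ).sub ((h.coord 0).memLp_partialDeriv 1 μ)

theorem MemH0Curl.sub {U : Set Plane} (hU : IsOpen U) (hfin : volume U ≠ ⊤)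
    {u v : Plane → Plane} (hu : MemH0Curl U u) (hv : MemH0Curl U v) : MemH0Curl U (u - v) := by
  refine ⟨hu.1.sub hv.1, fun ε hε => ?_⟩
  obtain ⟨φ, h1, h2, h3⟩ := hu.2 (ε / 2) (half_pos hε)
  obtain ⟨ψ, h1', h2', h3'⟩ := hv.2 (ε / 2) (half_pos hε)
  refine ⟨φ - ψ, h1.sub h1', ?_, ?_⟩
  · have := l2Norm_sub_le (hu.1.1.sub (h1.memLp _)) (hv.1.1.sub (h1'.memLp _))
    have e : l2Norm U (fun x => (u - v) x - (φ - ψ) x)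
        = l2Norm U (fun x => (u - φ) x - (v - ψ) x) := by
      congr 1; ext x; simp; ring
    rw [e]
    refine this.trans_lt ?_
    have e1 : l2Norm U (u - φ) = l2Norm U (fun x => u x - φ x) := rfl
    have e2 : l2Norm U (v - ψ) = l2Norm U (fun x => v x - ψ x) := rfl
    rw [e1, e2]
    linarith
  · have := l2Norm_sub_le (hu.1.memLp_weakCurl.sub (h1.memLp_classicalCurl _))
      (hv.1.memLp_weakCurl.sub (h1'.memLp_classicalCurl _))
    have e : l2Norm U (fun x => weakCurl U (u - v) x - classicalCurl (φ - ψ) x)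
        = l2Norm U (fun x => (weakCurl U u - classicalCurl φ) x
          - (weakCurl U v - classicalCurl ψ) x) := by
      refine l2Norm_congr ?_
      filter_upwards [weakCurl_sub hU hfin hu.1 hv.1] with x hx
      rw [hx, classicalCurl_sub h1 h1']
      simp; ring
    rw [e]
    refine this.trans_lt ?_
    have e1 : l2Norm U (weakCurl U u - classicalCurl φ)
      = l2Norm U (fun x => weakCurl U u x - classicalCurl φ x) := rfl
    have e2 : l2Norm U (weakCurl U v - classicalCurl ψ)
      = l2Norm U (fun x => weakCurl U v x - classicalCurl ψ x) := rfl
    rw [e1, e2]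
    linarith

/-! ### Curls of Nédélec fields, null curves, and the vector Poincaré inequality -/

/-- The weak curl of a Nédélec field. -/
theorem isWeakCurl_nedelec {T : Set Plane} (a : Plane) (b : ℝ) :
    IsWeakCurl T (fun x => a + b • !₂[x 1, - x 0]) (fun _ => -2 * b) := by
  intro φ hφ
  rw [setIntegral_eq_integral_of_forall_compl_eq_zero fun x hx => by simp [hφ.eq_zero hx],
    setIntegral_eq_integral_of_forall_compl_eq_zero fun x hx => by
      simp [hφ.partialDeriv_eq_zero _ hx]]
  have hφi : Integrable φ := hφ.1.continuous.integrable_of_hasCompactSupport hφ.2.1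
  -- Integration by parts against an affine function of one coordinate. It is used once per
  -- coordinate, and each use contributes `-b` to the curl.
  have key : ∀ (j k : Fin 2) (r s : ℝ), j ≠ k →
      Integrable (fun x : Plane => (r + s * x j) * partialDeriv j φ x) ∧
      ∫ x : Plane, (r + s * x j) * partialDeriv j φ x = - ∫ x, s * φ x := by
    intro j k r s hjk
    have hL : ∀ x : Plane, HasFDerivAt (fun x : Plane => r + s * x j)
        (s • (EuclideanSpace.proj j : Plane →L[ℝ] ℝ)) x := fun x =>
      (((EuclideanSpace.proj j : Plane →L[ℝ] ℝ).hasFDerivAt (x := x)).const_mul s).const_add r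
    have hd : ∀ x : Plane, fderiv ℝ (fun x : Plane => r + s * x j) x (EuclideanSpace.single j 1)
        = s := by
      intro x
      rw [(hL x).fderiv]
      simp
    have hc : Continuous fun x : Plane => r + s * x j := by fun_prop
    have hi : Integrable (fun x : Plane => (r + s * x j) * partialDeriv j φ x) :=
      (hc.mul (hφ.continuous_partialDeriv j)).integrable_of_hasCompactSupport
        ((hφ.hasCompactSupport_partialDeriv j).mul_left)
    refine ⟨hi, ?_⟩
    have := integral_mul_fderiv_eq_neg_fderiv_mul_of_integrable (μ := (volume : Measure Plane))
      (f := fun x : Plane => r + s * x j) (g := φ) (v := EuclideanSpace.single j 1)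
      (by simp only [hd]; exact hφi.const_mul s) hi
      ((hc.mul hφ.1.continuous).integrable_of_hasCompactSupport hφ.2.1.mul_left)
      (fun x _ => (hL x).differentiableAt) (fun x _ => hφ.differentiable x)
    simp only [hd] at this
    exact this
  have k1 := key 1 0 (a 0) b (by decide)
  have k0 := key 0 1 (a 1) (-b) (by decide)
  have e : ∀ x : Plane, (a + b • !₂[x 1, - x 0] : Plane) 0 * partialDeriv 1 φ x
      - (a + b • !₂[x 1, - x 0] : Plane) 1 * partialDeriv 0 φ x
      = (a 0 + b * x 1) * partialDeriv 1 φ x - (a 1 + -b * x 0) * partialDeriv 0 φ x := by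
    intro x; simp
  simp only [e]
  rw [integral_sub k1.1 k0.1, k1.2, k0.2, integral_const_mul, integral_const_mul,
    integral_const_mul]
  ring

theorem weakCurl_eq_of_nedelec {U T : Set Plane} (hT : IsOpen T) (hTU : T ⊆ U)
    (hfin : volume U ≠ ⊤) {v : Plane → Plane} (hv : MemHCurl U v) {a : Plane} {b : ℝ}
    (h : ∀ x ∈ T, v x = a + b • !₂[x 1, - x 0]) :
    ∀ᵐ x ∂(volume.restrict T), weakCurl U v x = -2 * b := by
  have : IsFiniteMeasure (volume.restrict U) := ⟨by simpa using lt_top_iff_ne_top.2 hfin⟩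
  have hTfin : volume T ≠ ⊤ := ((measure_mono hTU).trans_lt (lt_top_iff_ne_top.2 hfin)).ne
  have h1 : IntegrableOn (weakCurl U v) U := hv.memLp_weakCurl.integrable (by norm_num)
  exact IsWeakCurl.ae_eq hT hTU (h1.mono_set hTU) (integrableOn_const hTfin) hv.isWeakCurl
    ((isWeakCurl_nedelec a b).congr hT.measurableSet fun x hx => (h x hx).symm)

/-- A smooth curve is a null set. -/
theorem IsSmoothClosedCurve.volume_eq_zero {Γ : Set Plane} (h : IsSmoothClosedCurve Γ) :
    volume Γ = 0 := by
  obtain ⟨g, hg, -, -, -, rfl⟩ := h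
  -- The curve is the image of a line in the plane under the differentiable map `x ↦ g (x 0)` of the
  -- plane, and differentiable maps between spaces of equal dimension preserve null sets.
  set N : Set Plane := {x | x 1 = 0} with hN
  have hN0 : volume N = 0 := by
    have := Measure.addHaar_submodule (volume : Measure Plane)
      (LinearMap.ker (EuclideanSpace.proj 1 : Plane →L[ℝ] ℝ).toLinearMap)
      (by
        intro h
        have : EuclideanSpace.single (1 : Fin 2) (1 : ℝ) ∈ LinearMap.ker
            (EuclideanSpace.proj 1 : Plane →L[ℝ] ℝ).toLinearMap := by
          rw [h]; trivial
        simp at this)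
    convert this using 2
    ext x
    simp [hN]
  have hd : DifferentiableOn ℝ (fun x : Plane => g (x 0)) N :=
    ((hg.differentiable (by norm_num)).comp
      (EuclideanSpace.proj 0 : Plane →L[ℝ] ℝ).differentiable).differentiableOn
  refine measure_mono_null ?_
    (addHaar_image_eq_zero_of_differentiableOn_of_addHaar_eq_zero volume hd hN0)
  rintro _ ⟨t, rfl⟩
  exact ⟨!₂[t, 0], by simp [hN], by simp⟩

theorem average_coord {U : Set Plane} {f : Plane → Plane} (hf : IntegrableOn f U) (k : Fin 2) :
    (⨍ x in U, f x) k = ⨍ x in U, f x k := by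
  rw [average_eq, average_eq]
  have := (EuclideanSpace.proj k : Plane →L[ℝ] ℝ).integral_comp_comm hf
  simp only [PiLp.proj_apply] at this
  rw [this]
  simp

/-- The Poincaré–Wirtinger inequality for vector fields. -/
theorem integral_norm_sub_average_sq_le {U : Set Plane} (hU : IsOpen U)
    (hUc : Convex ℝ U) (hne : U.Nonempty) {D : ℝ} (hD : ∀ x ∈ U, ∀ y ∈ U, dist x y ≤ D)
    (hfin : volume U ≠ ⊤) {f : Plane → Plane} (hfL : MemLp f 2 (volume.restrict U))
    (hf : MemH1Vec U f) :
    ∫ x in U, ‖f x - ⨍ y in U, f y‖ ^ 2 ≤ 4 * D ^ 2 * h1SeminormSq U f := by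
  have hfm : IsFiniteMeasure (volume.restrict U) := ⟨by simpa using lt_top_iff_ne_top.2 hfin⟩
  have hfi : IntegrableOn f U := hfL.integrable (by norm_num)
  have hc : ∀ m, MemLp (fun x => f x m - ⨍ y in U, f y m) 2 (volume.restrict U) := fun m =>
    (memLp_coord hfL m).sub (memLp_const _)
  have e : ∀ x, ‖f x - ⨍ y in U, f y‖ ^ 2 = ∑ m, (f x m - ⨍ y in U, f y m) ^ 2 := by
    intro x
    rw [EuclideanSpace.norm_sq_eq]
    refine Finset.sum_congr rfl fun m _ => ?_
    rw [PiLp.sub_apply, average_coord hfi, Real.norm_eq_abs, sq_abs]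
  simp only [e]
  rw [integral_finsetSum _ fun m _ => (hc m).integrable_sq, h1SeminormSq, Finset.mul_sum]
  refine Finset.sum_le_sum fun m _ => ?_
  have hs : ∀ k, MemLp (weakPartial U k fun y => f y m) 2 (volume.restrict U) ∧
      IsWeakPartial U k (fun y => f y m) (weakPartial U k fun y => f y m) := by
    intro k
    rw [weakPartial, dif_pos ((hf m).2 k)]
    exact ((hf m).2 k).choose_spec
  exact integral_sub_average_sq_le hU hUc hne hD hfin (memLp_coord hfL m) (fun k => (hs k).1)
    fun k => (hs k).2

end MaxwellVEM

namespace MaxwellVEM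

/-! ### Nédélec fields on a triangle -/

theorem inner_plane (x y : Plane) : inner ℝ x y = x 0 * y 0 + x 1 * y 1 := by
  rw [PiLp.inner_apply, Fin.sum_univ_two]
  simp [mul_comm]

theorem norm_sq_plane (x : Plane) : ‖x‖ ^ 2 = x 0 ^ 2 + x 1 ^ 2 := by
  rw [EuclideanSpace.norm_sq_eq, Fin.sum_univ_two]; simp

/-- The value at `x` of the Nédélec field with parameters `a` and `b`. -/
def nedelec (a : Plane) (b : ℝ) (x : Plane) : Plane := a + b • !₂[x 1, - x 0]

theorem continuous_nedelec (a : Plane) (b : ℝ) : Continuous (nedelec a b) := by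
  unfold nedelec
  have : Continuous fun x : Plane => (!₂[x 1, - x 0] : Plane) := by
    refine (PiLp.continuous_toLp 2 _).comp (continuous_pi fun i => ?_)
    fin_cases i <;> simp <;> fun_prop
  fun_prop

/-- Every point of `T` is a limit of interior points, so the filter defining the trace is nontrivial
and `limUnder` returns a genuine limit instead of a default value. -/
theorem innerTrace_eq {T : Set Plane} (hT : Convex ℝ T) (hne : (interior T).Nonempty)
    {v F : Plane → Plane} (hF : Continuous F) (h : ∀ x ∈ interior T, v x = F x) {x : Plane}
    (hx : x ∈ T) : innerTrace T v x = F x := by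
  have hcl : x ∈ closure (interior T) := by
    rw [hT.closure_interior_eq_closure_of_nonempty_interior hne]
    exact subset_closure hx
  have : (𝓝[interior T] x).NeBot := mem_closure_iff_nhdsWithin_neBot.1 hcl
  refine Tendsto.limUnder_eq ?_
  refine (hF.continuousWithinAt (s := interior T) (x := x)).tendsto.congr' ?_
  filter_upwards [self_mem_nhdsWithin] with y hy using (h y hy).symm

/-- The tangential component of a Nédélec field is constant on an edge, so that it can be computed
at any point `z` of the edge. -/
theorem tangential_eq {T : Set Plane} (hT : Convex ℝ T) (hne : (interior T).Nonempty)
    {p q : Plane} (hp : p ∈ T) (hq : q ∈ T) {v : Plane → Plane} {a : Plane} {b : ℝ}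
    (h : ∀ x ∈ interior T, v x = nedelec a b x) (c : Plane) {s t : ℝ} (hs : s ∈ Icc (0 : ℝ) 1) :
    tangential T p q v c s
      = inner ℝ (nedelec a b (AffineMap.lineMap p q t) - c) ((dist p q)⁻¹ • (q - p)) := by
  have hmem : AffineMap.lineMap p q s ∈ T := hT.lineMap_mem hp hq hs
  rw [tangential, innerTrace_eq hT hne (continuous_nedelec a b) h hmem, inner_smul_right,
    inner_smul_right]
  congr 1
  -- Moving along the edge changes the field by a multiple of the rotated edge vector, which is
  -- orthogonal to `q - p`.
  simp only [inner_plane, nedelec, AffineMap.lineMap_apply]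
  simp
  ring

theorem edgeForm_eq {T : Set Plane} (hT : Convex ℝ T) (hne : (interior T).Nonempty)
    {p q : Plane} (hp : p ∈ T) (hq : q ∈ T) {v w : Plane → Plane} (hv : IsND T v)
    (hw : IsND T w) (c d : Plane) :
    edgeForm T p q v c w d = dist p q * (tangential T p q v c 0 * tangential T p q w d 0) := by
  obtain ⟨a, b, hv⟩ := hv
  obtain ⟨a', b', hw⟩ := hw
  rw [edgeForm]
  congr 1
  rw [intervalIntegral.integral_congr
    (g := fun _ => tangential T p q v c 0 * tangential T p q w d 0)]
  · simp
  · intro s hs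
    rw [uIcc_of_le zero_le_one] at hs
    have h0 : (0 : ℝ) ∈ Icc (0 : ℝ) 1 := by simp
    simp only
    rw [tangential_eq hT hne hp hq hv c (t := 0) hs, tangential_eq hT hne hp hq hv c (t := 0) h0,
      tangential_eq hT hne hp hq hw d (t := 0) hs, tangential_eq hT hne hp hq hw d (t := 0) h0]

theorem nedelec_sub (a a' : Plane) (b b' : ℝ) (x : Plane) :
    nedelec a b x - nedelec a' b' x = nedelec (a - a') (b - b') x := by
  simp only [nedelec, sub_smul]
  abel

theorem IsND.sub {T : Set Plane} {v w : Plane → Plane} (hv : IsND T v) (hw : IsND T w) :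
    IsND T (v - w) := by
  obtain ⟨a, b, hv⟩ := hv
  obtain ⟨a', b', hw⟩ := hw
  refine ⟨a - a', b - b', fun x hx => ?_⟩
  rw [Pi.sub_apply, hv x hx, hw x hx]
  exact nedelec_sub a a' b b' x

theorem tangential_sub {T : Set Plane} (hT : Convex ℝ T) (hne : (interior T).Nonempty)
    {p q : Plane} (hp : p ∈ T) (hq : q ∈ T) {v w : Plane → Plane} (hv : IsND T v)
    (hw : IsND T w) (c d : Plane) :
    tangential T p q (v - w) (c - d) 0 = tangential T p q v c 0 - tangential T p q w d 0 := by
  obtain ⟨a, b, hv⟩ := hv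
  obtain ⟨a', b', hw⟩ := hw
  have h0 : (0 : ℝ) ∈ Icc (0 : ℝ) 1 := by simp
  have hvw : ∀ x ∈ interior T, (v - w) x = nedelec (a - a') (b - b') x := by
    intro x hx
    rw [Pi.sub_apply, hv x hx, hw x hx]
    exact nedelec_sub a a' b b' x
  rw [tangential_eq hT hne hp hq hv c (t := 0) h0, tangential_eq hT hne hp hq hw d (t := 0) h0,
    tangential_eq hT hne hp hq hvw (c - d) (t := 0) h0, ← inner_sub_left, ← nedelec_sub]
  congr 1
  abel

/-- A vector is controlled by its components along two directions. -/
theorem norm_sq_mul_sin_sq_le {e₁ e₂ : Plane} (h₁ : e₁ ≠ 0) (h₂ : e₂ ≠ 0) (w : Plane) :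
    ‖w‖ ^ 2 * Real.sin (InnerProductGeometry.angle e₁ e₂) ^ 2
      ≤ 2 * (inner ℝ w (‖e₁‖⁻¹ • e₁) ^ 2 + inner ℝ w (‖e₂‖⁻¹ • e₂) ^ 2) := by
  have n₁ : 0 < ‖e₁‖ := norm_pos_iff.2 h₁
  have n₂ : 0 < ‖e₂‖ := norm_pos_iff.2 h₂
  set t₁ := ‖e₁‖⁻¹ • e₁ with ht₁
  set t₂ := ‖e₂‖⁻¹ • e₂ with ht₂
  have u₁ : t₁ 0 ^ 2 + t₁ 1 ^ 2 = 1 := by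
    rw [← norm_sq_plane, ht₁, norm_smul, norm_inv, norm_norm, inv_mul_cancel₀ n₁.ne', one_pow]
  have u₂ : t₂ 0 ^ 2 + t₂ 1 ^ 2 = 1 := by
    rw [← norm_sq_plane, ht₂, norm_smul, norm_inv, norm_norm, inv_mul_cancel₀ n₂.ne', one_pow]
  have hcos : Real.cos (InnerProductGeometry.angle e₁ e₂) = t₁ 0 * t₂ 0 + t₁ 1 * t₂ 1 := by
    rw [InnerProductGeometry.cos_angle, ← inner_plane, ht₁, ht₂, inner_smul_left,
      inner_smul_right]
    simp
    field_simp
  rw [Real.sin_sq, hcos, norm_sq_plane, inner_plane, inner_plane]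
  set x := w 0
  set y := w 1
  set p := t₁ 0
  set q := t₁ 1
  set r := t₂ 0
  set s := t₂ 1
  -- Lagrange's identity: the sine of the angle is the determinant of the two unit vectors. Cramer's
  -- rule then recovers `w` times the determinant from the components `m` and `n`.
  have h1 : 1 - (p * r + q * s) ^ 2 = (p * s - q * r) ^ 2 := by
    have : (p ^ 2 + q ^ 2) * (r ^ 2 + s ^ 2) = 1 := by rw [u₁, u₂, one_mul]
    linear_combination -this
  rw [h1]
  set m := x * p + y * q with hm
  set n := x * r + y * s with hn
  have hx : x * (p * s - q * r) = m * s - n * q := by rw [hm, hn]; ring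
  have hy : y * (p * s - q * r) = n * p - m * r := by rw [hm, hn]; ring
  have h2 : (x ^ 2 + y ^ 2) * (p * s - q * r) ^ 2 = (m * s - n * q) ^ 2 + (n * p - m * r) ^ 2 := by
    rw [← hx, ← hy]; ring
  rw [h2]
  have h3 : (m * s - n * q) ^ 2 + (n * p - m * r) ^ 2 + ((m * s + n * q) ^ 2 + (n * p + m * r) ^ 2)
      = 2 * (m ^ 2 + n ^ 2) := by
    linear_combination 2 * m ^ 2 * u₂ + 2 * n ^ 2 * u₁
  nlinarith [sq_nonneg (m * s + n * q), sq_nonneg (n * p + m * r)]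

/-- The triangle lies in the parallelogram spanned at `p`, whose area is bounded by Hadamard's
inequality. The product form matters: one edge length is kept as the weight of the edge integral
while the other is bounded by `h`. -/
theorem volume_triangle_le (p q r : Plane) :
    volume.real (convexHull ℝ {p, q, r}) ≤ dist p q * dist p r := by
  set b := EuclideanSpace.basisFun (Fin 2) ℝ
  set S := parallelepiped ![q - p, r - p] with hS
  have hvol : volume S = ENNReal.ofReal |b.toBasis.det ![q - p, r - p]| := by
    rw [← b.addHaar_eq_volume, hS, Measure.addHaar_parallelepiped]
  have hdet : |b.toBasis.det ![q - p, r - p]| ≤ dist p q * dist p r := by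
    rw [Module.Basis.det_apply, Matrix.det_fin_two]
    simp only [Module.Basis.toMatrix_apply]
    rw [dist_comm p q, dist_comm p r, dist_eq_norm, dist_eq_norm]
    apply abs_le_of_sq_le_sq _ (by positivity)
    rw [mul_pow, norm_sq_plane, norm_sq_plane]
    simp [b]
    nlinarith [sq_nonneg ((q 0 - p 0) * (r 0 - p 0) + (q 1 - p 1) * (r 1 - p 1))]
  have hsub : convexHull ℝ {p, q, r} ⊆ (fun x => p + x) '' S := by
    refine convexHull_min ?_ ?_
    · have hm : ∀ f : Fin 2 → ℝ, f ∈ Icc (0 : Fin 2 → ℝ) 1 →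
          p + (f 0 • (q - p) + f 1 • (r - p)) ∈ (fun x => p + x) '' S := by
        intro f hf
        refine ⟨_, (mem_parallelepiped_iff _ _).2 ⟨f, hf, rfl⟩, ?_⟩
        simp [Fin.sum_univ_two]
      rintro x (rfl | rfl | rfl)
      · simpa using hm 0 ⟨le_rfl, zero_le_one⟩
      · simpa using hm ![1, 0] ⟨by intro i; fin_cases i <;> simp, by intro i; fin_cases i <;> simp⟩
      · simpa using hm ![0, 1] ⟨by intro i; fin_cases i <;> simp, by intro i; fin_cases i <;> simp⟩
    · rw [image_add_left]
      exact (convex_parallelepiped _).translate_preimage_right _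
  have h1 : volume (convexHull ℝ {p, q, r}) ≤ volume S := by
    refine (measure_mono hsub).trans ?_
    rw [image_add_left, measure_preimage_add]
  rw [hvol] at h1
  refine (ENNReal.toReal_mono (by simp) h1).trans ?_
  rw [ENNReal.toReal_ofReal (abs_nonneg _)]
  exact hdet

theorem ne_of_interior_triangle_nonempty {p q r : Plane}
    (h : (interior (convexHull ℝ {p, q, r})).Nonempty) : p ≠ q := by
  rintro rfl
  rw [interior_convexHull_nonempty_iff_affineSpan_eq_top] at h
  have h1 : vectorSpan ℝ ({p, p, r} : Set Plane) = ⊤ := by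
    rw [← direction_affineSpan, h, AffineSubspace.direction_top]
  have h2 : Collinear ℝ ({p, p, r} : Set Plane) := by
    rw [insert_eq_of_mem (mem_insert _ _)]
    exact collinear_pair ℝ p r
  have h3 := h2.finrank_le_one
  rw [h1, finrank_top] at h3
  simp at h3

/-- The `L²` norm of a Nédélec field on a triangle is controlled by its tangential components on
two edges that enclose an angle `δ` bounded away from `0` and `π`, and by its curl. -/
theorem integral_nedelec_le {p q r : Plane}
    (hne : (interior (convexHull ℝ {p, q, r})).Nonempty) {θ : ℝ} (hθ : 0 < θ)
    (h1 : θ ≤ EuclideanGeometry.angle q p r) (h2 : EuclideanGeometry.angle q p r ≤ Real.pi - θ)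
    {h : ℝ} (hq : dist p q ≤ h) (hr : dist p r ≤ h)
    (hh : ∀ x ∈ convexHull ℝ {p, q, r}, dist x p ≤ h) {a : Plane} {b : ℝ} {v : Plane → Plane}
    (hv : ∀ x ∈ interior (convexHull ℝ {p, q, r}), v x = nedelec a b x) (c : Plane) :
    ∫ x in convexHull ℝ {p, q, r}, ‖v x - c‖ ^ 2
      ≤ 4 / Real.sin θ ^ 2 * h *
          (dist p q * inner ℝ (nedelec a b p - c) ((dist p q)⁻¹ • (q - p)) ^ 2
            + dist p r * inner ℝ (nedelec a b p - c) ((dist p r)⁻¹ • (r - p)) ^ 2)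
        + 2 * h ^ 2 * (b ^ 2 * volume.real (convexHull ℝ {p, q, r})) := by
  set T := convexHull ℝ {p, q, r} with hT
  set w := nedelec a b p - c with hw
  have hpq : p ≠ q := ne_of_interior_triangle_nonempty hne
  have hpr : p ≠ r := by
    refine ne_of_interior_triangle_nonempty (r := q) ?_
    rwa [pair_comm]
  have hcomp : IsCompact T := (Set.toFinite _).isCompact_convexHull ℝ
  have hfin : volume T ≠ ⊤ := hcomp.measure_ne_top
  have hh0 : 0 ≤ h := dist_nonneg.trans hq
  -- Relative to its value at the vertex `p`, the field changes by `b` times `x - p` rotated by a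
  -- right angle.
  have hptw : ∀ x ∈ interior T, ‖v x - c‖ ^ 2 ≤ 2 * ‖w‖ ^ 2 + 2 * (b ^ 2 * h ^ 2) := by
    intro x hx
    have e : v x - c = w + b • !₂[(x - p) 1, - (x - p) 0] := by
      rw [hv x hx, hw]
      ext i
      fin_cases i <;> simp [nedelec] <;> ring
    have e2 : ‖b • (!₂[(x - p) 1, - (x - p) 0] : Plane)‖ ^ 2 ≤ b ^ 2 * h ^ 2 := by
      rw [norm_smul, mul_pow, Real.norm_eq_abs, sq_abs]
      have : ‖(!₂[(x - p) 1, - (x - p) 0] : Plane)‖ ^ 2 = ‖x - p‖ ^ 2 := by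
        rw [norm_sq_plane, norm_sq_plane]; simp; ring
      rw [this, ← dist_eq_norm]
      have := hh x (interior_subset hx)
      gcongr
    rw [e]
    set z := b • (!₂[(x - p) 1, - (x - p) 0] : Plane)
    have := norm_add_le w z
    nlinarith [sq_nonneg (‖w‖ - ‖z‖), norm_nonneg (w + z), norm_nonneg w, norm_nonneg z]
  have hint : ∫ x in T, ‖v x - c‖ ^ 2
      ≤ (2 * ‖w‖ ^ 2 + 2 * (b ^ 2 * h ^ 2)) * volume.real T := by
    -- The form of `v` is known only in the interior; the frontier of a convex set is null.
    have hfr : volume (frontier T) = 0 := (convex_convexHull ℝ _).addHaar_frontier _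
    rw [← setIntegral_congr_set (interior_ae_eq_of_null_frontier hfr)]
    have hfi : volume (interior T) < ⊤ :=
      (measure_mono interior_subset).trans_lt (lt_top_iff_ne_top.2 hfin)
    have := norm_setIntegral_le_of_norm_le_const (μ := volume) (f := fun x => ‖v x - c‖ ^ 2)
      (C := 2 * ‖w‖ ^ 2 + 2 * (b ^ 2 * h ^ 2)) hfi (fun x hx => by
        rw [Real.norm_of_nonneg (sq_nonneg _)]; exact hptw x hx)
    refine (le_abs_self _).trans (this.trans ?_)
    refine mul_le_mul_of_nonneg_left ?_ (by positivity)
    exact ENNReal.toReal_mono hfin (measure_mono interior_subset)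
  have hsin : Real.sin θ ≤ Real.sin (EuclideanGeometry.angle q p r) := by
    set δ := EuclideanGeometry.angle q p r
    rcases le_total δ (Real.pi / 2) with hδ | hδ
    · exact Real.sin_le_sin_of_le_of_le_pi_div_two (by linarith [Real.pi_pos]) hδ h1
    · rw [← Real.sin_pi_sub δ]
      exact Real.sin_le_sin_of_le_of_le_pi_div_two (by linarith [Real.pi_pos]) (by linarith)
        (by linarith)
  -- The two angle bounds together force `θ ≤ π / 2`.
  have hs0 : 0 < Real.sin θ := Real.sin_pos_of_pos_of_lt_pi hθ (by linarith [Real.pi_pos])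
  have hvec := norm_sq_mul_sin_sq_le (sub_ne_zero.2 hpq.symm) (sub_ne_zero.2 hpr.symm) w
  have hn : ‖q - p‖ = dist p q := by rw [dist_comm, dist_eq_norm]
  have hn' : ‖r - p‖ = dist p r := by rw [dist_comm, dist_eq_norm]
  have hang : InnerProductGeometry.angle (q - p) (r - p) = EuclideanGeometry.angle q p r := rfl
  rw [hn, hn', hang] at hvec
  set m := inner ℝ w ((dist p q)⁻¹ • (q - p))
  set n := inner ℝ w ((dist p r)⁻¹ • (r - p))
  have hw2 : ‖w‖ ^ 2 ≤ 2 / Real.sin θ ^ 2 * (m ^ 2 + n ^ 2) := by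
    rw [div_mul_eq_mul_div, le_div_iff₀ (by positivity)]
    refine le_trans ?_ hvec
    gcongr
  have hvol := volume_triangle_le p q r
  have hV0 : 0 ≤ volume.real T := measureReal_nonneg
  -- Of the two lengths bounding the area, the one belonging to the component `m` is kept, so a
  -- short edge costs nothing.
  have hVm : volume.real T * m ^ 2 ≤ h * (dist p q * m ^ 2) := by
    have : volume.real T ≤ h * dist p q := by
      refine hvol.trans ?_
      rw [mul_comm]
      gcongr
    calc volume.real T * m ^ 2 ≤ (h * dist p q) * m ^ 2 := by gcongr
      _ = _ := by ring
  have hVn : volume.real T * n ^ 2 ≤ h * (dist p r * n ^ 2) := by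
    have : volume.real T ≤ h * dist p r := by
      refine hvol.trans ?_
      gcongr
    calc volume.real T * n ^ 2 ≤ (h * dist p r) * n ^ 2 := by gcongr
      _ = _ := by ring
  calc ∫ x in T, ‖v x - c‖ ^ 2 ≤ (2 * ‖w‖ ^ 2 + 2 * (b ^ 2 * h ^ 2)) * volume.real T := hint
    _ ≤ (2 * (2 / Real.sin θ ^ 2 * (m ^ 2 + n ^ 2)) + 2 * (b ^ 2 * h ^ 2)) * volume.real T := by
        gcongr
    _ = 4 / Real.sin θ ^ 2 * (volume.real T * m ^ 2 + volume.real T * n ^ 2)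
          + 2 * h ^ 2 * (b ^ 2 * volume.real T) := by ring
    _ ≤ 4 / Real.sin θ ^ 2 * (h * (dist p q * m ^ 2) + h * (dist p r * n ^ 2))
          + 2 * h ^ 2 * (b ^ 2 * volume.real T) := by gcongr
    _ = _ := by ring

end MaxwellVEM

namespace MaxwellVEM

/-! ### Geometry of the interface elements -/

theorem mem_convexHull_triple {p q r : Plane} {u v w : ℝ} (hu : 0 ≤ u) (hv : 0 ≤ v) (hw : 0 ≤ w)
    (h : u + v + w = 1) : u • p + v • q + w • r ∈ convexHull ℝ {p, q, r} := by
  have := (convex_convexHull ℝ {p, q, r}).sum_mem (t := Finset.univ) (w := ![u, v, w])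
    (z := ![p, q, r]) (by intro i _; fin_cases i <;> simpa) (by simpa [Fin.sum_univ_three])
    (by
      intro i _
      apply subset_convexHull
      fin_cases i <;> simp)
  simpa [Fin.sum_univ_three] using this

/-- The relation `hrel` expresses that the diagonals `A₀E` and `A₁D` cross. Subtracting a multiple
of it from a convex combination of the four vertices shifts weight from `A₀` and `E` to `A₁` and
`D`; one stops when the weight of `A₀` or that of `E` reaches zero, and this decides the triangle.
-/
theorem convexHull_quad_subset {A₀ A₁ A₂ D E : Plane} (hD : D ∈ openSegment ℝ A₀ A₂)
    (hE : E ∈ openSegment ℝ A₁ A₂) :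
    convexHull ℝ {A₀, A₁, E, D} ⊆ convexHull ℝ {A₀, A₁, D} ∪ convexHull ℝ {D, A₁, E} := by
  obtain ⟨a, b, ha, hb, hab, hD⟩ := hD
  obtain ⟨a', b', ha', hb', hab', hE⟩ := hE
  have hrel : (a * b') • A₀ + b • E = (b * a') • A₁ + b' • D := by
    rw [← hD, ← hE]; module
  have hsum : a * b' + b = b * a' + b' := by
    have e1 : a = 1 - b := by linarith
    have e2 : a' = 1 - b' := by linarith
    rw [e1, e2]; ring
  intro x hx
  rw [convexHull_insert (by simp), convexHull_insert (by simp), convexHull_pair,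
    mem_convexJoin] at hx
  obtain ⟨B₀, hB₀, y, hy, s, s', hs, hs', hss, rfl⟩ := hx
  rw [mem_convexJoin] at hy
  obtain ⟨B₁, hB₁, z, ⟨r, r', hr, hr', hrr, rfl⟩, t, t', ht, ht', htt, rfl⟩ := hy
  rw [mem_singleton_iff.1 hB₀, mem_singleton_iff.1 hB₁]
  have hp : 0 < a * b' := by positivity
  rcases le_total (s * b) (s' * (t' * r) * (a * b')) with hle | hle
  · right
    set k := s / (a * b') with hk
    have hs0 : s = k * (a * b') := by rw [hk]; field_simp
    have hk0 : 0 ≤ k := by positivity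
    have h2 : k * b ≤ s' * (t' * r) := by
      rw [hk, div_mul_eq_mul_div, div_le_iff₀ hp]
      exact hle
    have := mem_convexHull_triple (p := D) (q := A₁) (r := E)
      (u := s' * (t' * r') + k * b') (v := s' * t + k * (b * a'))
      (w := s' * (t' * r) - k * b) (by positivity) (by positivity) (by linarith) (by
        have : r' = 1 - r := by linarith
        have : t' = 1 - t := by linarith
        subst_vars
        have : s' = 1 - k * (a * b') := by linarith
        subst this
        linear_combination (-k) * hsum)
    convert this using 1
    rw [hs0]
    linear_combination (norm := module) k • hrel
  · left
    set k := s' * (t' * r) / b with hk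
    have hs0 : s' * (t' * r) = k * b := by rw [hk]; field_simp
    have hk0 : 0 ≤ k := by positivity
    have h2 : k * (a * b') ≤ s := by
      rw [hk, div_mul_eq_mul_div, div_le_iff₀ hb]
      exact hle
    have := mem_convexHull_triple (p := A₀) (q := A₁) (r := D)
      (u := s - k * (a * b')) (v := s' * t + k * (b * a'))
      (w := s' * (t' * r') + k * b') (by linarith) (by positivity) (by positivity) (by
        have e : s' * (t' * r') = s' - s' * t - s' * (t' * r) := by
          have : r' = 1 - r := by linarith
          have : t' = 1 - t := by linarith
          subst_vars
          ring
        rw [e, hs0]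
        linear_combination hss - k * hsum)
    convert this using 1
    have e : s' • (t • A₁ + t' • (r • E + r' • D))
        = (s' * t) • A₁ + (s' * (t' * r)) • E + (s' * (t' * r')) • D := by module
    rw [e, hs0]
    linear_combination (norm := module) k • hrel

namespace BackgroundMesh

variable {Ω : Set Plane} (M : BackgroundMesh Ω)

theorem affineSpan_vert (i : Fin M.n) : affineSpan ℝ (range (M.vert i)) = ⊤ := by
  rw [(M.nondegenerate i).affineSpan_eq_top_iff_card_eq_finrank_add_one]
  simp

theorem isCompact_elem (i : Fin M.n) : IsCompact (M.elem i) :=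
  (Set.finite_range _).isCompact_convexHull ℝ

theorem vert_mem_elem (i : Fin M.n) (k : Fin 3) : M.vert i k ∈ M.elem i :=
  subset_convexHull ℝ _ (mem_range_self k)

theorem convex_elem (i : Fin M.n) : Convex ℝ (M.elem i) := convex_convexHull ℝ _

theorem elem_subset_closure (i : Fin M.n) : M.elem i ⊆ closure Ω := by
  rw [← M.cover]
  exact subset_iUnion (fun i => convexHull ℝ (range (M.vert i))) i

theorem dist_le_diam (i : Fin M.n) {x y : Plane} (hx : x ∈ M.elem i) (hy : y ∈ M.elem i) :
    dist x y ≤ Metric.diam (M.elem i) :=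
  Metric.dist_le_diam_of_mem (M.isCompact_elem i).isBounded hx hy

theorem diam_elem_le (hΩ : Bornology.IsBounded Ω) (i : Fin M.n) :
    Metric.diam (M.elem i) ≤ Metric.diam Ω := by
  rw [← Metric.diam_closure (s := Ω)]
  exact Metric.diam_mono (M.elem_subset_closure i) hΩ.closure

/-- Distinct elements have disjoint interiors. -/
theorem eq_of_mem_interior {i j : Fin M.n} {x : Plane} (hi : x ∈ interior (M.elem i))
    (hj : x ∈ interior (M.elem j)) : i = j := by
  by_contra hij
  set S := range (M.vert i) ∩ range (M.vert j) with hS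
  have hne : (interior (convexHull ℝ S)).Nonempty := by
    rw [← M.conforming i j hij, interior_inter]
    exact ⟨x, hi, hj⟩
  rw [interior_convexHull_nonempty_iff_affineSpan_eq_top] at hne
  -- By conformity an overlap of interiors makes the common vertices span the plane affinely. By
  -- affine independence they must then be all vertices of either triangle.
  have key : ∀ k : Fin M.n, S ⊆ range (M.vert k) → range (M.vert k) ⊆ S := by
    rintro k hk _ ⟨l, rfl⟩
    obtain ⟨J, hJ⟩ : ∃ J, S = M.vert k '' J := ⟨M.vert k ⁻¹' S, by
      rw [image_preimage_eq_inter_range, inter_eq_left.2 hk]⟩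
    have : M.vert k l ∈ affineSpan ℝ (M.vert k '' J) := by
      rw [← hJ, hne]; trivial
    rw [(M.nondegenerate k).mem_affineSpan_iff] at this
    rw [hJ]
    exact mem_image_of_mem _ this
  have h1 : range (M.vert i) = S := (key i inter_subset_left).antisymm inter_subset_left
  have h2 : range (M.vert j) = S := (key j inter_subset_right).antisymm inter_subset_right
  exact hij (M.distinct (h1.trans h2.symm))

end BackgroundMesh

theorem sbtw_of_mem_openSegment {x y z : Plane} (h : y ∈ openSegment ℝ x z) (hxz : x ≠ z) :
    Sbtw ℝ x y z := by
  rw [openSegment_eq_image_lineMap] at h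
  rw [sbtw_iff_mem_image_Ioo_and_ne]
  exact ⟨h, hxz⟩

namespace Cutting

variable {Ω Γ : Set Plane} {M : BackgroundMesh Ω} (P : Cutting M Γ) {i : Fin M.n}

theorem D_mem_elem (hi : M.IsCut Γ i) : P.D i ∈ M.elem i :=
  (M.convex_elem i).openSegment_subset (M.vert_mem_elem i 0) (M.vert_mem_elem i 2)
    (P.D_mem i hi)

theorem E_mem_elem (hi : M.IsCut Γ i) : P.E i ∈ M.elem i :=
  (M.convex_elem i).openSegment_subset (M.vert_mem_elem i 1) (M.vert_mem_elem i 2)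
    (P.E_mem i hi)

theorem sbtw_D (hi : M.IsCut Γ i) : Sbtw ℝ (M.vert i 0) (P.D i) (M.vert i 2) :=
  sbtw_of_mem_openSegment (P.D_mem i hi) ((M.nondegenerate i).injective.ne (by decide))

theorem sbtw_E (hi : M.IsCut Γ i) : Sbtw ℝ (M.vert i 1) (P.E i) (M.vert i 2) :=
  sbtw_of_mem_openSegment (P.E_mem i hi) ((M.nondegenerate i).injective.ne (by decide))

theorem quad_subset_elem (hi : M.IsCut Γ i) : P.quad i ⊆ M.elem i := by
  refine convexHull_min ?_ (M.convex_elem i)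
  rintro x (rfl | rfl | rfl | rfl)
  exacts [M.vert_mem_elem i 0, M.vert_mem_elem i 1, P.E_mem_elem hi, P.D_mem_elem hi]

theorem triPart_subset_elem (hi : M.IsCut Γ i) : P.triPart i ⊆ M.elem i := by
  refine convexHull_min ?_ (M.convex_elem i)
  rintro x (rfl | rfl | rfl)
  exacts [P.D_mem_elem hi, P.E_mem_elem hi, M.vert_mem_elem i 2]

theorem quad1_subset_quad : P.quad1 i ⊆ P.quad i := by
  refine convexHull_mono ?_
  rintro x (rfl | rfl | rfl) <;> simp

theorem quad2_subset_quad : P.quad2 i ⊆ P.quad i := by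
  refine convexHull_mono ?_
  rintro x (rfl | rfl | rfl) <;> simp

theorem quad_subset_union (hi : M.IsCut Γ i) : P.quad i ⊆ P.quad1 i ∪ P.quad2 i :=
  convexHull_quad_subset (P.D_mem i hi) (P.E_mem i hi)

theorem elem_subset (P : Cutting M Γ) (hΩ : IsOpen Ω) (hi : M.IsCut Γ i) : M.elem i ⊆ Ω := by
  intro x hx
  by_contra hxΩ
  refine (P.interior_elem i hi).le_bot ⟨hx, ?_⟩
  rw [hΩ.frontier_eq]
  exact ⟨M.elem_subset_closure i hx, hxΩ⟩

theorem convex_quad : Convex ℝ (P.quad i) := convex_convexHull ℝ _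

theorem isCompact_quad : IsCompact (P.quad i) := (Set.toFinite _).isCompact_convexHull ℝ

theorem interior_quad1_nonempty (hi : M.IsCut Γ i) : (interior (P.quad1 i)).Nonempty := by
  rw [quad1, interior_convexHull_nonempty_iff_affineSpan_eq_top, eq_top_iff,
    ← M.affineSpan_vert i, affineSpan_le]
  have h0 : M.vert i 0 ∈ affineSpan ℝ {M.vert i 0, M.vert i 1, P.D i} :=
    subset_affineSpan _ _ (by simp)
  have h1 : M.vert i 1 ∈ affineSpan ℝ {M.vert i 0, M.vert i 1, P.D i} :=
    subset_affineSpan _ _ (by simp)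
  have hD : P.D i ∈ affineSpan ℝ {M.vert i 0, M.vert i 1, P.D i} :=
    subset_affineSpan _ _ (by simp)
  have h2 := affineSpan_pair_le_of_mem_of_mem h0 hD ((P.sbtw_D hi).right_mem_affineSpan)
  rintro _ ⟨k, rfl⟩
  fin_cases k
  exacts [h0, h1, h2]

theorem interior_quad2_nonempty (hi : M.IsCut Γ i) : (interior (P.quad2 i)).Nonempty := by
  rw [quad2, interior_convexHull_nonempty_iff_affineSpan_eq_top, eq_top_iff,
    ← M.affineSpan_vert i, affineSpan_le]
  have hD : P.D i ∈ affineSpan ℝ {P.D i, M.vert i 1, P.E i} :=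
    subset_affineSpan _ _ (by simp)
  have h1 : M.vert i 1 ∈ affineSpan ℝ {P.D i, M.vert i 1, P.E i} :=
    subset_affineSpan _ _ (by simp)
  have hE : P.E i ∈ affineSpan ℝ {P.D i, M.vert i 1, P.E i} :=
    subset_affineSpan _ _ (by simp)
  have h2 := affineSpan_pair_le_of_mem_of_mem h1 hE ((P.sbtw_E hi).right_mem_affineSpan)
  have h0 := affineSpan_pair_le_of_mem_of_mem h2 hD ((P.sbtw_D hi).symm.right_mem_affineSpan)
  rintro _ ⟨k, rfl⟩
  fin_cases k
  exacts [h0, h1, h2]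

theorem interior_quad_nonempty (hi : M.IsCut Γ i) : (interior (P.quad i)).Nonempty :=
  (P.interior_quad1_nonempty hi).mono (interior_mono P.quad1_subset_quad)

theorem eq_of_mem_interior_quad {j : Fin M.n} {x : Plane} (hi : M.IsCut Γ i)
    (hj : M.IsCut Γ j) (hxi : x ∈ interior (P.quad i)) (hxj : x ∈ interior (P.quad j)) : i = j :=
  M.eq_of_mem_interior (interior_mono (P.quad_subset_elem hi) hxi)
    (interior_mono (P.quad_subset_elem hj) hxj)

theorem eq_of_mem_interior_triPart {j : Fin M.n} {x : Plane} (hi : M.IsCut Γ i)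
    (hj : M.IsCut Γ j) (hxi : x ∈ interior (P.triPart i)) (hxj : x ∈ interior (P.triPart j)) :
    i = j :=
  M.eq_of_mem_interior (interior_mono (P.triPart_subset_elem hi) hxi)
    (interior_mono (P.triPart_subset_elem hj) hxj)

/-! ### Angles -/

/-- As `D` lies on the side `A₁A₃`, this is an angle of the mesh triangle; another of its angles is
at least `θ`, hence the upper bound. -/
theorem angle_quad1 {θ : ℝ} (hM : M.ShapeRegular θ) (hi : M.IsCut Γ i) :
    θ ≤ EuclideanGeometry.angle (M.vert i 1) (M.vert i 0) (P.D i) ∧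
      EuclideanGeometry.angle (M.vert i 1) (M.vert i 0) (P.D i) ≤ Real.pi - θ := by
  rw [(P.sbtw_D hi).angle_eq_right]
  refine ⟨hM i 1 0 2 (by decide) (by decide) (by decide), ?_⟩
  have hsum := EuclideanGeometry.angle_add_angle_add_angle_eq_pi (p₁ := M.vert i 1)
    (p₂ := M.vert i 0) (M.vert i 2) ((M.nondegenerate i).injective.ne (by decide))
  have h2 := hM i 0 2 1 (by decide) (by decide) (by decide)
  have h3 := EuclideanGeometry.angle_nonneg (M.vert i 2) (M.vert i 1) (M.vert i 0)
  linarith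

/-- The angle at `E` is the supplement of the angle `DEA₃`, hence at least the angle at `A₃`, which
is a mesh angle. The upper bound is the Delaunay condition combined with the lower bound at `A₁`. -/
theorem angle_quad2 {θ : ℝ} (hM : M.ShapeRegular θ) (hi : M.IsCut Γ i) :
    θ ≤ EuclideanGeometry.angle (M.vert i 1) (P.E i) (P.D i) ∧
      EuclideanGeometry.angle (M.vert i 1) (P.E i) (P.D i) ≤ Real.pi - θ := by
  constructor
  · have h1 := EuclideanGeometry.angle_add_angle_eq_pi_of_angle_eq_pi (P.D i)
      (P.sbtw_E hi).angle₁₂₃_eq_pi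
    have hsum := EuclideanGeometry.angle_add_angle_add_angle_eq_pi (p₁ := P.E i)
      (p₂ := M.vert i 2) (P.D i) (P.sbtw_E hi).ne_right.symm
    have h2 : EuclideanGeometry.angle (P.E i) (M.vert i 2) (P.D i)
        = EuclideanGeometry.angle (M.vert i 1) (M.vert i 2) (M.vert i 0) := by
      rw [(P.sbtw_E hi).symm.angle_eq_left, (P.sbtw_D hi).symm.angle_eq_right]
    have h3 := hM i 1 2 0 (by decide) (by decide) (by decide)
    have h4 := EuclideanGeometry.angle_nonneg (M.vert i 2) (P.D i) (P.E i)
    rw [EuclideanGeometry.angle_comm (M.vert i 1)]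
    linarith
  · have h1 := P.delaunay i hi
    have h2 := (P.angle_quad1 hM hi).1
    rw [EuclideanGeometry.angle_comm (M.vert i 1)]
    linarith

/-! ### The boundary form -/

/-- The tangential components of `v - Π v` on the four edges of the quadrilateral, scaled with the
square roots of the lengths of the edges. -/
def edgeVal (i : Fin M.n) (v : Plane → Plane) : Fin 4 → ℝ :=
  let c := proj (P.quad i) v
  ![√(dist (M.vert i 0) (M.vert i 1)) * tangential (P.quad1 i) (M.vert i 0) (M.vert i 1) v c 0,
    √(dist (M.vert i 1) (P.E i)) * tangential (P.quad2 i) (M.vert i 1) (P.E i) v c 0,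
    √(dist (P.E i) (P.D i)) * tangential (P.quad2 i) (P.E i) (P.D i) v c 0,
    √(dist (P.D i) (M.vert i 0)) * tangential (P.quad1 i) (P.D i) (M.vert i 0) v c 0]

theorem mem_quad1 : M.vert i 0 ∈ P.quad1 i ∧ M.vert i 1 ∈ P.quad1 i ∧ P.D i ∈ P.quad1 i :=
  ⟨subset_convexHull _ _ (by simp), subset_convexHull _ _ (by simp),
    subset_convexHull _ _ (by simp)⟩

theorem mem_quad2 : P.D i ∈ P.quad2 i ∧ M.vert i 1 ∈ P.quad2 i ∧ P.E i ∈ P.quad2 i :=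
  ⟨subset_convexHull _ _ (by simp), subset_convexHull _ _ (by simp),
    subset_convexHull _ _ (by simp)⟩

theorem convex_quad1 : Convex ℝ (P.quad1 i) := convex_convexHull ℝ _

theorem convex_quad2 : Convex ℝ (P.quad2 i) := convex_convexHull ℝ _

/-- Tangential components of Nédélec fields are constant on edges, so the boundary form is a
Euclidean inner product in `ℝ⁴`. Positivity and Cauchy–Schwarz for the stabilization come from here,
and linearity together with `edgeVal_sub`. -/
theorem bdryForm_eq (hi : M.IsCut Γ i) {v w : Plane → Plane} (hv₁ : IsND (P.quad1 i) v)
    (hv₂ : IsND (P.quad2 i) v) (hw₁ : IsND (P.quad1 i) w) (hw₂ : IsND (P.quad2 i) w) :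
    P.bdryForm i v w = ∑ k, P.edgeVal i v k * P.edgeVal i w k := by
  obtain ⟨m0, m1, mD⟩ := P.mem_quad1 (i := i)
  obtain ⟨nD, n1, nE⟩ := P.mem_quad2 (i := i)
  have i1 := P.interior_quad1_nonempty hi
  have i2 := P.interior_quad2_nonempty hi
  have e : ∀ l x y : ℝ, 0 ≤ l → l * (x * y) = √l * x * (√l * y) := by
    intro l x y hl
    rw [mul_mul_mul_comm, Real.mul_self_sqrt hl]
  simp only [bdryForm]
  rw [edgeForm_eq P.convex_quad1 i1 m0 m1 hv₁ hw₁, edgeForm_eq P.convex_quad2 i2 n1 nE hv₂ hw₂,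
    edgeForm_eq P.convex_quad2 i2 nE nD hv₂ hw₂, edgeForm_eq P.convex_quad1 i1 mD m0 hv₁ hw₁,
    e _ _ _ dist_nonneg, e _ _ _ dist_nonneg, e _ _ _ dist_nonneg, e _ _ _ dist_nonneg]
  simp [edgeVal, Fin.sum_univ_four]

theorem proj_sub {U : Set Plane} {v w : Plane → Plane} (hv : IntegrableOn v U)
    (hw : IntegrableOn w U) : proj U (v - w) = proj U v - proj U w := by
  simp only [proj, average_eq, Pi.sub_apply]
  rw [integral_sub hv hw, smul_sub]

theorem edgeVal_sub (hi : M.IsCut Γ i) {v w : Plane → Plane} (hv₁ : IsND (P.quad1 i) v)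
    (hv₂ : IsND (P.quad2 i) v) (hw₁ : IsND (P.quad1 i) w) (hw₂ : IsND (P.quad2 i) w)
    (hv : IntegrableOn v (P.quad i)) (hw : IntegrableOn w (P.quad i)) (k : Fin 4) :
    P.edgeVal i (v - w) k = P.edgeVal i v k - P.edgeVal i w k := by
  obtain ⟨m0, m1, mD⟩ := P.mem_quad1 (i := i)
  obtain ⟨nD, n1, nE⟩ := P.mem_quad2 (i := i)
  have i1 := P.interior_quad1_nonempty hi
  have i2 := P.interior_quad2_nonempty hi
  simp only [edgeVal]
  rw [proj_sub hv hw, tangential_sub P.convex_quad1 i1 m0 m1 hv₁ hw₁,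
    tangential_sub P.convex_quad2 i2 n1 nE hv₂ hw₂,
    tangential_sub P.convex_quad2 i2 nE nD hv₂ hw₂, tangential_sub P.convex_quad1 i1 mD m0 hv₁ hw₁]
  fin_cases k <;> simp [mul_sub]

/-- The curl is `-2 b` on `T`, so its square integrates to `4 b²` times the area. The left side is
the remainder in `integral_nedelec_le` without `h²`; the halves from the two triangles add up to one
integral over `Q`. -/
theorem two_mul_sq_volume_le {U T Q : Set Plane} (hT : Convex ℝ T) (hTQ : T ⊆ Q) (hQU : Q ⊆ U)
    (hfin : volume U ≠ ⊤) {v : Plane → Plane} (hv : MemHCurl U v) {a : Plane}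
    {b : ℝ} (h : ∀ x ∈ interior T, v x = nedelec a b x) :
    2 * (b ^ 2 * volume.real T) ≤ 1 / 2 * ∫ x in Q, weakCurl U v x ^ 2 := by
  have hae := weakCurl_eq_of_nedelec isOpen_interior
    (interior_subset.trans (hTQ.trans hQU)) hfin hv h
  have hT' : (interior T : Set Plane) =ᵐ[volume] T :=
    interior_ae_eq_of_null_frontier (hT.addHaar_frontier _)
  have h1 : ∫ x in T, weakCurl U v x ^ 2 = volume.real T * (4 * b ^ 2) := by
    rw [← setIntegral_congr_set hT', integral_congr_ae (g := fun _ => 4 * b ^ 2)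
      (by filter_upwards [hae] with x hx; rw [hx]; ring), setIntegral_const,
      measureReal_congr hT', smul_eq_mul]
  have h2 : ∫ x in T, weakCurl U v x ^ 2 ≤ ∫ x in Q, weakCurl U v x ^ 2 :=
    setIntegral_mono_set (hv.memLp_weakCurl.integrable_sq.mono_measure
      (Measure.restrict_mono hQU le_rfl)) (Eventually.of_forall fun x => sq_nonneg _)
      (LE.le.eventuallyLE hTQ)
  linarith

/-- On a quadrilateral, `v - Π v` is controlled by its tangential components on the boundary and by
the curl of `v`, uniformly in the position of the interface. -/
theorem integral_quad_sub_proj_le {θ : ℝ} (hθ : 0 < θ) (hM : M.ShapeRegular θ) (hΩ : IsOpen Ω)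
    (hfin : volume Ω ≠ ⊤) (hi : M.IsCut Γ i) {v : Plane → Plane} (hv : MemHCurl Ω v)
    (hv₁ : IsND (P.quad1 i) v) (hv₂ : IsND (P.quad2 i) v) :
    ∫ x in P.quad i, ‖v x - proj (P.quad i) v‖ ^ 2
      ≤ 4 / Real.sin θ ^ 2 * (Metric.diam (M.elem i) * P.bdryForm i v v)
        + Metric.diam (M.elem i) ^ 2 * ∫ x in P.quad i, weakCurl Ω v x ^ 2 := by
  set c := proj (P.quad i) v with hc
  set h := Metric.diam (M.elem i) with hh
  obtain ⟨m0, m1, mD⟩ := P.mem_quad1 (i := i)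
  obtain ⟨nD, n1, nE⟩ := P.mem_quad2 (i := i)
  have i1 := P.interior_quad1_nonempty hi
  have i2 := P.interior_quad2_nonempty hi
  have sub1 : P.quad1 i ⊆ M.elem i := P.quad1_subset_quad.trans (P.quad_subset_elem hi)
  have sub2 : P.quad2 i ⊆ M.elem i := P.quad2_subset_quad.trans (P.quad_subset_elem hi)
  have hQΩ : P.quad i ⊆ Ω := (P.quad_subset_elem hi).trans (P.elem_subset hΩ hi)
  have hbf := P.bdryForm_eq hi hv₁ hv₂ hv₁ hv₂
  obtain ⟨a, b, hab⟩ := hv₁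
  obtain ⟨a', b', hab'⟩ := hv₂
  have t0 : (0 : ℝ) ∈ Icc (0 : ℝ) 1 := by simp
  -- Reordered so that the base vertex is `E`, where two boundary edges of the quadrilateral meet;
  -- the diagonal `A₂D` carries no stabilization.
  have eq2 : P.quad2 i = convexHull ℝ {P.E i, M.vert i 1, P.D i} := by
    rw [quad2]; congr 1; ext x; simp; tauto
  have est1 := integral_nedelec_le i1 hθ (P.angle_quad1 hM hi).1 (P.angle_quad1 hM hi).2
    (M.dist_le_diam i (sub1 m0) (sub1 m1)) (M.dist_le_diam i (sub1 m0) (sub1 mD))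
    (fun x hx => M.dist_le_diam i (sub1 hx) (sub1 m0)) hab c
  have est2 := integral_nedelec_le (eq2 ▸ i2) hθ (P.angle_quad2 hM hi).1 (P.angle_quad2 hM hi).2
    (M.dist_le_diam i (sub2 nE) (sub2 n1)) (M.dist_le_diam i (sub2 nE) (sub2 nD))
    (fun x hx => M.dist_le_diam i (sub2 (eq2 ▸ hx)) (sub2 nE)) (eq2 ▸ hab') c
  rw [← eq2] at est2
  change ∫ x in P.quad1 i, _ ≤ _ at est1
  have hL2 : IntegrableOn (fun x => ‖v x - c‖ ^ 2) (P.quad i) := by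
    have : IsFiniteMeasure (volume.restrict (P.quad i)) :=
      ⟨by simpa using P.isCompact_quad.measure_lt_top⟩
    exact ((hv.1.mono_measure (Measure.restrict_mono hQΩ le_rfl)).sub
      (memLp_const c)).integrable_norm_pow (by norm_num)
  have hsplit : ∫ x in P.quad i, ‖v x - c‖ ^ 2
      ≤ (∫ x in P.quad1 i, ‖v x - c‖ ^ 2) + ∫ x in P.quad2 i, ‖v x - c‖ ^ 2 := by
    have hi1 := hL2.mono_set P.quad1_subset_quad
    have hi2 := hL2.mono_set P.quad2_subset_quad
    have hm : volume.restrict (P.quad i)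
        ≤ volume.restrict (P.quad1 i) + volume.restrict (P.quad2 i) :=
      (Measure.restrict_mono (P.quad_subset_union hi) le_rfl).trans
        (Measure.restrict_union_le _ _)
    exact (integral_mono_measure hm (Eventually.of_forall fun x => sq_nonneg _)
      (Integrable.add_measure hi1 hi2)).trans (le_of_eq (integral_add_measure hi1 hi2))
  have c1 := two_mul_sq_volume_le P.convex_quad1 P.quad1_subset_quad hQΩ hfin hv hab
  have c2 := two_mul_sq_volume_le P.convex_quad2 P.quad2_subset_quad hQΩ hfin hv hab'
  have v1 : P.edgeVal i v 0 * P.edgeVal i v 0 = dist (M.vert i 0) (M.vert i 1) * inner ℝ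
      (nedelec a b (M.vert i 0) - c)
      ((dist (M.vert i 0) (M.vert i 1))⁻¹ • (M.vert i 1 - M.vert i 0)) ^ 2 := by
    simp only [edgeVal, Matrix.cons_val_zero]
    rw [← hc, tangential_eq P.convex_quad1 i1 m0 m1 hab c (t := 0) t0, AffineMap.lineMap_apply_zero,
      mul_mul_mul_comm, Real.mul_self_sqrt dist_nonneg, ← sq]
  -- This edge ends at `A₁`, so the constant component is evaluated at parameter 1; the reversed
  -- orientation disappears in the square.
  have v4 : P.edgeVal i v 3 * P.edgeVal i v 3 = dist (M.vert i 0) (P.D i) * inner ℝ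
      (nedelec a b (M.vert i 0) - c)
      ((dist (M.vert i 0) (P.D i))⁻¹ • (P.D i - M.vert i 0)) ^ 2 := by
    simp only [edgeVal, Matrix.cons_val]
    rw [← hc, tangential_eq P.convex_quad1 i1 mD m0 hab c (t := 1) t0, AffineMap.lineMap_apply_one,
      mul_mul_mul_comm, Real.mul_self_sqrt dist_nonneg, ← sq, dist_comm (P.D i),
      ← neg_sub (P.D i), smul_neg, inner_neg_right, neg_sq]
  have v2 : P.edgeVal i v 1 * P.edgeVal i v 1 = dist (P.E i) (M.vert i 1) * inner ℝ
      (nedelec a' b' (P.E i) - c)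
      ((dist (P.E i) (M.vert i 1))⁻¹ • (M.vert i 1 - P.E i)) ^ 2 := by
    simp only [edgeVal, Matrix.cons_val]
    rw [← hc, tangential_eq P.convex_quad2 i2 n1 nE hab' c (t := 1) t0,
      AffineMap.lineMap_apply_one, mul_mul_mul_comm, Real.mul_self_sqrt dist_nonneg, ← sq,
      dist_comm (M.vert i 1), ← neg_sub (M.vert i 1), smul_neg, inner_neg_right, neg_sq]
  have v3 : P.edgeVal i v 2 * P.edgeVal i v 2 = dist (P.E i) (P.D i) * inner ℝ
      (nedelec a' b' (P.E i) - c)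
      ((dist (P.E i) (P.D i))⁻¹ • (P.D i - P.E i)) ^ 2 := by
    simp only [edgeVal, Matrix.cons_val]
    rw [← hc, tangential_eq P.convex_quad2 i2 nE nD hab' c (t := 0) t0,
      AffineMap.lineMap_apply_zero, mul_mul_mul_comm, Real.mul_self_sqrt dist_nonneg, ← sq]
  rw [← v1, ← v4] at est1
  rw [← v2, ← v3] at est2
  rw [hbf, Fin.sum_univ_four]
  have hh2 : 0 ≤ h ^ 2 := sq_nonneg _
  have c1' := mul_le_mul_of_nonneg_left c1 hh2
  have c2' := mul_le_mul_of_nonneg_left c2 hh2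
  change _ ≤ _ + 2 * h ^ 2 * (b ^ 2 * volume.real (P.quad1 i)) at est1
  nlinarith [est1, est2, hsplit, c1', c2']

end Cutting

end MaxwellVEM

namespace MaxwellVEM

/-! ### The operator `Π_h` and the modified coefficients -/

theorem integrable_inner {μ : Measure Plane} {f g : Plane → Plane} (hf : MemLp f 2 μ)
    (hg : MemLp g 2 μ) : Integrable (fun x => inner ℝ (f x) (g x)) μ :=
  (hf.norm.integrable_mul hg.norm).mono' (hf.1.inner hg.1)
    (Eventually.of_forall fun _ => abs_real_inner_le_norm _ _)

/-- Disjointness makes the value on `A i` independent of any choice, so preimages are countable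
unions of the sets `A i` and a part of a preimage under `G`. -/
theorem measurable_dite_choose {ι X Y : Type*} [Countable ι] [MeasurableSpace X]
    [MeasurableSpace Y] {Q : ι → Prop} {A : ι → Set X} (hA : ∀ i, MeasurableSet (A i))
    (hdisj : ∀ i j, ∀ x : X, Q i → Q j → x ∈ A i → x ∈ A j → i = j) (c : ι → Y) {G : X → Y}
    (hG : Measurable G) {F : X → Y} (hF : ∀ i x, Q i → x ∈ A i → F x = c i)
    (hF' : ∀ x, (¬ ∃ i, Q i ∧ x ∈ A i) → F x = G x) : Measurable F := by
  intro s hs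
  have e : F ⁻¹' s = (⋃ i ∈ {i | Q i ∧ c i ∈ s}, A i) ∪ ((⋃ i ∈ {i | Q i}, A i)ᶜ ∩ G ⁻¹' s) := by
    ext x
    simp only [mem_preimage, mem_union, mem_iUnion, mem_inter_iff, mem_compl_iff, mem_ofPred_eq,
      exists_prop]
    by_cases h : ∃ i, Q i ∧ x ∈ A i
    · obtain ⟨i, hi, hx⟩ := h
      rw [hF i x hi hx]
      constructor
      · intro h
        exact Or.inl ⟨i, ⟨hi, h⟩, hx⟩
      · rintro (⟨j, ⟨hj, hc⟩, hxj⟩ | ⟨h, -⟩)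
        · rwa [hdisj i j x hi hj hx hxj]
        · exact absurd ⟨i, hi, hx⟩ h
    · rw [hF' x h]
      constructor
      · intro h'
        exact Or.inr ⟨h, h'⟩
      · rintro (⟨j, ⟨hj, hc⟩, hxj⟩ | ⟨-, h⟩)
        · exact absurd ⟨j, hj, hxj⟩ h
        · exact h
  rw [e]
  exact (MeasurableSet.biUnion (to_countable _) fun i _ => hA i).union
    ((MeasurableSet.biUnion (to_countable _) fun i _ => hA i).compl.inter (hG hs))

theorem measurable_coeff {Ωp : Set Plane} (h : MeasurableSet Ωp) (cm cp : ℝ) :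
    Measurable (coeff Ωp cm cp) := by
  classical
  unfold coeff
  exact Measurable.ite h measurable_const measurable_const

theorem coeff_mem (Ωp : Set Plane) (cm cp : ℝ) (x : Plane) :
    min cm cp ≤ coeff Ωp cm cp x ∧ coeff Ωp cm cp x ≤ max cm cp := by
  unfold coeff
  split_ifs <;> simp

namespace Cutting

variable {Ω Γ : Set Plane} {M : BackgroundMesh Ω} (P : Cutting M Γ) {i : Fin M.n}

theorem projH_of_mem (hi : M.IsCut Γ i) (v : Plane → Plane) {x : Plane}
    (hx : x ∈ interior (P.quad i)) : P.projH v x = proj (P.quad i) v := by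
  have h : ∃ i, M.IsCut Γ i ∧ x ∈ interior (P.quad i) := ⟨i, hi, hx⟩
  rw [projH, dif_pos h, P.eq_of_mem_interior_quad h.choose_spec.1 hi h.choose_spec.2 hx]

theorem projH_of_notMem (v : Plane → Plane) {x : Plane}
    (hx : ¬ ∃ i, M.IsCut Γ i ∧ x ∈ interior (P.quad i)) : P.projH v x = v x := by
  rw [projH, dif_neg hx]

theorem modified_of_mem (hi : M.IsCut Γ i) (κ : Plane → ℝ) {x : Plane}
    (hx : x ∈ interior (P.quad i)) : P.modified κ x = κ (M.vert i 0) := by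
  have h : ∃ i, M.IsCut Γ i ∧ x ∈ interior (P.quad i) := ⟨i, hi, hx⟩
  rw [modified, dif_pos h, P.eq_of_mem_interior_quad h.choose_spec.1 hi h.choose_spec.2 hx]

/-- Upper and lower bounds on `κ` pass to the modified coefficient through this, with no need to
know on which side of the interface a vertex lies. -/
theorem modified_mem_range (κ : Plane → ℝ) (x : Plane) : P.modified κ x ∈ range κ := by
  unfold modified
  split_ifs <;> exact mem_range_self _

open Classical in
theorem measurable_modified {κ : Plane → ℝ} (hκ : Measurable κ) : Measurable (P.modified κ) := by
  have h1 : Measurable fun x => if h : ∃ i, M.IsCut Γ i ∧ x ∈ interior (P.triPart i)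
      then κ (M.vert h.choose 2) else κ x := by
    refine measurable_dite_choose (Q := fun i => M.IsCut Γ i)
      (A := fun i => interior (P.triPart i)) (fun i => isOpen_interior.measurableSet)
      (fun i j x hi hj hxi hxj => P.eq_of_mem_interior_triPart hi hj hxi hxj)
      (fun i => κ (M.vert i 2)) hκ ?_ ?_
    · intro i x hi hx
      have h : ∃ i, M.IsCut Γ i ∧ x ∈ interior (P.triPart i) := ⟨i, hi, hx⟩
      simp only [dif_pos h]
      rw [P.eq_of_mem_interior_triPart h.choose_spec.1 hi h.choose_spec.2 hx]
    · intro x hx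
      simp only [dif_neg hx]
  refine measurable_dite_choose (Q := fun i => M.IsCut Γ i)
    (A := fun i => interior (P.quad i)) (fun i => isOpen_interior.measurableSet)
    (fun i j x hi hj hxi hxj => P.eq_of_mem_interior_quad hi hj hxi hxj)
    (fun i => κ (M.vert i 0)) h1 (fun i x hi hx => P.modified_of_mem hi κ hx) ?_
  intro x hx
  rw [modified, dif_neg hx]

theorem projH_sub {v w : Plane → Plane} (hv : ∀ i, M.IsCut Γ i → IntegrableOn v (P.quad i))
    (hw : ∀ i, M.IsCut Γ i → IntegrableOn w (P.quad i)) (x : Plane) :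
    P.projH (v - w) x = P.projH v x - P.projH w x := by
  by_cases h : ∃ i, M.IsCut Γ i ∧ x ∈ interior (P.quad i)
  · obtain ⟨i, hi, hx⟩ := h
    rw [P.projH_of_mem hi _ hx, P.projH_of_mem hi _ hx, P.projH_of_mem hi _ hx,
      proj_sub (hv i hi) (hw i hi)]
  · rw [P.projH_of_notMem _ h, P.projH_of_notMem _ h, P.projH_of_notMem _ h, Pi.sub_apply]

/-! ### Integrals over the quadrilaterals -/

theorem mem_cutElems : i ∈ M.cutElems Γ ↔ M.IsCut Γ i := by
  simp [BackgroundMesh.cutElems]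

theorem quad_subset (hΩ : IsOpen Ω) (hi : M.IsCut Γ i) : P.quad i ⊆ Ω :=
  (P.quad_subset_elem hi).trans (P.elem_subset hΩ hi)

theorem interior_quad_ae_eq : (interior (P.quad i) : Set Plane) =ᵐ[volume] P.quad i :=
  interior_ae_eq_of_null_frontier (P.convex_quad.addHaar_frontier _)

/-- The union of the (open) quadrilaterals. -/
def quads : Set Plane := ⋃ i ∈ M.cutElems Γ, interior (P.quad i)

theorem mem_quads {x : Plane} : x ∈ P.quads ↔ ∃ i, M.IsCut Γ i ∧ x ∈ interior (P.quad i) := by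
  simp [quads, mem_cutElems]

theorem quads_subset (hΩ : IsOpen Ω) : P.quads ⊆ Ω := by
  intro x hx
  obtain ⟨i, hi, hx⟩ := P.mem_quads.1 hx
  exact P.quad_subset hΩ hi (interior_subset hx)

theorem integral_quads (hΩ : IsOpen Ω) {F : Plane → ℝ} (hF : IntegrableOn F Ω) :
    ∫ x in P.quads, F x = ∑ i ∈ M.cutElems Γ, ∫ x in P.quad i, F x := by
  rw [quads, integral_biUnion_finset _ (fun _ _ => isOpen_interior.measurableSet) ?_ ?_]
  · exact Finset.sum_congr rfl fun i _ => setIntegral_congr_set P.interior_quad_ae_eq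
  · intro i hi j hj hij
    rw [Function.onFun, Set.disjoint_left]
    intro x hxi hxj
    exact hij (P.eq_of_mem_interior_quad (mem_cutElems.1 hi) (mem_cutElems.1 hj) hxi hxj)
  · intro i hi
    exact hF.mono_set (interior_subset.trans (P.quad_subset hΩ (mem_cutElems.1 hi)))

theorem integral_eq_sum_quad (hΩ : IsOpen Ω) {F : Plane → ℝ} (hF : IntegrableOn F Ω)
    (h0 : ∀ x, x ∉ P.quads → F x = 0) :
    ∫ x in Ω, F x = ∑ i ∈ M.cutElems Γ, ∫ x in P.quad i, F x := by
  rw [← P.integral_quads hΩ hF]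
  exact (setIntegral_eq_of_subset_of_forall_sdiff_eq_zero hΩ.measurableSet (P.quads_subset hΩ)
    fun x hx => h0 x hx.2)

theorem sum_integral_quad_le (hΩ : IsOpen Ω) {F : Plane → ℝ} (hF : IntegrableOn F Ω)
    (h0 : ∀ x, 0 ≤ F x) : ∑ i ∈ M.cutElems Γ, ∫ x in P.quad i, F x ≤ ∫ x in Ω, F x := by
  rw [← P.integral_quads hΩ hF]
  exact setIntegral_mono_set hF (Eventually.of_forall h0) (LE.le.eventuallyLE (P.quads_subset hΩ))

theorem integral_quad_congr {F G : Plane → ℝ}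
    (h : ∀ x ∈ interior (P.quad i), F x = G x) :
    ∫ x in P.quad i, F x = ∫ x in P.quad i, G x := by
  rw [← setIntegral_congr_set P.interior_quad_ae_eq, ← setIntegral_congr_set P.interior_quad_ae_eq]
  exact setIntegral_congr_fun isOpen_interior.measurableSet h

theorem memLp_projH (hfin : volume Ω ≠ ⊤) {v : Plane → Plane}
    (hv : MemLp v 2 (volume.restrict Ω)) : MemLp (P.projH v) 2 (volume.restrict Ω) := by
  have : IsFiniteMeasure (volume.restrict Ω) := ⟨by simpa using lt_top_iff_ne_top.2 hfin⟩
  -- `Π v` differs from `v` by finitely many square integrable corrections on disjoint sets, which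
  -- settles measurability and integrability at once.
  have e : P.projH v = fun x => v x + ∑ i ∈ M.cutElems Γ,
      (interior (P.quad i)).indicator (fun x => proj (P.quad i) v - v x) x := by
    ext1 x
    by_cases h : ∃ i, M.IsCut Γ i ∧ x ∈ interior (P.quad i)
    · obtain ⟨i, hi, hx⟩ := h
      rw [P.projH_of_mem hi v hx, Finset.sum_eq_single_of_mem i (mem_cutElems.2 hi),
        indicator_of_mem hx, add_sub_cancel]
      intro j hj hji
      refine indicator_of_notMem (fun hxj => hji ?_) _
      exact P.eq_of_mem_interior_quad (mem_cutElems.1 hj) hi hxj hx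
    · rw [P.projH_of_notMem v h, Finset.sum_eq_zero, add_zero]
      intro i hi
      exact indicator_of_notMem (fun hx => h ⟨i, mem_cutElems.1 hi, hx⟩) _
  rw [e]
  refine hv.add (memLp_finsetSum _ fun i _ => ?_)
  exact ((memLp_const _).sub hv).indicator isOpen_interior.measurableSet

/-- Fields that are constant on the quadrilaterals are orthogonal to `v - Π v`. -/
theorem integral_inner_sub_projH_eq_zero (hΩ : IsOpen Ω) (hfin : volume Ω ≠ ⊤)
    {g v : Plane → Plane} (hg : MemLp g 2 (volume.restrict Ω))
    (hv : MemLp v 2 (volume.restrict Ω))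
    (hconst : ∀ i, M.IsCut Γ i → ∃ p, ∀ x ∈ interior (P.quad i), g x = p) :
    ∫ x in Ω, inner ℝ (g x) (v x - P.projH v x) = 0 := by
  have hfm : IsFiniteMeasure (volume.restrict Ω) := ⟨by simpa using lt_top_iff_ne_top.2 hfin⟩
  have hvi : IntegrableOn v Ω := hv.integrable (by norm_num)
  have hpv := P.memLp_projH hfin hv
  have hi : IntegrableOn (fun x => inner ℝ (g x) (v x - P.projH v x)) Ω :=
    integrable_inner hg (hv.sub hpv)
  rw [P.integral_eq_sum_quad hΩ hi]
  · refine Finset.sum_eq_zero fun i hi => ?_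
    rw [mem_cutElems] at hi
    obtain ⟨p, hp⟩ := hconst i hi
    have hQfin : volume (P.quad i) ≠ ⊤ := P.isCompact_quad.measure_ne_top
    have hvQ : IntegrableOn v (P.quad i) := hvi.mono_set (P.quad_subset hΩ hi)
    rw [P.integral_quad_congr (G := fun x => inner ℝ (v x) p - inner ℝ (proj (P.quad i) v) p)
      (fun x hx => by
        rw [hp x hx, P.projH_of_mem hi v hx, inner_sub_right, real_inner_comm,
          real_inner_comm (proj _ _)])]
    have hi1 : IntegrableOn (fun x => (inner ℝ (v x) p : ℝ)) (P.quad i) := hvQ.inner_const p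
    have hi2 : IntegrableOn (fun _ => (inner ℝ (proj (P.quad i) v) p : ℝ)) (P.quad i) :=
      integrableOn_const hQfin
    rw [integral_sub hi1 hi2, proj_spec _ hQfin v hvQ p, sub_self]
  · intro x hx
    rw [P.mem_quads] at hx
    rw [P.projH_of_notMem v hx, sub_self, inner_zero_right]

theorem l2Norm_sub_projH_sq (hΩ : IsOpen Ω) (hfin : volume Ω ≠ ⊤) {v : Plane → Plane}
    (hv : MemLp v 2 (volume.restrict Ω)) :
    l2Norm Ω (fun x => v x - P.projH v x) ^ 2
      = ∑ i ∈ M.cutElems Γ, ∫ x in P.quad i, ‖v x - proj (P.quad i) v‖ ^ 2 := by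
  have hpv := P.memLp_projH hfin hv
  have hint : IntegrableOn (fun x => ‖v x - P.projH v x‖ ^ 2) Ω :=
    (hv.sub hpv).integrable_norm_pow (by norm_num)
  rw [l2Norm_sq, P.integral_eq_sum_quad hΩ hint]
  · refine Finset.sum_congr rfl fun i hi => ?_
    rw [mem_cutElems] at hi
    exact P.integral_quad_congr fun x hx => by
      rw [P.projH_of_mem hi v hx]
  · intro x hx
    rw [P.mem_quads] at hx
    simp [P.projH_of_notMem v hx]

theorem l2Norm_sub_projH_sq_le_h1SeminormSq (hΩ : IsOpen Ω) (hfin : volume Ω ≠ ⊤)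
    {f : Plane → Plane} (hf : MemLp f 2 (volume.restrict Ω))
    (hf1 : ∀ i, M.IsCut Γ i → MemH1Vec (interior (P.quad i)) f) :
    l2Norm Ω (fun x => f x - P.projH f x) ^ 2
      ≤ 4 * ∑ i ∈ M.cutElems Γ,
          Metric.diam (M.elem i) ^ 2 * h1SeminormSq (interior (P.quad i)) f := by
  rw [P.l2Norm_sub_projH_sq hΩ hfin hf, Finset.mul_sum]
  refine Finset.sum_le_sum fun i hi => ?_
  rw [mem_cutElems] at hi
  have hsub : interior (P.quad i) ⊆ P.quad i := interior_subset
  have h := integral_norm_sub_average_sq_le (U := interior (P.quad i)) isOpen_interior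
    P.convex_quad.interior (P.interior_quad_nonempty hi) (D := Metric.diam (M.elem i))
    (fun x hx y hy => M.dist_le_diam i (P.quad_subset_elem hi (hsub hx))
      (P.quad_subset_elem hi (hsub hy)))
    ((measure_mono hsub).trans_lt P.isCompact_quad.measure_lt_top).ne
    (hf.mono_measure (Measure.restrict_mono (hsub.trans (P.quad_subset hΩ hi)) le_rfl))
    (hf1 i hi)
  rw [setIntegral_congr_set P.interior_quad_ae_eq, setAverage_congr P.interior_quad_ae_eq] at h
  rw [← mul_assoc]
  exact h

/-- Sums the local bounds. The factor `h_K²` before the curl is enlarged to the squared diameter of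
`Ω`, since only control by the energy norm is needed. -/
theorem l2Norm_sub_projH_sq_le_bdryForm {θ : ℝ} (hθ : 0 < θ) (hM : M.ShapeRegular θ)
    (hΩ : IsOpen Ω) (hb : Bornology.IsBounded Ω) (hfin : volume Ω ≠ ⊤) {v : Plane → Plane}
    (hv : v ∈ P.Vh) :
    l2Norm Ω (fun x => v x - P.projH v x) ^ 2
      ≤ 4 / Real.sin θ ^ 2 * ∑ i ∈ M.cutElems Γ, Metric.diam (M.elem i) * P.bdryForm i v v
        + Metric.diam Ω ^ 2 * l2Norm Ω (weakCurl Ω v) ^ 2 := by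
  have hcurl : IntegrableOn (fun x => weakCurl Ω v x ^ 2) Ω :=
    hv.1.1.memLp_weakCurl.integrable_sq
  have e : l2Norm Ω (weakCurl Ω v) ^ 2 = ∫ x in Ω, weakCurl Ω v x ^ 2 := by
    rw [l2Norm_sq]; simp
  rw [P.l2Norm_sub_projH_sq hΩ hfin hv.1.1.1, e, Finset.mul_sum]
  have hsum := P.sum_integral_quad_le hΩ hcurl fun x => sq_nonneg _
  calc ∑ i ∈ M.cutElems Γ, ∫ x in P.quad i, ‖v x - proj (P.quad i) v‖ ^ 2
      ≤ ∑ i ∈ M.cutElems Γ, (4 / Real.sin θ ^ 2 * (Metric.diam (M.elem i) * P.bdryForm i v v)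
          + Metric.diam Ω ^ 2 * ∫ x in P.quad i, weakCurl Ω v x ^ 2) := by
        refine Finset.sum_le_sum fun i hi => ?_
        rw [mem_cutElems] at hi
        refine (P.integral_quad_sub_proj_le hθ hM hΩ hfin hi hv.1.1 (hv.2.2 i hi).2.1
          (hv.2.2 i hi).2.2.1).trans ?_
        have := M.diam_elem_le hb i
        have h0 : 0 ≤ ∫ x in P.quad i, weakCurl Ω v x ^ 2 :=
          integral_nonneg fun x => sq_nonneg _
        have h1 : 0 ≤ Metric.diam (M.elem i) := Metric.diam_nonneg
        gcongr
    _ ≤ _ := by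
        rw [Finset.sum_add_distrib, ← Finset.mul_sum, ← Finset.mul_sum]
        gcongr

/-! ### The discrete space and the stabilization -/

theorem sub_mem_Vh (hΩ : IsOpen Ω) (hfin : volume Ω ≠ ⊤) {v w : Plane → Plane}
    (hv : v ∈ P.Vh) (hw : w ∈ P.Vh) : v - w ∈ P.Vh := by
  refine ⟨hv.1.sub hΩ hfin hw.1, fun i hi => (hv.2.1 i hi).sub (hw.2.1 i hi), fun i hi => ?_⟩
  obtain ⟨h1, h2, h3, c, hc⟩ := hv.2.2 i hi
  obtain ⟨h1', h2', h3', c', hc'⟩ := hw.2.2 i hi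
  refine ⟨h1.sub h1', h2.sub h2', h3.sub h3', c - c', ?_⟩
  have := ae_restrict_of_ae_restrict_of_subset (P.quad_subset hΩ hi)
    (weakCurl_sub hΩ hfin hv.1.1 hw.1.1)
  filter_upwards [this, hc, hc'] with x hx h h'
  rw [hx, h, h']

theorem Vh.integrableOn_quad {P : Cutting M Γ} (hΩ : IsOpen Ω) (hfin : volume Ω ≠ ⊤)
    {v : Plane → Plane} (hv : v ∈ P.Vh) (hi : M.IsCut Γ i) : IntegrableOn v (P.quad i) := by
  have : IsFiniteMeasure (volume.restrict Ω) := ⟨by simpa using lt_top_iff_ne_top.2 hfin⟩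
  have hvi : IntegrableOn v Ω := hv.1.1.1.integrable (by norm_num)
  exact hvi.mono_set (P.quad_subset hΩ hi)

theorem Vh.bdryForm_eq {P : Cutting M Γ} {v w : Plane → Plane} (hv : v ∈ P.Vh) (hw : w ∈ P.Vh)
    (hi : M.IsCut Γ i) : P.bdryForm i v w = ∑ k, P.edgeVal i v k * P.edgeVal i w k :=
  P.bdryForm_eq hi (hv.2.2 i hi).2.1 (hv.2.2 i hi).2.2.1 (hw.2.2 i hi).2.1 (hw.2.2 i hi).2.2.1

theorem Vh.bdryForm_self_nonneg {P : Cutting M Γ} {v : Plane → Plane} (hv : v ∈ P.Vh)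
    (hi : M.IsCut Γ i) : 0 ≤ P.bdryForm i v v := by
  rw [Vh.bdryForm_eq hv hv hi]
  exact Finset.sum_nonneg fun k _ => mul_self_nonneg _

theorem Vh.bdryForm_sub_left {P : Cutting M Γ} (hΩ : IsOpen Ω) (hfin : volume Ω ≠ ⊤)
    {v w z : Plane → Plane} (hv : v ∈ P.Vh) (hw : w ∈ P.Vh) (hz : z ∈ P.Vh)
    (hi : M.IsCut Γ i) : P.bdryForm i (v - w) z = P.bdryForm i v z - P.bdryForm i w z := by
  rw [Vh.bdryForm_eq (P.sub_mem_Vh hΩ hfin hv hw) hz hi, Vh.bdryForm_eq hv hz hi,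
    Vh.bdryForm_eq hw hz hi, ← Finset.sum_sub_distrib]
  refine Finset.sum_congr rfl fun k _ => ?_
  rw [P.edgeVal_sub hi (hv.2.2 i hi).2.1 (hv.2.2 i hi).2.2.1 (hw.2.2 i hi).2.1
    (hw.2.2 i hi).2.2.1 (Vh.integrableOn_quad hΩ hfin hv hi)
    (Vh.integrableOn_quad hΩ hfin hw hi), sub_mul]

theorem Vh.abs_bdryForm_le {P : Cutting M Γ} {v w : Plane → Plane} (hv : v ∈ P.Vh)
    (hw : w ∈ P.Vh) (hi : M.IsCut Γ i) :
    |P.bdryForm i v w| ≤ √(P.bdryForm i v v) * √(P.bdryForm i w w) := by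
  rw [Vh.bdryForm_eq hv hw hi, Vh.bdryForm_eq hv hv hi, Vh.bdryForm_eq hw hw hi]
  rw [← Real.sqrt_mul (Finset.sum_nonneg fun k _ => mul_self_nonneg _)]
  apply Real.abs_le_sqrt
  simp only [← sq]
  exact Finset.sum_mul_sq_le_sq_mul_sq _ _ _

/-- Cauchy–Schwarz inequality for the stabilization. -/
theorem Vh.abs_sum_bdryForm_le {P : Cutting M Γ} {v w : Plane → Plane} (hv : v ∈ P.Vh)
    (hw : w ∈ P.Vh) {κ : Fin M.n → ℝ} {K : ℝ} (hK : 0 ≤ K)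
    (hκ : ∀ i, M.IsCut Γ i → |κ i| ≤ K) :
    |∑ i ∈ M.cutElems Γ, κ i * (Metric.diam (M.elem i) * P.bdryForm i v w)|
      ≤ K * (√(∑ i ∈ M.cutElems Γ, Metric.diam (M.elem i) * P.bdryForm i v v)
        * √(∑ i ∈ M.cutElems Γ, Metric.diam (M.elem i) * P.bdryForm i w w)) := by
  calc |∑ i ∈ M.cutElems Γ, κ i * (Metric.diam (M.elem i) * P.bdryForm i v w)|
      ≤ ∑ i ∈ M.cutElems Γ, |κ i * (Metric.diam (M.elem i) * P.bdryForm i v w)| :=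
        Finset.abs_sum_le_sum_abs _ _
    _ ≤ ∑ i ∈ M.cutElems Γ, K * (√(Metric.diam (M.elem i) * P.bdryForm i v v)
          * √(Metric.diam (M.elem i) * P.bdryForm i w w)) := by
        refine Finset.sum_le_sum fun i hi => ?_
        rw [mem_cutElems] at hi
        have hd : 0 ≤ Metric.diam (M.elem i) := Metric.diam_nonneg
        rw [abs_mul, abs_mul, abs_of_nonneg hd]
        refine mul_le_mul (hκ i hi) ?_ (by positivity) hK
        rw [Real.sqrt_mul hd, Real.sqrt_mul hd, mul_mul_mul_comm, Real.mul_self_sqrt hd]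
        exact mul_le_mul_of_nonneg_left (Vh.abs_bdryForm_le hv hw hi) hd
    _ = K * ∑ i ∈ M.cutElems Γ, √(Metric.diam (M.elem i) * P.bdryForm i v v)
          * √(Metric.diam (M.elem i) * P.bdryForm i w w) := by rw [Finset.mul_sum]
    _ ≤ _ := by
        refine mul_le_mul_of_nonneg_left ?_ hK
        have h0 : ∀ z ∈ P.Vh, ∑ i ∈ M.cutElems Γ, √(Metric.diam (M.elem i) * P.bdryForm i z z) ^ 2
            = ∑ i ∈ M.cutElems Γ, Metric.diam (M.elem i) * P.bdryForm i z z := fun z hz =>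
          Finset.sum_congr rfl fun i hi => Real.sq_sqrt (mul_nonneg Metric.diam_nonneg
            (Vh.bdryForm_self_nonneg hz (mem_cutElems.1 hi)))
        rw [← h0 v hv, ← h0 w hw, ← Real.sqrt_mul (Finset.sum_nonneg fun i _ => sq_nonneg _)]
        exact Real.le_sqrt_of_sq_le (Finset.sum_mul_sq_le_sq_mul_sq _ _ _)

end Cutting

end MaxwellVEM

namespace MaxwellVEM

/-! ### The error estimate -/

theorem abs_integral_mul_le {U : Set Plane} {f g : Plane → ℝ} (hf : MemLp f 2 (volume.restrict U))
    (hg : MemLp g 2 (volume.restrict U)) :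
    |∫ x in U, f x * g x| ≤ l2Norm U f * l2Norm U g := by
  have h := abs_integral_inner_le hg hf
  simpa [mul_comm] using h

theorem MemLp.bdd_smul {F : Type*} [NormedAddCommGroup F] [NormedSpace ℝ F] {μ : Measure Plane}
    {κ : Plane → ℝ} {K : ℝ} (hκ : Measurable κ) (hK : ∀ x, |κ x| ≤ K) {g : Plane → F}
    (hg : MemLp g 2 μ) : MemLp (fun x => κ x • g x) 2 μ := by
  refine hg.of_le_mul (c := K) (hκ.aestronglyMeasurable.smul hg.1) (Eventually.of_forall fun x => ?_)
  rw [norm_smul]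
  exact mul_le_mul_of_nonneg_right (hK x) (norm_nonneg _)

namespace Cutting

variable {Ω Γ : Set Plane} {M : BackgroundMesh Ω} (P : Cutting M Γ) {i : Fin M.n}

theorem abs_modified_le {κ : Plane → ℝ} {K : ℝ} (hK : ∀ x, |κ x| ≤ K) (x : Plane) :
    |P.modified κ x| ≤ K := by
  obtain ⟨y, hy⟩ := P.modified_mem_range κ x
  rw [← hy]
  exact hK y

theorem le_modified {κ : Plane → ℝ} {k : ℝ} (hk : ∀ x, k ≤ κ x) (x : Plane) :
    k ≤ P.modified κ x := by
  obtain ⟨y, hy⟩ := P.modified_mem_range κ x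
  rw [← hy]
  exact hk y

theorem aForm_sub_left (hΩ : IsOpen Ω) (hfin : volume Ω ≠ ⊤) {α β : Plane → ℝ}
    (hα : Measurable α) (hβ : Measurable β) {K : ℝ} (hαK : ∀ x, |α x| ≤ K)
    (hβK : ∀ x, |β x| ≤ K) (γ : Fin M.n → ℝ) {v w z : Plane → Plane} (hv : v ∈ P.Vh)
    (hw : w ∈ P.Vh) (hz : z ∈ P.Vh) :
    P.aForm α β γ (v - w) z = P.aForm α β γ v z - P.aForm α β γ w z := by
  have hαm := P.measurable_modified hα
  have hβm := P.measurable_modified hβ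
  have e1 : ∫ x in Ω, P.modified α x * weakCurl Ω (v - w) x * weakCurl Ω z x
      = (∫ x in Ω, P.modified α x * weakCurl Ω v x * weakCurl Ω z x)
        - ∫ x in Ω, P.modified α x * weakCurl Ω w x * weakCurl Ω z x := by
    have hi : ∀ y ∈ P.Vh, IntegrableOn
        (fun x => P.modified α x * weakCurl Ω y x * weakCurl Ω z x) Ω := fun y hy =>
      (MemLp.bdd_smul hαm (P.abs_modified_le hαK) hy.1.1.memLp_weakCurl).integrable_mul
        hz.1.1.memLp_weakCurl
    rw [← integral_sub (hi v hv) (hi w hw)]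
    refine integral_congr_ae ?_
    filter_upwards [weakCurl_sub hΩ hfin hv.1.1 hw.1.1] with x hx
    rw [hx]; ring
  have e2 : ∫ x in Ω, P.modified β x * inner ℝ (P.projH (v - w) x) (P.projH z x)
      = (∫ x in Ω, P.modified β x * inner ℝ (P.projH v x) (P.projH z x))
        - ∫ x in Ω, P.modified β x * inner ℝ (P.projH w x) (P.projH z x) := by
    have hi : ∀ y ∈ P.Vh, IntegrableOn
        (fun x => P.modified β x * inner ℝ (P.projH y x) (P.projH z x)) Ω := by
      intro y hy
      have := integrable_inner (MemLp.bdd_smul hβm (P.abs_modified_le hβK)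
        (P.memLp_projH hfin hy.1.1.1)) (P.memLp_projH hfin hz.1.1.1)
      simpa [IntegrableOn, inner_smul_left] using this
    rw [← integral_sub (hi v hv) (hi w hw)]
    congr 1
    ext x
    rw [P.projH_sub (fun i hi => Vh.integrableOn_quad hΩ hfin hv hi)
      (fun i hi => Vh.integrableOn_quad hΩ hfin hw hi), inner_sub_left, mul_sub]
  have e3 : ∑ i ∈ M.cutElems Γ,
        γ i * Metric.diam (M.elem i) * (β (M.vert i 0) * P.bdryForm i (v - w) z)
      = (∑ i ∈ M.cutElems Γ, γ i * Metric.diam (M.elem i) * (β (M.vert i 0) * P.bdryForm i v z))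
        - ∑ i ∈ M.cutElems Γ,
          γ i * Metric.diam (M.elem i) * (β (M.vert i 0) * P.bdryForm i w z) := by
    rw [← Finset.sum_sub_distrib]
    refine Finset.sum_congr rfl fun i hi => ?_
    rw [Vh.bdryForm_sub_left hΩ hfin hv hw hz (mem_cutElems.1 hi)]
    ring
  simp only [aForm]
  rw [e1, e2, e3]
  ring

/-- The error equation. -/
theorem aForm_error_eq (hΩ : IsOpen Ω) (hfin : volume Ω ≠ ⊤) {α β : Plane → ℝ}
    (hα : Measurable α) (hβ : Measurable β) {K : ℝ} (hαK : ∀ x, |α x| ≤ K)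
    (hβK : ∀ x, |β x| ≤ K) {γ : Fin M.n → ℝ} {f u uh vh : Plane → Plane}
    (hf : MemLp f 2 (volume.restrict Ω)) (hu : IsWeakSolution Ω α β f u)
    (huh : P.IsVEMSolution α β γ f uh) (hvh : vh ∈ P.Vh) :
    P.aForm α β γ (uh - vh) (uh - vh)
      = (∫ x in Ω, (α x * weakCurl Ω u x - P.modified α x * weakCurl Ω vh x)
            * weakCurl Ω (uh - vh) x)
        + (∫ x in Ω, inner ℝ (β x • u x - P.modified β x • P.projH vh x) ((uh - vh) x))
        - (∫ x in Ω, inner ℝ (f x - P.projH f x) ((uh - vh) x - P.projH (uh - vh) x))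
        - ∑ i ∈ M.cutElems Γ, γ i * β (M.vert i 0)
            * (Metric.diam (M.elem i) * P.bdryForm i vh (uh - vh)) := by
  have hη : uh - vh ∈ P.Vh := P.sub_mem_Vh hΩ hfin huh.1 hvh
  have hsub := P.aForm_sub_left hΩ hfin hα hβ hαK hβK γ huh.1 hvh hη
  set η := uh - vh with hηdef
  have hηL := hη.1.1.1
  have hπη := P.memLp_projH hfin hηL
  have hπf := P.memLp_projH hfin hf
  have hπv := P.memLp_projH hfin hvh.1.1.1
  have hcη := hη.1.1.memLp_weakCurl
  have hβπv : MemLp (fun x => P.modified β x • P.projH vh x) 2 (volume.restrict Ω) :=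
    MemLp.bdd_smul (P.measurable_modified hβ) (P.abs_modified_le hβK) hπv
  have hβu : MemLp (fun x => β x • u x) 2 (volume.restrict Ω) := MemLp.bdd_smul hβ hβK hu.1.1.1
  have I1 : ∫ x in Ω, (α x * weakCurl Ω u x - P.modified α x * weakCurl Ω vh x) * weakCurl Ω η x
      = (∫ x in Ω, α x * weakCurl Ω u x * weakCurl Ω η x)
        - ∫ x in Ω, P.modified α x * weakCurl Ω vh x * weakCurl Ω η x := by
    have i1 : IntegrableOn (fun x => α x * weakCurl Ω u x * weakCurl Ω η x) Ω :=
      (MemLp.bdd_smul hα hαK hu.1.1.memLp_weakCurl).integrable_mul hcη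
    have i2 : IntegrableOn (fun x => P.modified α x * weakCurl Ω vh x * weakCurl Ω η x) Ω :=
      (MemLp.bdd_smul (P.measurable_modified hα) (P.abs_modified_le hαK)
        hvh.1.1.memLp_weakCurl).integrable_mul hcη
    rw [← integral_sub i1 i2]
    simp only [sub_mul]
  -- The modified coefficient is constant on each quadrilateral, so `β_h Π v_h` is too; this lets `Π
  -- η` be replaced by `η` in the mass term.
  have O1 : ∫ x in Ω, inner ℝ (P.modified β x • P.projH vh x) (η x - P.projH η x) = 0 := by
    refine P.integral_inner_sub_projH_eq_zero hΩ hfin hβπv hηL fun i hi => ?_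
    exact ⟨_, fun x hx => by rw [P.modified_of_mem hi β hx, P.projH_of_mem hi vh hx]⟩
  -- This inserts `Π f` into the load error, so that the Poincaré inequality applies to `f - Π f`.
  have O2 : ∫ x in Ω, inner ℝ (P.projH f x) (η x - P.projH η x) = 0 := by
    refine P.integral_inner_sub_projH_eq_zero hΩ hfin hπf hηL fun i hi => ?_
    exact ⟨_, fun x hx => P.projH_of_mem hi f hx⟩
  have I2 : ∫ x in Ω, inner ℝ (β x • u x - P.modified β x • P.projH vh x) (η x)
      = (∫ x in Ω, β x * inner ℝ (u x) (η x))
        - ∫ x in Ω, P.modified β x * inner ℝ (P.projH vh x) (P.projH η x) := by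
    have s1 : ∫ x in Ω, inner ℝ (P.modified β x • P.projH vh x) (η x - P.projH η x)
        = (∫ x in Ω, inner ℝ (P.modified β x • P.projH vh x) (η x))
          - ∫ x in Ω, inner ℝ (P.modified β x • P.projH vh x) (P.projH η x) := by
      rw [← integral_sub (integrable_inner hβπv hηL) (integrable_inner hβπv hπη)]
      simp only [inner_sub_right]
    have s2 : ∫ x in Ω, inner ℝ (β x • u x - P.modified β x • P.projH vh x) (η x)
        = (∫ x in Ω, inner ℝ (β x • u x) (η x))
          - ∫ x in Ω, inner ℝ (P.modified β x • P.projH vh x) (η x) := by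
      rw [← integral_sub (integrable_inner hβu hηL) (integrable_inner hβπv hηL)]
      simp only [inner_sub_left]
    have s3 : ∫ x in Ω, inner ℝ (β x • u x) (η x) = ∫ x in Ω, β x * inner ℝ (u x) (η x) := by
      simp only [real_inner_smul_left]
    have s4 : ∫ x in Ω, inner ℝ (P.modified β x • P.projH vh x) (P.projH η x)
        = ∫ x in Ω, P.modified β x * inner ℝ (P.projH vh x) (P.projH η x) := by
      simp only [real_inner_smul_left]
    linarith
  have I3 : ∫ x in Ω, inner ℝ (f x - P.projH f x) (η x - P.projH η x)
      = (∫ x in Ω, inner ℝ (f x) (η x)) - ∫ x in Ω, inner ℝ (f x) (P.projH η x) := by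
    have hd : MemLp (fun x => η x - P.projH η x) 2 (volume.restrict Ω) := hηL.sub hπη
    have s1 : ∫ x in Ω, inner ℝ (f x - P.projH f x) (η x - P.projH η x)
        = (∫ x in Ω, inner ℝ (f x) (η x - P.projH η x))
          - ∫ x in Ω, inner ℝ (P.projH f x) (η x - P.projH η x) := by
      rw [← integral_sub (integrable_inner hf hd) (integrable_inner hπf hd)]
      simp only [inner_sub_left]
    have s2 : ∫ x in Ω, inner ℝ (f x) (η x - P.projH η x)
        = (∫ x in Ω, inner ℝ (f x) (η x)) - ∫ x in Ω, inner ℝ (f x) (P.projH η x) := by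
      rw [← integral_sub (integrable_inner hf hηL) (integrable_inner hf hπη)]
      simp only [inner_sub_right]
    linarith
  have I4 : ∑ i ∈ M.cutElems Γ, γ i * β (M.vert i 0)
            * (Metric.diam (M.elem i) * P.bdryForm i vh η)
      = ∑ i ∈ M.cutElems Γ,
          γ i * Metric.diam (M.elem i) * (β (M.vert i 0) * P.bdryForm i vh η) :=
    Finset.sum_congr rfl fun i _ => by ring
  have h1 := huh.2 η hη
  have h2 := hu.2 η hη.1
  have h3 : P.aForm α β γ vh η
      = (∫ x in Ω, P.modified α x * weakCurl Ω vh x * weakCurl Ω η x)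
        + (∫ x in Ω, P.modified β x * inner ℝ (P.projH vh x) (P.projH η x))
        + ∑ i ∈ M.cutElems Γ,
          γ i * Metric.diam (M.elem i) * (β (M.vert i 0) * P.bdryForm i vh η) := rfl
  rw [hsub, I1, I2, I3, I4, h1, h3]
  linarith

/-- The discrete energy norm controls each of its parts, and it is controlled by the bilinear
form. -/
theorem energyNorm_spec {α β : Plane → ℝ} (hfin : volume Ω ≠ ⊤)
    (hα : Measurable α) (hβ : Measurable β) {K : ℝ} (hαK : ∀ x, |α x| ≤ K)
    (hβK : ∀ x, |β x| ≤ K) {a b : ℝ} (ha0 : 0 < a) (hb0 : 0 < b) (ha : ∀ x, a ≤ α x)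
    (hb : ∀ x, b ≤ β x) {γ : Fin M.n → ℝ} {γ₀ : ℝ} (hγ₀ : 0 < γ₀)
    (hγ : ∀ i, M.IsCut Γ i → γ₀ ≤ γ i) {v : Plane → Plane} (hv : v ∈ P.Vh) :
    a * l2Norm Ω (weakCurl Ω v) ^ 2 ≤ P.energyNorm α β v ^ 2 ∧
      b * l2Norm Ω (P.projH v) ^ 2 ≤ P.energyNorm α β v ^ 2 ∧
      ∑ i ∈ M.cutElems Γ, Metric.diam (M.elem i) * P.bdryForm i v v ≤ P.energyNorm α β v ^ 2 ∧
      min 1 (γ₀ * b) * P.energyNorm α β v ^ 2 ≤ P.aForm α β γ v v := by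
  have hπ := P.memLp_projH hfin hv.1.1.1
  have hc := hv.1.1.memLp_weakCurl
  have hS3 : ∀ i ∈ M.cutElems Γ, 0 ≤ Metric.diam (M.elem i) * P.bdryForm i v v := fun i hi =>
    mul_nonneg Metric.diam_nonneg (Vh.bdryForm_self_nonneg hv (mem_cutElems.1 hi))
  set S₁ := ∫ x in Ω, P.modified α x * weakCurl Ω v x ^ 2 with hS₁
  set S₂ := ∫ x in Ω, P.modified β x * ‖P.projH v x‖ ^ 2 with hS₂
  set S₃ := ∑ i ∈ M.cutElems Γ, Metric.diam (M.elem i) * P.bdryForm i v v with hS₃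
  have i1 : IntegrableOn (fun x => P.modified α x * weakCurl Ω v x ^ 2) Ω := by
    have : IntegrableOn (fun x => P.modified α x * weakCurl Ω v x * weakCurl Ω v x) Ω :=
      (MemLp.bdd_smul (P.measurable_modified hα) (P.abs_modified_le hαK) hc).integrable_mul hc
    simpa [mul_assoc, sq] using this
  have i2 : IntegrableOn (fun x => P.modified β x * ‖P.projH v x‖ ^ 2) Ω := by
    have := integrable_inner (MemLp.bdd_smul (P.measurable_modified hβ)
      (P.abs_modified_le hβK) hπ) hπ
    simpa [IntegrableOn, real_inner_smul_left, real_inner_self_eq_norm_sq] using this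
  have l1 : a * l2Norm Ω (weakCurl Ω v) ^ 2 ≤ S₁ := by
    rw [l2Norm_sq, ← integral_const_mul]
    refine integral_mono ((hc.integrable_norm_pow (by norm_num)).const_mul a) i1 fun x => ?_
    simp only [Real.norm_eq_abs, sq_abs]
    exact mul_le_mul_of_nonneg_right (P.le_modified ha x) (sq_nonneg _)
  have l2 : b * l2Norm Ω (P.projH v) ^ 2 ≤ S₂ := by
    rw [l2Norm_sq, ← integral_const_mul]
    refine integral_mono ((hπ.integrable_norm_pow (by norm_num)).const_mul b) i2 fun x => ?_
    exact mul_le_mul_of_nonneg_right (P.le_modified hb x) (sq_nonneg _)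
  have p1 : 0 ≤ S₁ := le_trans (by positivity) l1
  have p2 : 0 ≤ S₂ := le_trans (by positivity) l2
  have p3 : 0 ≤ S₃ := Finset.sum_nonneg hS3
  have hX : P.energyNorm α β v ^ 2 = S₁ + S₂ + S₃ := Real.sq_sqrt (by positivity)
  have hform : P.aForm α β γ v v = S₁ + S₂ + ∑ i ∈ M.cutElems Γ,
      γ i * Metric.diam (M.elem i) * (β (M.vert i 0) * P.bdryForm i v v) := by
    simp only [aForm, real_inner_self_eq_norm_sq, mul_assoc, ← sq]
    rw [hS₁, hS₂]
  have l3 : γ₀ * b * S₃ ≤ ∑ i ∈ M.cutElems Γ,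
      γ i * Metric.diam (M.elem i) * (β (M.vert i 0) * P.bdryForm i v v) := by
    rw [hS₃, Finset.mul_sum]
    refine Finset.sum_le_sum fun i hi => ?_
    have h1 : γ₀ * b ≤ γ i * β (M.vert i 0) :=
      mul_le_mul (hγ i (mem_cutElems.1 hi)) (hb _) hb0.le
        (hγ₀.le.trans (hγ i (mem_cutElems.1 hi)))
    have := mul_le_mul_of_nonneg_right h1 (hS3 i hi)
    linarith
  rw [hX, hform]
  refine ⟨by linarith, by linarith, by linarith, ?_⟩
  -- The curl and mass terms agree in the form and in the norm. The boundary term of the form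
  -- carries the weight `γ β_h ≥ γ₀ b`, that of the norm carries none.
  have m1 : min 1 (γ₀ * b) * (S₁ + S₂) ≤ 1 * (S₁ + S₂) :=
    mul_le_mul_of_nonneg_right (min_le_left _ _) (by positivity)
  have m2 : min 1 (γ₀ * b) * S₃ ≤ γ₀ * b * S₃ :=
    mul_le_mul_of_nonneg_right (min_le_right _ _) p3
  linarith

end Cutting

theorem le_sqrt_mul_of_mul_sq_le {a x y : ℝ} (ha : 0 < a) (hy : 0 ≤ y)
    (h : a * x ^ 2 ≤ y ^ 2) : x ≤ √(1 / a) * y := by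
  rw [← Real.sqrt_sq hy, ← Real.sqrt_mul (by positivity)]
  apply Real.le_sqrt_of_sq_le
  rw [one_div, inv_mul_eq_div, le_div_iff₀ ha]
  linarith

end MaxwellVEM

end

/-! ### Assembly of the error estimate -/

open MaxwellVEM in
theorem theorem4p1 (Ω : Set MaxwellVEM.Plane) (hΩo : IsOpen Ω) (hΩc : IsConnected Ω)
    (hΩb : Bornology.IsBounded Ω)
    (αm αp βm βp : ℝ) (hαm : 0 < αm) (hαp : 0 < αp) (hβm : 0 < βm) (hβp : 0 < βp)
    (θ γ₀ γ₁ : ℝ) (hθ : 0 < θ) (hγ₀ : 0 < γ₀) :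
    ∃ C : ℝ, 0 < C ∧
      ∀ (Γ Ωm Ωp : Set MaxwellVEM.Plane), MaxwellVEM.IsInterface Ω Γ Ωm Ωp →
      ∀ α : MaxwellVEM.Plane → ℝ, α = MaxwellVEM.coeff Ωp αm αp →
      ∀ β : MaxwellVEM.Plane → ℝ, β = MaxwellVEM.coeff Ωp βm βp →
      ∀ M : MaxwellVEM.BackgroundMesh Ω, M.ShapeRegular θ →
      ∀ P : MaxwellVEM.Cutting M Γ,
      ∀ γ : Fin M.n → ℝ, (∀ i, M.IsCut Γ i → γ₀ ≤ γ i ∧ γ i ≤ γ₁) →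
      ∀ f : MaxwellVEM.Plane → MaxwellVEM.Plane, MemLp f 2 (volume.restrict Ω) →
        (∀ i, M.IsCut Γ i → MaxwellVEM.MemH1Vec (interior (P.quad i)) f) →
      ∀ u : MaxwellVEM.Plane → MaxwellVEM.Plane, MaxwellVEM.IsWeakSolution Ω α β f u →
        MaxwellVEM.MemH1Curl Ωm u → MaxwellVEM.MemH1Curl Ωp u →
      ∀ uh : MaxwellVEM.Plane → MaxwellVEM.Plane, P.IsVEMSolution α β γ f uh →
      ∀ vh ∈ P.Vh,
        uh - vh ∈ P.Vh ∧
        P.energyNorm α β (uh - vh) ≤ C *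
          (√((∑ i ∈ M.cutElems Γ,
                Metric.diam (M.elem i) ^ 2 * MaxwellVEM.h1SeminormSq (interior (P.quad i)) f)
              + ∑ i ∈ M.cutElems Γ, Metric.diam (M.elem i) * P.bdryForm i vh vh)
            + MaxwellVEM.l2Norm (Ωm ∪ Ωp)
                (fun x => α x * MaxwellVEM.weakCurl Ω u x
                  - P.modified α x * MaxwellVEM.weakCurl Ω vh x)
            + MaxwellVEM.l2Norm Ω
                (fun x => β x • u x - P.modified β x • P.projH vh x)) := by
  have hfin : volume Ω ≠ ⊤ := hΩb.measure_lt_top.ne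
  set a := min αm αp
  set b := min βm βp
  have ha0 : 0 < a := lt_min hαm hαp
  have hb0 : 0 < b := lt_min hβm hβp
  set K := max (max αm αp) (max βm βp)
  -- Here `m` is the coercivity constant, and `c` bounds `‖η - Π η‖²` by the squared energy norm.
  -- The constants `k₁`, `k₂`, `k₃` belong to the curl error, the mass error, and the load and
  -- stabilization terms together. If `sin θ = 0`, the quotient in `c` is 0 by convention, which is
  -- harmless: no triangle has all angles at least such a `θ`.
  set m := min 1 (γ₀ * b)
  have hm0 : 0 < m := lt_min one_pos (mul_pos hγ₀ hb0)
  set c := 4 / Real.sin θ ^ 2 + Metric.diam Ω ^ 2 / a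
  have hc0 : 0 ≤ c := by positivity
  set k₁ := √(1 / a)
  set k₂ := √(1 / b) + √c
  set k₃ := 2 * √c + |γ₁| * K
  have hK0 : 0 ≤ K := hαm.le.trans ((le_max_left _ _).trans (le_max_left _ _))
  refine ⟨(k₁ + k₂ + k₃) / m + 1, by positivity, ?_⟩
  intro Γ Ωm Ωp hI α hα β hβ M hM P γ hγ f hf hf1 u hu _ _ uh huh vh hvh
  have hη := P.sub_mem_Vh hΩo hfin huh.1 hvh
  refine ⟨hη, ?_⟩
  have hαmeas : Measurable α := by
    rw [hα]; exact measurable_coeff hI.open_p.measurableSet _ _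
  have hβmeas : Measurable β := by
    rw [hβ]; exact measurable_coeff hI.open_p.measurableSet _ _
  have hαa : ∀ x, a ≤ α x := fun x => by rw [hα]; exact (coeff_mem Ωp αm αp x).1
  have hβb : ∀ x, b ≤ β x := fun x => by rw [hβ]; exact (coeff_mem Ωp βm βp x).1
  have hαK : ∀ x, |α x| ≤ K := fun x => by
    rw [abs_of_pos (ha0.trans_le (hαa x)), hα]
    exact (coeff_mem Ωp αm αp x).2.trans (le_max_left _ _)
  have hβK : ∀ x, |β x| ≤ K := fun x => by
    rw [abs_of_pos (hb0.trans_le (hβb x)), hβ]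
    exact (coeff_mem Ωp βm βp x).2.trans (le_max_right _ _)
  have herr := P.aForm_error_eq hΩo hfin hαmeas hβmeas hαK hβK hf hu huh hvh
  obtain ⟨q1, q2, q3, q4⟩ := P.energyNorm_spec hfin hαmeas hβmeas hαK hβK ha0 hb0 hαa hβb hγ₀
    (fun i hi => (hγ i hi).1) hη
  have hδ := P.l2Norm_sub_projH_sq_le_bdryForm hθ hM hΩo hΩb hfin hη
  have hfδ := P.l2Norm_sub_projH_sq_le_h1SeminormSq hΩo hfin hf hf1
  -- The subdomains miss only the curve, which is a null set.
  have hset : (Ωm ∪ Ωp : Set Plane) =ᵐ[volume] Ω := by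
    rw [hI.union_eq]
    exact sdiff_null_ae_eq_self hI.curve.volume_eq_zero
  have hl2 : ∀ g : Plane → ℝ, l2Norm (Ωm ∪ Ωp) g = l2Norm Ω g := fun g => by
    rw [l2Norm, l2Norm, setIntegral_congr_set hset]
  rw [hl2]
  have hstab := Cutting.Vh.abs_sum_bdryForm_le hvh hη (κ := fun i => γ i * β (M.vert i 0))
    (K := |γ₁| * K) (by positivity) (fun i hi => by
      rw [abs_mul]
      have h1 := (hγ i hi).1
      have h2 := (hγ i hi).2
      have h3 : |γ i| ≤ |γ₁| := by
        rw [abs_of_pos (hγ₀.trans_le h1)]; exact h2.trans (le_abs_self _)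
      exact mul_le_mul h3 (hβK _) (abs_nonneg _) (abs_nonneg _))
  set η := uh - vh
  set X := P.energyNorm α β η
  have hX0 : 0 ≤ X := Real.sqrt_nonneg _
  set Sf := ∑ i ∈ M.cutElems Γ, Metric.diam (M.elem i) ^ 2 * h1SeminormSq (interior (P.quad i)) f
  set Sv := ∑ i ∈ M.cutElems Γ, Metric.diam (M.elem i) * P.bdryForm i vh vh
  have hSf0 : 0 ≤ Sf := by
    have := sq_nonneg (l2Norm Ω fun x => f x - P.projH f x)
    linarith
  have hSv0 : 0 ≤ Sv := Finset.sum_nonneg fun i hi =>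
    mul_nonneg Metric.diam_nonneg
      (Cutting.Vh.bdryForm_self_nonneg hvh (Cutting.mem_cutElems.1 hi))
  set R := √(Sf + Sv)
  set B₁ := l2Norm Ω fun x => α x * weakCurl Ω u x - P.modified α x * weakCurl Ω vh x
  set B₂ := l2Norm Ω fun x => β x • u x - P.modified β x • P.projH vh x
  have hB₁ : 0 ≤ B₁ := l2Norm_nonneg _ _
  have hB₂ : 0 ≤ B₂ := l2Norm_nonneg _ _
  have hR0 : 0 ≤ R := Real.sqrt_nonneg _
  have hcurl : l2Norm Ω (weakCurl Ω η) ≤ k₁ * X := le_sqrt_mul_of_mul_sq_le ha0 hX0 q1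
  have hproj : l2Norm Ω (P.projH η) ≤ √(1 / b) * X := le_sqrt_mul_of_mul_sq_le hb0 hX0 q2
  -- The energy norm contains no bare `η`, only `Π η`; this bound also yields control of `‖η‖`,
  -- needed against the mass error.
  have hδX : l2Norm Ω (fun x => η x - P.projH η x) ≤ √c * X := by
    rw [← Real.sqrt_sq hX0, ← Real.sqrt_mul hc0]
    apply Real.le_sqrt_of_sq_le
    refine hδ.trans ?_
    have h1 : l2Norm Ω (weakCurl Ω η) ^ 2 ≤ X ^ 2 / a := by
      rw [le_div_iff₀ ha0]; linarith
    calc _ ≤ 4 / Real.sin θ ^ 2 * X ^ 2 + Metric.diam Ω ^ 2 * (X ^ 2 / a) := by gcongr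
      _ = c * X ^ 2 := by simp only [c]; ring
  have hηL := hη.1.1.1
  have hπη := P.memLp_projH hfin hηL
  have hηX : l2Norm Ω η ≤ k₂ * X := by
    have h := l2Norm_add_le hπη (hηL.sub hπη)
    have e : (fun x => P.projH η x + (η - P.projH η) x) = η := by ext1 x; simp
    rw [e] at h
    have e2 : l2Norm Ω (η - P.projH η) = l2Norm Ω (fun x => η x - P.projH η x) := rfl
    rw [e2] at h
    calc l2Norm Ω η ≤ √(1 / b) * X + √c * X := by linarith
      _ = k₂ * X := by simp only [k₂]; ring
  -- The 2 is the square root of the Poincaré constant 4.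
  have hfR : l2Norm Ω (fun x => f x - P.projH f x) ≤ 2 * R := by
    refine abs_le_of_sq_le_sq' ?_ (by positivity) |>.2
    rw [mul_pow, Real.sq_sqrt (by positivity)]
    linarith
  have T1 := abs_integral_mul_le (MemLp.sub
    (MemLp.bdd_smul hαmeas hαK hu.1.1.memLp_weakCurl)
    (MemLp.bdd_smul (P.measurable_modified hαmeas) (P.abs_modified_le hαK)
      hvh.1.1.memLp_weakCurl)) hη.1.1.memLp_weakCurl
  have T2 := abs_integral_inner_le (MemLp.sub (MemLp.bdd_smul hβmeas hβK hu.1.1.1)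
    (MemLp.bdd_smul (P.measurable_modified hβmeas) (P.abs_modified_le hβK)
      (P.memLp_projH hfin hvh.1.1.1))) hηL
  have T3 := abs_integral_inner_le (hf.sub (P.memLp_projH hfin hf)) (hηL.sub hπη)
  change |∫ x in Ω, (α x * weakCurl Ω u x - P.modified α x * weakCurl Ω vh x)
    * weakCurl Ω η x| ≤ B₁ * _ at T1
  change |∫ x in Ω, inner ℝ (β x • u x - P.modified β x • P.projH vh x) (η x)| ≤ B₂ * _ at T2
  change |∫ x in Ω, inner ℝ (f x - P.projH f x) (η x - P.projH η x)|
    ≤ l2Norm Ω (fun x => f x - P.projH f x) * l2Norm Ω (fun x => η x - P.projH η x) at T3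
  have U1 : B₁ * l2Norm Ω (weakCurl Ω η) ≤ B₁ * (k₁ * X) := by gcongr
  have U2 : B₂ * l2Norm Ω η ≤ B₂ * (k₂ * X) := by gcongr
  have U3 : l2Norm Ω (fun x => f x - P.projH f x) * l2Norm Ω (fun x => η x - P.projH η x)
      ≤ 2 * R * (√c * X) :=
    mul_le_mul hfR hδX (l2Norm_nonneg _ _) (by positivity)
  have U4 : √Sv * √(∑ i ∈ M.cutElems Γ, Metric.diam (M.elem i) * P.bdryForm i η η) ≤ R * X := by
    refine mul_le_mul (Real.sqrt_le_sqrt (by linarith)) ?_ (Real.sqrt_nonneg _) hR0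
    rw [← Real.sqrt_sq hX0]
    exact Real.sqrt_le_sqrt q3
  have U4' := mul_le_mul_of_nonneg_left U4 (by positivity : 0 ≤ |γ₁| * K)
  have hk₁ : 0 ≤ k₁ := Real.sqrt_nonneg _
  have hk₂ : 0 ≤ k₂ := by positivity
  have hk₃ : 0 ≤ k₃ := by positivity
  have main : m * X ^ 2 ≤ (k₁ * B₁ + k₂ * B₂ + k₃ * R) * X := by
    have e : (k₁ * B₁ + k₂ * B₂ + k₃ * R) * X
        = B₁ * (k₁ * X) + B₂ * (k₂ * X) + 2 * R * (√c * X) + |γ₁| * K * (R * X) := by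
      simp only [k₃]; ring
    rw [e]
    have := (abs_le.1 T1).2
    have := (abs_le.1 T2).2
    have := (abs_le.1 T3).1
    have := (abs_le.1 hstab).1
    linarith
  have main' : m * X ≤ k₁ * B₁ + k₂ * B₂ + k₃ * R := by
    -- One factor `X` is cancelled; for `X = 0` the claim is nonnegativity of the right side.
    rcases hX0.eq_or_lt with h | h
    · rw [← h, mul_zero]; positivity
    · refine le_of_mul_le_mul_right ?_ h
      calc m * X * X = m * X ^ 2 := by ring
        _ ≤ _ := main
  have hsum : k₁ * B₁ + k₂ * B₂ + k₃ * R ≤ (k₁ + k₂ + k₃) * (R + B₁ + B₂) := by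
    have h1 : k₁ * B₁ ≤ k₁ * (R + B₁ + B₂) := by gcongr; linarith
    have h2 : k₂ * B₂ ≤ k₂ * (R + B₁ + B₂) := by gcongr; linarith
    have h3 : k₃ * R ≤ k₃ * (R + B₁ + B₂) := by gcongr; linarith
    linarith
  calc X ≤ (k₁ + k₂ + k₃) * (R + B₁ + B₂) / m := by
        rw [le_div_iff₀ hm0]; linarith
    _ = (k₁ + k₂ + k₃) / m * (R + B₁ + B₂) := by ring
    _ ≤ ((k₁ + k₂ + k₃) / m + 1) * (R + B₁ + B₂) := by
        have : 0 ≤ R + B₁ + B₂ := by positivity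
        gcongr
        linarith
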